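/- Let $q(i,j;n)$ be the number of $n$-step walks that start at $(0,0)$, stay in $\mathbb{N}^2$, end at $(i,j)$, and take their steps in the multiset $\{(-1,-1),(-1,0),(1,-1),(1,0),(1,0),(1,1)\}$ (the two copies of the east step $(1,0)$ being distinguished), and let $$Q(x,y;t)=\sum_{i,j,n\ge 0}q(i,j;n)\,x^iy^jt^n\in\mathbb{Q}[x,y][[t]].$$ Then $Q(x,y;t)$ is algebraic of degree $12$ over $\mathbb{Q}(x,y,t)$. It satisfies $$Q(x,y;t)=\frac{xy-t(1+x^2)Q(x,0;t)-t(1+y)Q(0,y;t)+tQ(0,0;t)}{xy\,\bigl(1-t(1+y^{-1})(x^{-1}+x(1+y))\bigr)}.$$ The specialisations $Q(x,0;t)$ and $Q(0,y;t)$ are given as follows. 1. There is a unique power series $T\in\mathbb{Q}[[t]]$ with constant term $0$ such that $T(1-4T^2)=t$, and a unique power series $S\in\mathbb{Q}[[t]]$ with constant term $0$ such that $S=T(1+S^2)$. For power series $S$ with constant term $0$, the latter equation is equivalent to $S(1-S^2)^2=t(1+S^2)^3$. 2. $Q(x,0;t)$ is algebraic of degree $12$ over $\mathbb{Q}(x,t)$,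 of degree $2$ over $\mathbb{Q}(x,S)$, and $$Q(x,0;t)=\left(\frac{1+S^2}{1-S^2}\right)^3\frac{x(1+6S^2+S^4)-2S(1-S^2)(1+x^2)-(x-2S+xS^2)\sqrt{(1-S^2)^2-4xS(1+S^2)}}{2x(1+x^2)S^2},$$ where the square root is the unique one in $\mathbb{Q}[x][[t]]$ with constant term $1$. 3. There is a unique power series $W$ in $t$, with coefficients in $\mathbb{Q}[y]$ and constant term $0$, such that $W(1-(1+y)W)=T^2$. The series $Q(0,y;t)$ is algebraic of degree $6$ over $\mathbb{Q}(y,t)$, belongs to $\mathbb{Q}(T,W)$, and $$Q(0,y;t)=t^{-2}\,W\,(1-4T^2-2W).$$ 4. The coefficients $q(0,j;2n)$ of $Q(0,y;t)$ are doubly hypergeometric (the ratios $q(0,j;2n+2)/q(0,j;2n)$ and $q(0,j+1;2n)/q(0,j;2n)$ are rational functions of $n$ and $j$); explicitly, $$Q(0,y;t)=\sum_{n\ge j\ge 0}\frac{6\,(2j+1)!\,(6n+1)!\,(2n+j+1)!}{j!^2\,(3n)!\,(4n+2j+3)!\,(n-j)!\,(n+1)}\,y^jt^{2n}.$$ -/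

import Mathlib

noncomputable section

namespace QuadrantWalk

/-! ### Quadrant walks with a repeated east step -/

/-- The six steps `(-1,-1), (-1,0), (1,-1), (1,0), (1,0), (1,1)`; the east step `(1,0)` occurs
twice, and its two copies are distinguished in walks. -/
def step : Fin 6 → ℤ × ℤ :=
  ![(-1, -1), (-1, 0), (1, -1), (1, 0), (1, 0), (1, 1)]

/-- The position reached after the first `k` steps of the walk `w`, which starts at `(0,0)`. -/
def position {n : ℕ} (w : Fin n → Fin 6) (k : ℕ) : ℤ × ℤ :=
  ∑ i : Fin n with i.val < k, step (w i)

/-- The walk never leaves the quadrant `ℕ × ℕ`. -/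
def IsQuadrantWalk {n : ℕ} (w : Fin n → Fin 6) : Prop :=
  ∀ k ≤ n, 0 ≤ (position w k).1 ∧ 0 ≤ (position w k).2

/-- `q i j n` is the number of `n`-step quadrant walks that end at `(i,j)`. -/
def q (i j n : ℕ) : ℕ :=
  Nat.card {w : Fin n → Fin 6 // IsQuadrantWalk w ∧ position w n = ((i : ℤ), (j : ℤ))}

/-- A coordinate of a walk increases by at most `1` at each step. -/
theorem position_le {n : ℕ} (w : Fin n → Fin 6) (k : ℕ) :
    (position w k).1 ≤ n ∧ (position w k).2 ≤ n := by
  have h : ∀ a : Fin 6, (step a).1 ≤ 1 ∧ (step a).2 ≤ 1 := by decide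
  have hc : ((Finset.univ.filter fun i : Fin n => i.val < k).card : ℤ) ≤ n := by
    have := Finset.card_filter_le (Finset.univ : Finset (Fin n)) (fun i => i.val < k)
    rw [Finset.card_univ, Fintype.card_fin] at this
    exact_mod_cast this
  unfold position
  rw [Prod.fst_sum, Prod.snd_sum]
  constructor
  · refine le_trans (Finset.sum_le_card_nsmul _ _ 1 fun i _ => (h (w i)).1) ?_
    simpa using hc
  · refine le_trans (Finset.sum_le_card_nsmul _ _ 1 fun i _ => (h (w i)).2) ?_
    simpa using hc

theorem q_eq_zero {i j n : ℕ} (h : n < i ∨ n < j) : q i j n = 0 := by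
  have : IsEmpty {w : Fin n → Fin 6 //
      IsQuadrantWalk w ∧ position w n = ((i : ℤ), (j : ℤ))} := by
    refine ⟨fun ⟨w, _, hw⟩ => ?_⟩
    have := position_le w n
    rw [hw] at this
    simp only [Nat.cast_le] at this
    omega
  exact Nat.card_of_isEmpty

/-! ### Series in `t` -/

/-- The ring `ℚ[x,y][[t]]`; the variable `x` is `MvPolynomial.X 0`, `y` is `MvPolynomial.X 1`. -/
abbrev Series : Type := PowerSeries (MvPolynomial (Fin 2) ℚ)

/-- The field of fractions of `ℚ[x,y][[t]]`, which contains `ℚ(x,y,t)` and all our series. -/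
abbrev SeriesField : Type := FractionRing Series

/-- The complete generating function `Q(x,y;t) = ∑ q(i,j;n) x^i y^j t^n`. A walk of length `n`
ends at a point whose coordinates are at most `n`, so the inner sums are complete. -/
def Q : Series :=
  PowerSeries.mk fun n => ∑ i ∈ Finset.range (n + 1), ∑ j ∈ Finset.range (n + 1),
    (q i j n : MvPolynomial (Fin 2) ℚ) * MvPolynomial.X 0 ^ i * MvPolynomial.X 1 ^ j

/-- The coefficient of `x^i y^j t^n` in `Q(x,y;t)` is `q i j n`, for all `i, j, n`. -/
theorem coeff_Q (m : Fin 2 →₀ ℕ) (n : ℕ) :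
    MvPolynomial.coeff m (PowerSeries.coeff n Q) = (q (m 0) (m 1) n : ℚ) := by
  have key : ∀ i j : ℕ, MvPolynomial.coeff m ((q i j n : MvPolynomial (Fin 2) ℚ) *
      MvPolynomial.X 0 ^ i * MvPolynomial.X 1 ^ j) =
      if m 0 = i ∧ m 1 = j then (q i j n : ℚ) else 0 := by
    intro i j
    have e : (q i j n : MvPolynomial (Fin 2) ℚ) * MvPolynomial.X 0 ^ i * MvPolynomial.X 1 ^ j =
        MvPolynomial.monomial (Finsupp.single 0 i + Finsupp.single 1 j) (q i j n : ℚ) := by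
      rw [MvPolynomial.X_pow_eq_monomial, MvPolynomial.X_pow_eq_monomial, mul_assoc,
        MvPolynomial.monomial_mul, ← map_natCast (MvPolynomial.C (σ := Fin 2) (R := ℚ)),
        MvPolynomial.C_mul_monomial]
      simp
    rw [e, MvPolynomial.coeff_monomial]
    refine if_congr ?_ rfl rfl
    rw [Finsupp.ext_iff, Fin.forall_fin_two]
    simp [eq_comm]
  simp only [Q, PowerSeries.coeff_mk, MvPolynomial.coeff_sum, key]
  by_cases h : m 0 < n + 1 ∧ m 1 < n + 1
  · rw [Finset.sum_eq_single_of_mem (m 0) (by simpa using h.1) (fun b _ hb => by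
        apply Finset.sum_eq_zero; intro c _; rw [if_neg]; exact fun h' => hb h'.1.symm),
      Finset.sum_eq_single_of_mem (m 1) (by simpa using h.2) (fun b _ hb => by
        rw [if_neg]; exact fun h' => hb h'.2.symm)]
    simp
  · rw [q_eq_zero (by omega)]
    simp only [Nat.cast_zero]
    refine Finset.sum_eq_zero fun i hi => Finset.sum_eq_zero fun j hj => ?_
    rw [if_neg]
    simp only [Finset.mem_range] at hi hj
    omega

/-- Specialisation `F(a,b;t)` of a series `F(x,y;t)` at polynomials `a, b` in `x, y`. -/
def specialise (a b : MvPolynomial (Fin 2) ℚ) (F : Series) : Series :=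
  PowerSeries.map (MvPolynomial.aeval ![a, b] :
    MvPolynomial (Fin 2) ℚ →ₐ[ℚ] MvPolynomial (Fin 2) ℚ).toRingHom F

/-- `Q(x,0;t)`. -/
def Qx0 : Series := specialise (MvPolynomial.X 0) 0 Q

/-- `Q(0,y;t)`. -/
def Q0y : Series := specialise 0 (MvPolynomial.X 1) Q

/-- `Q(0,0;t)`. -/
def Q00 : Series := specialise 0 0 Q

/-- The inclusion of `ℚ[x,y][[t]]` in its field of fractions. -/
def emb : Series →+* SeriesField := algebraMap Series SeriesField

/-- The inclusion of `ℚ[[t]]`. -/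
def embT : PowerSeries ℚ →+* SeriesField :=
  emb.comp (PowerSeries.map MvPolynomial.C)

/-- The inclusion of `ℚ[x][[t]]`. -/
def embX : PowerSeries (Polynomial ℚ) →+* SeriesField :=
  emb.comp (PowerSeries.map (Polynomial.aeval (MvPolynomial.X 0 : MvPolynomial (Fin 2) ℚ)).toRingHom)

/-- The inclusion of `ℚ[y][[t]]`. -/
def embY : PowerSeries (Polynomial ℚ) →+* SeriesField :=
  emb.comp (PowerSeries.map (Polynomial.aeval (MvPolynomial.X 1 : MvPolynomial (Fin 2) ℚ)).toRingHom)

/-- The variable `x`. -/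
def x : SeriesField := emb (PowerSeries.C (MvPolynomial.X 0))

/-- The variable `y`. -/
def y : SeriesField := emb (PowerSeries.C (MvPolynomial.X 1))

/-- The variable `t`. -/
def t : SeriesField := emb PowerSeries.X

/-- `f` is algebraic of degree exactly `d` over the field `k`. -/
def AlgebraicOfDegree (k : IntermediateField ℚ SeriesField) (f : SeriesField) (d : ℕ) : Prop :=
  IsAlgebraic k f ∧ (minpoly k f).natDegree = d

/-! ### The auxiliary series -/

/-- `T` has constant term `0` and `T (1 - 4 T²) = t`. -/
def IsT (T : PowerSeries ℚ) : Prop :=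
  PowerSeries.constantCoeff T = 0 ∧ T * (1 - 4 * T ^ 2) = PowerSeries.X

/-- `S` has constant term `0` and `S = T (1 + S²)`. -/
def IsS (T S : PowerSeries ℚ) : Prop :=
  PowerSeries.constantCoeff S = 0 ∧ S = T * (1 + S ^ 2)

/-- `R`, in `ℚ[x][[t]]`, is the square root of `(1 - S²)² - 4 x S (1 + S²)` with
constant term `1`. -/
def IsR (S : PowerSeries ℚ) (R : PowerSeries (Polynomial ℚ)) : Prop :=
  PowerSeries.constantCoeff R = 1 ∧
    R ^ 2 = (1 - PowerSeries.map Polynomial.C S ^ 2) ^ 2 -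
      4 * PowerSeries.C Polynomial.X * PowerSeries.map Polynomial.C S *
        (1 + PowerSeries.map Polynomial.C S ^ 2)

/-- `W`, in `ℚ[y][[t]]`, has constant term `0` and `W (1 - (1 + y) W) = T²`. -/
def IsW (T : PowerSeries ℚ) (W : PowerSeries (Polynomial ℚ)) : Prop :=
  PowerSeries.constantCoeff W = 0 ∧
    W * (1 - (1 + PowerSeries.C Polynomial.X) * W) = PowerSeries.map Polynomial.C T ^ 2

/-! ### Hypergeometric coefficients -/

/-- `6 (2j+1)! (6n+1)! (2n+j+1)! / (j!² (3n)! (4n+2j+3)! (n-j)! (n+1))`, used only for `j ≤ n`. -/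
def coeffFormula (n j : ℕ) : ℚ :=
  (6 * (2 * j + 1).factorial * (6 * n + 1).factorial * (2 * n + j + 1).factorial : ℚ) /
    ((j.factorial : ℚ) ^ 2 * (3 * n).factorial * (4 * n + 2 * j + 3).factorial *
      (n - j).factorial * (n + 1))

/-- A double sequence is doubly hypergeometric if the two quotients `a(n+1,j)/a(n,j)` and
`a(n,j+1)/a(n,j)` are given by rational functions of `n` and `j` (denominators cleared). -/
def DoublyHypergeometric (a : ℕ → ℕ → ℚ) : Prop :=
  (∃ A B : MvPolynomial (Fin 2) ℚ, A ≠ 0 ∧ B ≠ 0 ∧ ∀ n j : ℕ,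
    MvPolynomial.eval ![(n : ℚ), (j : ℚ)] A * a (n + 1) j =
      MvPolynomial.eval ![(n : ℚ), (j : ℚ)] B * a n j) ∧
  (∃ A B : MvPolynomial (Fin 2) ℚ, A ≠ 0 ∧ B ≠ 0 ∧ ∀ n j : ℕ,
    MvPolynomial.eval ![(n : ℚ), (j : ℚ)] A * a n (j + 1) =
      MvPolynomial.eval ![(n : ℚ), (j : ℚ)] B * a n j)

end QuadrantWalk

end

/-! Removing the last step of a walk gives a linear functional equation for Q(x,y;t), with kernel xy
- t(1+y)(1+x²(1+y)). It determines the coefficient of t^(n+1) from that of t^n, so it has only one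
solution in ℚ[x,y][[t]] (`FunctionalEquation.eq_Q`), and it suffices to exhibit one.

Put w = 1+y and let D, R, V be the square roots with constant term 1 of 1-4T², D²-4xT and 1-4wT².
Then t = TD², D = (1-S²)/(1+S²) and V = 1-2wW. In these terms the kernel is a difference of squares
up to a factor: 4T(xy - tw(1+x²w)) = (RV)² - D²(1-2Txw)². The factor RV + D(1-2Txw) has constant
term 2. The solution can therefore be written with this factor in its denominator in place of the
kernel, which makes it visibly a power series with polynomial coefficients. Setting x = 0 turns R
into D and setting y = 0 turns V into D, so the boundary series are read off, and the functional
equation becomes an algebraic identity modulo the relations between t, T, D, R, V, W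
(`kernel_mul_formula`, `explicit_formulas`).

For the degrees, put α = (1-4T²-2/w)V and β = (1-2T/x)DR. Up to affine maps over the respective base
field, Q(x,y), Q(0,y) and Q(x,0) are α+β, α and D(2-D²)-β. The fields generated by (T,V,R), (T,V)
and (T,D,R) have degrees 3·2·2, 3·2 and 3·2·2: the cubic for T has no rational root, and the square
root of a linear polynomial in a transcendental is not rational in it (`not_mem_algebraicAdjoin`).
It remains to see that the single series generates its whole field. Both α² and β² depend on T only
through ξ = T²-6T⁴, and T is rational in t and ξ (`cubic_resolvent`); this settles α. For the other
two, a conjugate of T or D over the field generated by the series, if different, would make β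
rational in x over algebraic elements, which is impossible; so the only conjugate is T or D itself
(`mem_of_add_sqrt`, `mem_of_sub_sqrt`).

For the coefficients, t²Q(0,y;t) satisfies a partial differential equation that amounts to a
first-order recurrence in j (`pde_of_isW`), and D(2-D²) = 1+2t²Q(0,0;t) satisfies an ordinary one
that gives a recurrence in n for j = 0 (`ode_of_sqrt`). With q(0,0;0) = 1 these force the product
formula. -/

noncomputable section

namespace QuadrantWalk

/-! ### The functional equation -/

/-- The number of `n`-step quadrant walks that end at `p`, where `p` may be any lattice point. -/
def walkCount (p : ℤ × ℤ) (n : ℕ) : ℕ :=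
  Nat.card {w : Fin n → Fin 6 // IsQuadrantWalk w ∧ position w n = p}

theorem walkCount_natCast (i j n : ℕ) : walkCount (i, j) n = q i j n := rfl

theorem walkCount_eq_zero {p : ℤ × ℤ} {n : ℕ} (h : p.1 < 0 ∨ p.2 < 0) : walkCount p n = 0 := by
  have : IsEmpty {w : Fin n → Fin 6 // IsQuadrantWalk w ∧ position w n = p} := by
    refine ⟨fun ⟨w, hq, hw⟩ => ?_⟩
    have := hq n le_rfl
    rw [hw] at this
    omega
  exact Nat.card_of_isEmpty

theorem position_eq_sum {n : ℕ} (w : Fin n → Fin 6) (k : ℕ) :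
    position w k = ∑ i : Fin n, if i.val < k then step (w i) else 0 := by
  rw [position, Finset.sum_filter]

theorem position_succ_of_le {n : ℕ} (w : Fin (n + 1) → Fin 6) {k : ℕ} (hk : k ≤ n) :
    position w k = position (Fin.init w) k := by
  rw [position_eq_sum, position_eq_sum, Fin.sum_univ_castSucc]
  simp [Fin.init, hk]

theorem position_succ_last {n : ℕ} (w : Fin (n + 1) → Fin 6) :
    position w (n + 1) = position (Fin.init w) n + step (w (Fin.last n)) := by
  rw [position_eq_sum, position_eq_sum, Fin.sum_univ_castSucc]
  congr 1
  · refine Finset.sum_congr rfl fun i _ => ?_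
    have h1 : (i : ℕ) < n + 1 := by omega
    simp [Fin.init, h1]
  · simp

theorem isQuadrantWalk_succ {n : ℕ} (w : Fin (n + 1) → Fin 6) :
    IsQuadrantWalk w ↔ IsQuadrantWalk (Fin.init w) ∧
      0 ≤ (position w (n + 1)).1 ∧ 0 ≤ (position w (n + 1)).2 := by
  constructor
  · intro h
    refine ⟨fun k hk => ?_, h _ le_rfl⟩
    rw [← position_succ_of_le w hk]
    exact h k (by omega)
  · rintro ⟨h, h'⟩ k hk
    rcases Nat.lt_or_ge n k with hk' | hk'
    · obtain rfl : k = n + 1 := by omega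
      exact h'
    · rw [position_succ_of_le w hk']
      exact h k hk'

/-- A walk is its last step together with the walk before it. As `p` lies in the quadrant, the only
remaining constraint is that the shorter walk stays there too. -/
theorem walkCount_succ {p : ℤ × ℤ} (h1 : 0 ≤ p.1) (h2 : 0 ≤ p.2) (n : ℕ) :
    walkCount p (n + 1) = ∑ s, walkCount (p - step s) n := by
  let e : {w : Fin (n + 1) → Fin 6 // IsQuadrantWalk w ∧ position w (n + 1) = p} ≃
      Σ s, {w : Fin n → Fin 6 // IsQuadrantWalk w ∧ position w n = p - step s} :=
    { toFun := fun w => ⟨w.1 (Fin.last n), Fin.init w.1,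
        ((isQuadrantWalk_succ w.1).1 w.2.1).1, by
          have := position_succ_last w.1
          rw [w.2.2] at this
          exact eq_sub_of_add_eq this.symm⟩
      invFun := fun w => ⟨Fin.snoc w.2.1 w.1, by
          have hp : position (Fin.snoc w.2.1 w.1 : Fin (n + 1) → Fin 6) (n + 1) = p := by
            rw [position_succ_last, Fin.init_snoc, Fin.snoc_last, w.2.2.2]; simp
          refine ⟨(isQuadrantWalk_succ _).2 ⟨?_, ?_⟩, hp⟩
          · rw [Fin.init_snoc]; exact w.2.2.1
          · rw [hp]; exact ⟨h1, h2⟩⟩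
      left_inv := fun w => by
        apply Subtype.ext
        exact Fin.snoc_init_self _
      right_inv := fun w => by
        rcases w with ⟨s, w, hw⟩
        have h1 : (Fin.snoc w s : Fin (n + 1) → Fin 6) (Fin.last n) = s := Fin.snoc_last _ _
        have h2 : Fin.init (Fin.snoc w s : Fin (n + 1) → Fin 6) = w := Fin.init_snoc _ _
        apply Sigma.ext h1
        dsimp only
        congr! 4
        rw [h1] }
  unfold walkCount
  rw [Nat.card_congr e, Nat.card_sigma]

theorem walkCount_zero (p : ℤ × ℤ) : walkCount p 0 = if p = 0 then 1 else 0 := by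
  have hq : ∀ w : Fin 0 → Fin 6, IsQuadrantWalk w := by
    intro w k _
    simp [position]
  have hp : ∀ w : Fin 0 → Fin 6, position w 0 = 0 := fun w => by simp [position]
  split_ifs with h
  · subst h
    rw [walkCount, Nat.card_eq_one_iff_unique]
    exact ⟨⟨fun a b => Subtype.ext (Subsingleton.elim _ _)⟩, ⟨⟨Fin.elim0, hq _, hp _⟩⟩⟩
  · have : IsEmpty {w : Fin 0 → Fin 6 // IsQuadrantWalk w ∧ position w 0 = p} :=
      ⟨fun ⟨w, _, hw⟩ => h (by rw [← hw, hp])⟩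
    exact Nat.card_of_isEmpty

/-! ### The recursion on the number of steps -/

/-- The coefficient of `t^n` in `Q(x,y;t)`. -/
abbrev Qn (n : ℕ) : MvPolynomial (Fin 2) ℚ := PowerSeries.coeff n Q

/-- Counting walks at all points of ℤ² makes multiplication by a monomial a plain translation:
outside the quadrant both sides vanish. -/
theorem coeff_monomial_mul_Qn (a b n : ℕ) (m : Fin 2 →₀ ℕ) :
    MvPolynomial.coeff m (MvPolynomial.X 0 ^ a * MvPolynomial.X 1 ^ b * Qn n) =
      (walkCount ((m 0 : ℤ) - a, (m 1 : ℤ) - b) n : ℚ) := by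
  have e : (MvPolynomial.X 0 ^ a * MvPolynomial.X 1 ^ b : MvPolynomial (Fin 2) ℚ) =
      MvPolynomial.monomial (Finsupp.single 0 a + Finsupp.single 1 b) 1 := by
    rw [MvPolynomial.X_pow_eq_monomial, MvPolynomial.X_pow_eq_monomial,
      MvPolynomial.monomial_mul, one_mul]
  rw [e, MvPolynomial.coeff_monomial_mul']
  have hle : (Finsupp.single 0 a + Finsupp.single 1 b : Fin 2 →₀ ℕ) ≤ m ↔ a ≤ m 0 ∧ b ≤ m 1 := by
    rw [Finsupp.le_def, Fin.forall_fin_two]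
    simp
  split_ifs with h
  · have h' := hle.1 h
    rw [one_mul, coeff_Q, ← walkCount_natCast]
    simp [h'.1, h'.2]
  · rw [walkCount_eq_zero, Nat.cast_zero]
    rw [hle] at h
    dsimp only
    omega

theorem coeff_aeval_zero_left (p : MvPolynomial (Fin 2) ℚ) (m : Fin 2 →₀ ℕ) :
    MvPolynomial.coeff m (MvPolynomial.aeval ![(0 : MvPolynomial (Fin 2) ℚ), MvPolynomial.X 1] p) =
      if m 0 = 0 then MvPolynomial.coeff m p else 0 := by
  induction p using MvPolynomial.induction_on' with
  | monomial u a =>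
    rw [MvPolynomial.aeval_monomial, Finsupp.prod_fintype _ _ (by simp), Fin.prod_univ_two]
    simp only [Matrix.cons_val_zero, Matrix.cons_val_one, MvPolynomial.algebraMap_eq]
    by_cases hu : u 0 = 0
    · rw [hu, pow_zero, one_mul, MvPolynomial.X_pow_eq_monomial, MvPolynomial.C_mul_monomial,
        mul_one, MvPolynomial.coeff_monomial, MvPolynomial.coeff_monomial]
      have : Finsupp.single 1 (u 1) = u := by
        ext i; fin_cases i <;> simp [hu]
      rw [this]
      by_cases h : u = m
      · subst h; simp [hu]
      · simp [h]
    · rw [zero_pow hu, zero_mul, mul_zero, MvPolynomial.coeff_zero, MvPolynomial.coeff_monomial]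
      by_cases h : u = m
      · subst h; simp [hu]
      · simp [h]
  | add p q hp hq => rw [map_add, MvPolynomial.coeff_add, hp, hq, MvPolynomial.coeff_add]; split_ifs <;> simp

theorem coeff_aeval_zero_right (p : MvPolynomial (Fin 2) ℚ) (m : Fin 2 →₀ ℕ) :
    MvPolynomial.coeff m (MvPolynomial.aeval ![MvPolynomial.X 0, (0 : MvPolynomial (Fin 2) ℚ)] p) =
      if m 1 = 0 then MvPolynomial.coeff m p else 0 := by
  induction p using MvPolynomial.induction_on' with
  | monomial u a =>
    rw [MvPolynomial.aeval_monomial, Finsupp.prod_fintype _ _ (by simp), Fin.prod_univ_two]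
    simp only [Matrix.cons_val_zero, Matrix.cons_val_one, MvPolynomial.algebraMap_eq]
    by_cases hu : u 1 = 0
    · rw [hu, pow_zero, mul_one, MvPolynomial.X_pow_eq_monomial, MvPolynomial.C_mul_monomial,
        mul_one, MvPolynomial.coeff_monomial, MvPolynomial.coeff_monomial]
      have : Finsupp.single 0 (u 0) = u := by
        ext i; fin_cases i <;> simp [hu]
      rw [this]
      by_cases h : u = m
      · subst h; simp [hu]
      · simp [h]
    · rw [zero_pow hu, mul_zero, mul_zero, MvPolynomial.coeff_zero, MvPolynomial.coeff_monomial]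
      by_cases h : u = m
      · subst h; simp [hu]
      · simp [h]
  | add p q hp hq => rw [map_add, MvPolynomial.coeff_add, hp, hq, MvPolynomial.coeff_add]; split_ifs <;> simp

theorem aeval_zero_zero (p : MvPolynomial (Fin 2) ℚ) :
    MvPolynomial.aeval ![(0 : MvPolynomial (Fin 2) ℚ), 0] p =
      MvPolynomial.aeval ![(0 : MvPolynomial (Fin 2) ℚ), MvPolynomial.X 1]
        (MvPolynomial.aeval ![MvPolynomial.X 0, (0 : MvPolynomial (Fin 2) ℚ)] p) := by
  rw [← AlgHom.comp_apply]
  congr 1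
  ext i
  fin_cases i <;> simp

theorem coeff_specialise (a b : MvPolynomial (Fin 2) ℚ) (F : Series) (n : ℕ) :
    PowerSeries.coeff n (specialise a b F) =
      MvPolynomial.aeval ![a, b] (PowerSeries.coeff n F) := by
  simp [specialise, PowerSeries.coeff_map]

/-- The contribution of walks of length `n` to the right-hand side of the functional equation. -/
def stepPoly (p : MvPolynomial (Fin 2) ℚ) : MvPolynomial (Fin 2) ℚ :=
  (1 + MvPolynomial.X 1) * (1 + MvPolynomial.X 0 ^ 2 * (1 + MvPolynomial.X 1)) * p
    - (1 + MvPolynomial.X 0 ^ 2) * MvPolynomial.aeval ![MvPolynomial.X 0, 0] p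
    - (1 + MvPolynomial.X 1) * MvPolynomial.aeval ![0, MvPolynomial.X 1] p
    + MvPolynomial.aeval ![0, 0] p

theorem Qn_zero : Qn 0 = 1 := by
  simp only [Qn, Q, PowerSeries.coeff_mk]
  simp [← walkCount_natCast, walkCount_zero]

/-- Inclusion-exclusion on the last step. Multiplied by xy, the step polynomial is (1+y)(1+x²(1+y)).
South steps from the x-axis and west steps from the y-axis are removed, and the south-west step at
the origin, removed twice, is restored. -/
theorem monomials_mul_Qn_succ (n : ℕ) :
    MvPolynomial.X 0 * MvPolynomial.X 1 * Qn (n + 1) = stepPoly (Qn n) := by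
  ext m
  have hL : MvPolynomial.X 0 * MvPolynomial.X 1 * Qn (n + 1) =
      MvPolynomial.X 0 ^ 1 * MvPolynomial.X 1 ^ 1 * Qn (n + 1) := by ring
  have hx : ∀ p : MvPolynomial (Fin 2) ℚ, MvPolynomial.aeval ![MvPolynomial.X 0, (0 : MvPolynomial (Fin 2) ℚ)]
      (MvPolynomial.X 0 ^ 2 * p) =
        MvPolynomial.X 0 ^ 2 * MvPolynomial.aeval ![MvPolynomial.X 0, (0 : MvPolynomial (Fin 2) ℚ)] p := by
    intro p; simp
  have hy : ∀ p : MvPolynomial (Fin 2) ℚ, MvPolynomial.aeval ![(0 : MvPolynomial (Fin 2) ℚ), MvPolynomial.X 1]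
      (MvPolynomial.X 1 * p) =
        MvPolynomial.X 1 * MvPolynomial.aeval ![(0 : MvPolynomial (Fin 2) ℚ), MvPolynomial.X 1] p := by
    intro p; simp
  have hR : stepPoly (Qn n) =
      MvPolynomial.X 0 ^ 0 * MvPolynomial.X 1 ^ 0 * Qn n
      + MvPolynomial.X 0 ^ 0 * MvPolynomial.X 1 ^ 1 * Qn n
      + MvPolynomial.X 0 ^ 2 * MvPolynomial.X 1 ^ 0 * Qn n
      + MvPolynomial.X 0 ^ 2 * MvPolynomial.X 1 ^ 1 * Qn n
      + MvPolynomial.X 0 ^ 2 * MvPolynomial.X 1 ^ 1 * Qn n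
      + MvPolynomial.X 0 ^ 2 * MvPolynomial.X 1 ^ 2 * Qn n
      - MvPolynomial.aeval ![MvPolynomial.X 0, (0 : MvPolynomial (Fin 2) ℚ)] (MvPolynomial.X 0 ^ 0 * MvPolynomial.X 1 ^ 0 * Qn n)
      - MvPolynomial.aeval ![MvPolynomial.X 0, (0 : MvPolynomial (Fin 2) ℚ)] (MvPolynomial.X 0 ^ 2 * MvPolynomial.X 1 ^ 0 * Qn n)
      - MvPolynomial.aeval ![(0 : MvPolynomial (Fin 2) ℚ), MvPolynomial.X 1] (MvPolynomial.X 0 ^ 0 * MvPolynomial.X 1 ^ 0 * Qn n)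
      - MvPolynomial.aeval ![(0 : MvPolynomial (Fin 2) ℚ), MvPolynomial.X 1] (MvPolynomial.X 0 ^ 0 * MvPolynomial.X 1 ^ 1 * Qn n)
      + MvPolynomial.aeval ![(0 : MvPolynomial (Fin 2) ℚ), MvPolynomial.X 1] (MvPolynomial.aeval
          ![MvPolynomial.X 0, (0 : MvPolynomial (Fin 2) ℚ)]
          (MvPolynomial.X 0 ^ 0 * MvPolynomial.X 1 ^ 0 * Qn n)) := by
    simp only [pow_zero, one_mul, mul_one, pow_one, hx, hy, stepPoly, aeval_zero_zero]
    ring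
  rw [hL, hR]
  clear hL hR hx hy
  simp only [MvPolynomial.coeff_add, MvPolynomial.coeff_sub, coeff_aeval_zero_left,
    coeff_aeval_zero_right, coeff_monomial_mul_Qn]
  have hneg : ∀ (p : ℤ × ℤ), p.1 < 0 ∨ p.2 < 0 → ∀ k, walkCount p k = 0 :=
    fun p h k => walkCount_eq_zero h
  -- On either axis the left side has coefficient 0 and the correction terms cancel the forbidden
  -- steps. In the interior all corrections vanish and `walkCount_succ` applies.
  rcases Nat.eq_zero_or_pos (m 0) with h0 | h0
  · rw [hneg (((m 0 : ℕ) : ℤ) - (1 : ℕ), _) (by left; simp [h0]) (n + 1)]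
    simp only [fun j : ℤ => hneg (((m 0 : ℕ) : ℤ) - (2 : ℕ), j) (by left; simp [h0]) n]
    rcases Nat.eq_zero_or_pos (m 1) with h1 | h1
    · simp only [h0, h1, if_true]
      ring
    · simp only [h0, h1.ne', if_true, if_false]
      simp
  · rcases Nat.eq_zero_or_pos (m 1) with h1 | h1
    · rw [hneg (_, ((m 1 : ℕ) : ℤ) - (1 : ℕ)) (by right; simp [h1]) (n + 1)]
      simp only [fun j : ℤ => hneg (j, ((m 1 : ℕ) : ℤ) - (1 : ℕ)) (by right; simp [h1]) n,
        fun j : ℤ => hneg (j, ((m 1 : ℕ) : ℤ) - (2 : ℕ)) (by right; simp [h1]) n]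
      simp only [h0.ne', h1, if_true, if_false]
      simp
    · rw [walkCount_succ (by dsimp only; omega) (by dsimp only; omega), Fin.sum_univ_six]
      simp only [h0.ne', h1.ne', if_false]
      have e : ∀ (s : Fin 6) (a b : ℕ), step s = ((a : ℤ) - 1, (b : ℤ) - 1) →
          ((((m 0 : ℕ) : ℤ) - (1 : ℕ), ((m 1 : ℕ) : ℤ) - (1 : ℕ)) - step s : ℤ × ℤ) =
            (((m 0 : ℕ) : ℤ) - a, ((m 1 : ℕ) : ℤ) - b) := by
        intro s a b h
        rw [h]
        ext <;> simp
      rw [e 0 0 0 (by simp [step]), e 1 0 1 (by simp [step]), e 2 2 0 (by simp [step]),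
        e 3 2 1 (by simp [step]), e 4 2 1 (by simp [step]), e 5 2 2 (by simp [step])]
      push_cast
      ring

/-- The polynomial `x y K(x,y)`, where `K` is the kernel. -/
def kernel : Series :=
  PowerSeries.C (MvPolynomial.X 0) * PowerSeries.C (MvPolynomial.X 1) -
    PowerSeries.X * (1 + PowerSeries.C (MvPolynomial.X 1)) *
      (1 + PowerSeries.C (MvPolynomial.X 0) ^ 2 * (1 + PowerSeries.C (MvPolynomial.X 1)))

/-- The equation that characterises the generating function of quadrant walks. -/
def FunctionalEquation (F : Series) : Prop :=
  kernel * F = PowerSeries.C (MvPolynomial.X 0) * PowerSeries.C (MvPolynomial.X 1)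
    - PowerSeries.X * (1 + PowerSeries.C (MvPolynomial.X 0) ^ 2) * specialise (MvPolynomial.X 0) 0 F
    - PowerSeries.X * (1 + PowerSeries.C (MvPolynomial.X 1)) * specialise 0 (MvPolynomial.X 1) F
    + PowerSeries.X * specialise 0 0 F

theorem functionalEquation_iff (F : Series) :
    FunctionalEquation F ↔ PowerSeries.coeff 0 F = 1 ∧ ∀ n,
      MvPolynomial.X 0 * MvPolynomial.X 1 * PowerSeries.coeff (n + 1) F =
        stepPoly (PowerSeries.coeff n F) := by
  have h : FunctionalEquation F ↔
      PowerSeries.C (MvPolynomial.X 0 * MvPolynomial.X 1) * F =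
      PowerSeries.C (MvPolynomial.X 0 * MvPolynomial.X 1) + PowerSeries.X *
        (PowerSeries.C ((1 + MvPolynomial.X 1) *
            (1 + MvPolynomial.X 0 ^ 2 * (1 + MvPolynomial.X 1))) * F
          - PowerSeries.C (1 + MvPolynomial.X 0 ^ 2) * specialise (MvPolynomial.X 0) 0 F
          - PowerSeries.C (1 + MvPolynomial.X 1) * specialise 0 (MvPolynomial.X 1) F
          + specialise 0 0 F) := by
    rw [FunctionalEquation, kernel]
    simp only [map_mul, map_add, map_one, map_pow]
    constructor <;> intro h <;> linear_combination h
  rw [h, PowerSeries.ext_iff]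
  have hX : (MvPolynomial.X 0 * MvPolynomial.X 1 : MvPolynomial (Fin 2) ℚ) ≠ 0 :=
    mul_ne_zero (MvPolynomial.X_ne_zero 0) (MvPolynomial.X_ne_zero 1)
  constructor
  · intro h
    refine ⟨?_, fun n => ?_⟩
    · have := h 0
      rw [PowerSeries.coeff_C_mul, map_add, PowerSeries.coeff_zero_X_mul, add_zero,
        PowerSeries.coeff_C, if_pos rfl] at this
      exact mul_left_cancel₀ hX (by rw [this, mul_one])
    · have := h (n + 1)
      rw [PowerSeries.coeff_C_mul, map_add, PowerSeries.coeff_succ_X_mul,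
        PowerSeries.coeff_C, if_neg (by omega), zero_add] at this
      rw [this, map_add, map_sub, map_sub]
      simp only [PowerSeries.coeff_C_mul, coeff_specialise, stepPoly]
  · rintro ⟨h0, h⟩ n
    cases n with
    | zero =>
      rw [PowerSeries.coeff_C_mul, map_add, PowerSeries.coeff_zero_X_mul, add_zero,
        PowerSeries.coeff_C, if_pos rfl, h0, mul_one]
    | succ n =>
      rw [PowerSeries.coeff_C_mul, map_add, PowerSeries.coeff_succ_X_mul,
        PowerSeries.coeff_C, if_neg (by omega), zero_add, h n,
        map_add, map_sub, map_sub]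
      simp only [PowerSeries.coeff_C_mul, coeff_specialise, stepPoly]

theorem functionalEquation_Q : FunctionalEquation Q :=
  (functionalEquation_iff Q).2 ⟨Qn_zero, monomials_mul_Qn_succ⟩

/-- In the coefficient form, xy times each coefficient is a function of the previous one, and xy can
be cancelled. -/
theorem FunctionalEquation.eq_Q {F : Series} (hF : FunctionalEquation F) : F = Q := by
  rw [functionalEquation_iff] at hF
  have hX : (MvPolynomial.X 0 * MvPolynomial.X 1 : MvPolynomial (Fin 2) ℚ) ≠ 0 :=
    mul_ne_zero (MvPolynomial.X_ne_zero 0) (MvPolynomial.X_ne_zero 1)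
  ext1 n
  induction n with
  | zero => rw [hF.1]; exact Qn_zero.symm
  | succ n ih =>
    apply mul_left_cancel₀ hX
    rw [hF.2, ih]
    exact (monomials_mul_Qn_succ n).symm

/-! ### Algebraic equations in power series -/

theorem eq_of_forall_X_pow_dvd_sub {A : Type*} [CommRing A] {F G : PowerSeries A}
    (h : ∀ n, (PowerSeries.X : PowerSeries A) ^ n ∣ F - G) : F = G := by
  ext n
  have := PowerSeries.X_pow_dvd_iff.1 (h (n + 1)) n (by omega)
  rwa [map_sub, sub_eq_zero] at this

/-- Since `a` is divisible by the series variable, U ↦ 1 + aU^k is a contraction for the adic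
topology; its fixed point is read off coefficientwise from the iterates of 0. The series T, S, W and
all square roots are built from this one equation. -/
theorem exists_eq_one_add_mul_pow {A : Type*} [CommRing A] (a : PowerSeries A)
    (ha : PowerSeries.constantCoeff a = 0) (k : ℕ) : ∃ U : PowerSeries A, U = 1 + a * U ^ k := by
  obtain ⟨b, rfl⟩ := PowerSeries.X_dvd_iff.2 ha
  let Φ : PowerSeries A → PowerSeries A := fun U => 1 + PowerSeries.X * b * U ^ k
  have hΦ : ∀ n F G, (PowerSeries.X : PowerSeries A) ^ n ∣ F - G →
      (PowerSeries.X : PowerSeries A) ^ (n + 1) ∣ Φ F - Φ G := by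
    intro n F G h
    obtain ⟨c, hc⟩ := h.trans (sub_dvd_pow_sub_pow F G k)
    exact ⟨b * c, by simp only [Φ]; linear_combination PowerSeries.X * b * hc⟩
  let u : ℕ → PowerSeries A := fun n => Φ^[n] 0
  have hu : ∀ n, u (n + 1) = Φ (u n) := fun n => Function.iterate_succ_apply' _ _ _
  have h1 : ∀ n, (PowerSeries.X : PowerSeries A) ^ n ∣ u (n + 1) - u n := by
    intro n
    induction n with
    | zero => simp
    | succ n ih => rw [hu (n + 1), hu n]; exact hΦ n _ _ (by rw [← hu]; exact ih)
  have h2 : ∀ n d, (PowerSeries.X : PowerSeries A) ^ n ∣ u (n + d) - u n := by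
    intro n d
    induction d with
    | zero => simp
    | succ d ih =>
      have := dvd_add ((pow_dvd_pow _ (Nat.le_add_right n d)).trans (h1 (n + d))) ih
      rwa [sub_add_sub_cancel] at this
  let U : PowerSeries A := PowerSeries.mk fun n => PowerSeries.coeff n (u (n + 1))
  have h3 : ∀ n, (PowerSeries.X : PowerSeries A) ^ n ∣ U - u n := by
    intro n
    rw [PowerSeries.X_pow_dvd_iff]
    intro m hm
    obtain ⟨d, rfl⟩ := Nat.exists_eq_add_of_lt hm
    have := PowerSeries.X_pow_dvd_iff.1 (h2 (m + 1) d) m (by omega)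
    rw [map_sub, sub_eq_zero] at this
    rw [map_sub, PowerSeries.coeff_mk, sub_eq_zero, ← this]
    congr 2
    omega
  refine ⟨U, eq_of_forall_X_pow_dvd_sub fun n => ?_⟩
  have := dvd_sub (h3 (n + 1)) (hΦ n _ _ (h3 n))
  rw [hu, sub_sub_sub_cancel_right] at this
  exact (pow_dvd_pow _ (Nat.le_succ n)).trans this

theorem ne_zero_of_constantCoeff {A : Type*} [CommRing A] {F : PowerSeries A}
    (h : PowerSeries.constantCoeff F ≠ 0) : F ≠ 0 := by
  rintro rfl
  exact h (map_zero _)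

/-- The common uniqueness argument: the difference of two solutions of a polynomial equation
factors, and the cofactor has nonzero constant term. -/
theorem eq_of_sub_mul_eq_zero {A : Type*} [CommRing A] [IsDomain A] {F G H : PowerSeries A}
    (h : (F - G) * H = 0) (hH : PowerSeries.constantCoeff H ≠ 0) : F = G :=
  sub_eq_zero.1 ((mul_eq_zero.1 h).resolve_right (ne_zero_of_constantCoeff hH))

/-! ### Existence and uniqueness of T, S, R and W -/

theorem exists_isT : ∃ T, IsT T := by
  -- With T = tU the equation T = t + 4T³ becomes U = 1 + 4t²U³.
  obtain ⟨U, hU⟩ := exists_eq_one_add_mul_pow (4 * PowerSeries.X ^ 2 : PowerSeries ℚ) (by simp) 3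
  refine ⟨PowerSeries.X * U, by simp, ?_⟩
  linear_combination PowerSeries.X * hU

theorem IsT.unique {T T' : PowerSeries ℚ} (h : IsT T) (h' : IsT T') : T' = T := by
  refine eq_of_sub_mul_eq_zero (H := 1 - 4 * (T' ^ 2 + T' * T + T ^ 2)) ?_ ?_
  · linear_combination h'.2 - h.2
  · simp [h.1, h'.1]

theorem exists_isS {T : PowerSeries ℚ} (hT : IsT T) : ∃ S, IsS T S := by
  obtain ⟨U, hU⟩ := exists_eq_one_add_mul_pow (T ^ 2) (by simp [hT.1]) 2
  refine ⟨T * U, by simp [hT.1], ?_⟩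
  linear_combination T * hU

theorem IsS.unique {T S S' : PowerSeries ℚ} (hT : IsT T) (h : IsS T S) (h' : IsS T S') :
    S' = S := by
  refine eq_of_sub_mul_eq_zero (H := 1 - T * (S' + S)) ?_ ?_
  · linear_combination h'.2 - h.2
  · simp [hT.1]

/-- Both T and S/(1+S²) are small roots of the same cubic, which has only one such root. Clearing
the denominators 1+S² keeps the argument inside power series. -/
theorem isS_iff {T : PowerSeries ℚ} (hT : IsT T) {S : PowerSeries ℚ}
    (hS : PowerSeries.constantCoeff S = 0) :
    S = T * (1 + S ^ 2) ↔ S * (1 - S ^ 2) ^ 2 = PowerSeries.X * (1 + S ^ 2) ^ 3 := by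
  constructor
  · intro h
    rw [← hT.2]
    have e : T * (1 - 4 * T ^ 2) * (1 + S ^ 2) ^ 3 =
        (T * (1 + S ^ 2)) * ((1 + S ^ 2) ^ 2 - 4 * (T * (1 + S ^ 2)) ^ 2) := by ring
    rw [e, ← h]
    ring
  · intro h
    refine eq_of_sub_mul_eq_zero
      (H := (1 + S ^ 2) ^ 2 - 4 * (S ^ 2 + S * (T * (1 + S ^ 2)) + (T * (1 + S ^ 2)) ^ 2)) ?_ ?_
    · rw [← hT.2] at h
      linear_combination h
    · simp [hS, hT.1]

/-- If U = 1 - eU², then (1+2eU)² = 1 + 4e(U+eU²) = 1 + 4e; no division is needed. -/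
theorem exists_sq_eq {A : Type*} [CommRing A] (e : PowerSeries A)
    (he : PowerSeries.constantCoeff e = 0) :
    ∃ R : PowerSeries A, PowerSeries.constantCoeff R = 1 ∧ R ^ 2 = 1 + 4 * e := by
  obtain ⟨U, hU⟩ := exists_eq_one_add_mul_pow (-e) (by simp [he]) 2
  refine ⟨1 + 2 * e * U, by simp [he], ?_⟩
  linear_combination 4 * e * hU

theorem eq_of_sq_eq_sq {A : Type*} [CommRing A] [IsDomain A] [CharZero A] {F G : PowerSeries A}
    (hF : PowerSeries.constantCoeff F = 1) (hG : PowerSeries.constantCoeff G = 1)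
    (h : F ^ 2 = G ^ 2) : F = G := by
  refine eq_of_sub_mul_eq_zero (H := F + G) ?_ ?_
  · linear_combination h
  · rw [map_add, hF, hG, one_add_one_eq_two]
    exact two_ne_zero

theorem constantCoeff_map_C {T : PowerSeries ℚ} (hT : PowerSeries.constantCoeff T = 0) :
    PowerSeries.constantCoeff (PowerSeries.map Polynomial.C T) = 0 := by
  rw [← PowerSeries.coeff_zero_eq_constantCoeff_apply, PowerSeries.coeff_map,
    PowerSeries.coeff_zero_eq_constantCoeff_apply, hT, map_zero]

theorem exists_isR {T S : PowerSeries ℚ} (hS : IsS T S) : ∃ R, IsR S R := by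
  -- The argument is a quarter of (1-S²)² - 4xS(1+S²) - 1.
  obtain ⟨R, h1, h2⟩ := exists_sq_eq
    (PowerSeries.map Polynomial.C (S * (-2 * S + S ^ 3)) * PowerSeries.C (Polynomial.C (1 / 4 : ℚ)) -
      PowerSeries.C Polynomial.X * PowerSeries.map Polynomial.C S *
        (1 + PowerSeries.map Polynomial.C S ^ 2))
    (by
      rw [map_sub, map_mul, constantCoeff_map_C (by simp [hS.1]), map_mul, map_mul,
        constantCoeff_map_C hS.1]
      simp)
  refine ⟨R, h1, h2.trans ?_⟩
  have h4 : (4 : PowerSeries (Polynomial ℚ)) * PowerSeries.C (Polynomial.C (1 / 4 : ℚ)) = 1 := by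
    have : (4 : PowerSeries (Polynomial ℚ)) = PowerSeries.C (Polynomial.C (4 : ℚ)) := by
      rw [map_ofNat, map_ofNat]
    rw [this, ← map_mul, ← map_mul]
    norm_num
  simp only [map_mul, map_add, map_neg, map_pow, map_ofNat]
  linear_combination (PowerSeries.map Polynomial.C S * (-2 * PowerSeries.map Polynomial.C S +
    PowerSeries.map Polynomial.C S ^ 3)) * h4

theorem IsR.unique {S : PowerSeries ℚ} {R R' : PowerSeries (Polynomial ℚ)} (h : IsR S R)
    (h' : IsR S R') : R' = R :=
  eq_of_sq_eq_sq h'.1 h.1 (h'.2.trans h.2.symm)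

theorem exists_isW {T : PowerSeries ℚ} (hT : IsT T) : ∃ W, IsW T W := by
  have h0 := constantCoeff_map_C hT.1
  obtain ⟨U, hU⟩ := exists_eq_one_add_mul_pow
    ((1 + PowerSeries.C Polynomial.X) * PowerSeries.map Polynomial.C T ^ 2) (by simp [h0]) 2
  refine ⟨PowerSeries.map Polynomial.C T ^ 2 * U, by simp [h0], ?_⟩
  linear_combination PowerSeries.map Polynomial.C T ^ 2 * hU

theorem IsW.unique {T : PowerSeries ℚ} {W W' : PowerSeries (Polynomial ℚ)} (h : IsW T W)
    (h' : IsW T W') : W' = W := by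
  refine eq_of_sub_mul_eq_zero (H := 1 - (1 + PowerSeries.C Polynomial.X) * (W' + W)) ?_ ?_
  · linear_combination h'.2 - h.2
  · simp [h.1, h'.1]

/-! ### The explicit solution -/

section Identities

variable {K : Type*} [Field K] [CharZero K] {x w t D T R V W F : K}

/-- Here and in the next two lemmas `hF` is a specialisation of the closed form with invertible
denominator: w = 1 and V = D for y = 0, x = 0 and R = D for x = 0. The conclusion rationalises the
denominator; `h0` allows cancelling it. -/
theorem formula_x_zero (ht : t = T * D ^ 2) (hR : R ^ 2 = D ^ 2 - 4 * x * T)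
    (hD : T ^ 2 = (1 - D ^ 2) / 4)
    (h0 : D ^ 2 * D * (R * D + D * (1 - 2 * T * x)) * (R + D) * (1 + D) ≠ 0)
    (hF : F * (D ^ 2 * D * (R * D + D * (1 - 2 * T * x)) * (R + D) * (1 + D)) =
      2 * (D * (1 + D) * (R + D) - 2 * T ^ 2 * (4 * D + 2 * D * (R + D)))) :
    2 * t ^ 2 * (1 + x ^ 2) * x * F =
      x * (D * (2 - D ^ 2)) - (x - 2 * T) * D * R - 2 * t * (1 + x ^ 2) := by
  apply mul_right_cancel₀ h0
  linear_combination (2 * t ^ 2 * (1 + x ^ 2) * x) * hF +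
    (4 * x ^ 3 * t * D ^ 3 - 16 * x ^ 3 * t * D ^ 2 * T ^ 2 + 4 * x ^ 3 * t * D ^ 2 * R + 4 * x
    ^ 3 * t * D ^ 2 - 16 * x ^ 3 * t * D * T ^ 2 * R - 32 * x ^ 3 * t * D * T ^ 2 + 4 * x ^ 3 *
    t * D * R + 8 * x ^ 3 * D ^ 5 * T - 8 * x ^ 3 * D ^ 3 * T + 2 * x ^ 2 * D ^ 6 * R + 2 * x ^
    2 * D ^ 6 + 2 * x ^ 2 * D ^ 5 * R ^ 2 + 4 * x ^ 2 * D ^ 5 * R + 2 * x ^ 2 * D ^ 5 + 2 * x ^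
    2 * D ^ 4 * R ^ 2 + 2 * x ^ 2 * D ^ 4 * R + 4 * x * t * D ^ 3 - 16 * x * t * D ^ 2 * T ^ 2 +
    4 * x * t * D ^ 2 * R + 4 * x * t * D ^ 2 - 16 * x * t * D * T ^ 2 * R - 32 * x * t * D * T
    ^ 2 + 4 * x * t * D * R + 8 * x * D ^ 5 * T - 8 * x * D ^ 3 * T + 2 * D ^ 6 * R + 2 * D ^ 6
    + 2 * D ^ 5 * R ^ 2 + 4 * D ^ 5 * R + 2 * D ^ 5 + 2 * D ^ 4 * R ^ 2 + 2 * D ^ 4 * R) * ht +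
    (2 * x ^ 2 * D ^ 7 * T - 2 * x ^ 2 * D ^ 5 * T + x * D ^ 8 + 2 * x * D ^ 7 + 4 * x * D ^ 6 *
    T ^ 2 + x * D ^ 6 * R + 4 * x * D ^ 5 * T ^ 2 + x * D ^ 5 * R - x * D ^ 5 - 2 * D ^ 6 * T *
    R - 2 * D ^ 6 * T - 2 * D ^ 5 * T * R - 2 * D ^ 5 * T) * hR + (-16 * x ^ 3 * t * D ^ 4 * T -
    16 * x ^ 3 * t * D ^ 3 * T * R - 32 * x ^ 3 * t * D ^ 3 * T - 16 * x ^ 2 * D ^ 6 * T - 16 *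
    x ^ 2 * D ^ 5 * T - 16 * x * t * D ^ 4 * T - 16 * x * t * D ^ 3 * T * R - 32 * x * t * D ^ 3
    * T + 4 * x * D ^ 8 + 4 * x * D ^ 7 * R + 12 * x * D ^ 7 + 12 * x * D ^ 6 * R + 8 * x * D ^
    6 + 8 * x * D ^ 5 * R) * hD

theorem formula_zero_y (ht : t = T * D ^ 2) (hV : V ^ 2 = 1 - 4 * w * T ^ 2)
    (hD : T ^ 2 = (1 - D ^ 2) / 4)
    (h0 : D ^ 2 * V * (D * V + D) * (D + D) * (1 + V) ≠ 0)
    (hF : F * (D ^ 2 * V * (D * V + D) * (D + D) * (1 + V)) =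
      2 * (D * (1 + V) * (D + D) - 2 * T ^ 2 * (4 * V + 2 * D * w * (D + D)))) :
    2 * t ^ 2 * w ^ 2 * F = w - 2 - (D ^ 2 * w - 2) * V := by
  apply mul_right_cancel₀ h0
  linear_combination (2 * t ^ 2 * w ^ 2) * hF +
    (-32 * w ^ 3 * t * D ^ 2 * T ^ 2 + 8 * w ^ 3 * D ^ 6 * T - 8 * w ^ 3 * D ^ 4 * T + 8 * w ^ 2
    * t * D ^ 2 * V + 8 * w ^ 2 * t * D ^ 2 - 32 * w ^ 2 * t * T ^ 2 * V + 16 * w ^ 2 * D ^ 4 *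
    T * V + 8 * w ^ 2 * D ^ 4 * T - 8 * w ^ 2 * D ^ 2 * T * V) * ht + (2 * w ^ 2 * D ^ 8 - 2 * w
    ^ 2 * D ^ 6 + 2 * w * D ^ 6 * V ^ 2 + 4 * w * D ^ 6 * V - 2 * w * D ^ 4 * V - 4 * D ^ 4 * V
    ^ 2 - 4 * D ^ 4 * V) * hV + (-32 * w ^ 3 * t * D ^ 4 * T - 32 * w ^ 2 * t * D ^ 2 * T * V -
    8 * w ^ 2 * D ^ 6 * V ^ 2 + 8 * w ^ 2 * D ^ 6 + 16 * w * D ^ 4 * V ^ 2 + 16 * w * D ^ 4 * V)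
    * hD

theorem formula_zero_zero (ht : t = T * D ^ 2) (hD : T ^ 2 = (1 - D ^ 2) / 4)
    (h0 : D ^ 2 * D * (D * D + D) * (D + D) * (1 + D) ≠ 0)
    (hF : F * (D ^ 2 * D * (D * D + D) * (D + D) * (1 + D)) =
      2 * (D * (1 + D) * (D + D) - 2 * T ^ 2 * (4 * D + 2 * D * (D + D)))) :
    2 * t ^ 2 * F = -D ^ 3 + 2 * D - 1 := by
  apply mul_right_cancel₀ h0
  linear_combination (2 * t ^ 2) * hF +
    (8 * t * D ^ 3 - 32 * t * D ^ 2 * T ^ 2 + 8 * t * D ^ 2 - 32 * t * D * T ^ 2 + 8 * D ^ 6 * T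
    + 16 * D ^ 5 * T - 8 * D ^ 3 * T) * ht + (-32 * t * D ^ 4 * T - 32 * t * D ^ 3 * T + 8 * D ^
    8 + 16 * D ^ 7 - 8 * D ^ 5) * hD

-- The factors R+D and 1+V of the denominator are removed with (D+R)(D-R) = 4xT and (1+V)W = 2T².
-- The factor RV + D(1-2Txw), a divisor of 4T times the kernel, is kept.
omit [CharZero K] in
theorem formula_x_y (ht : t = T * D ^ 2) (hR : R ^ 2 = D ^ 2 - 4 * x * T)
    (hW' : V * W = 2 * T ^ 2 - W)
    (h0 : D ^ 2 * (R + D) * (1 + V) ≠ 0)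
    (hF : F * (D ^ 2 * V * (R * V + D * (1 - 2 * T * x * w)) * (R + D) * (1 + V)) =
      2 * (D * (1 + V) * (R + D) - 2 * T ^ 2 * (4 * V + 2 * D * w * (R + D)))) :
    t * x * V * (R * V + D * (1 - 2 * T * x * w)) * F =
      2 * (W * (R * V + D * (1 - 2 * T * x * w)) + T * (x - 2 * T) * D) := by
  apply mul_right_cancel₀ h0
  linear_combination (t * x) * hF +
    (-8 * x * w * D ^ 2 * T ^ 2 - 8 * x * w * D * T ^ 2 * R + 2 * x * D ^ 2 * V + 2 * x * D ^ 2
    + 2 * x * D * R * V + 2 * x * D * R - 16 * x * T ^ 2 * V) * ht + (4 * x * w * D ^ 4 * T + 4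
    * x * w * D ^ 3 * T * R - 8 * x * D ^ 2 * T - 2 * D ^ 3 * R * V - 2 * D ^ 3 * R - 2 * D ^ 2
    * R ^ 2 * V - 2 * D ^ 2 * R ^ 2) * hW' + (-4 * D ^ 2 * T ^ 2 * V - 4 * D ^ 2 * T ^ 2 + 2 * D
    ^ 2 * V * W + 2 * D ^ 2 * W) * hR

/-- This is the functional equation with w = 1+y. It rests on 4T(x(w-1) - tw(1+x²w)) = (RV)² -
D²(1-2Txw)²: multiplying by the kernel cancels RV + D(1-2Txw) and leaves its conjugate factor, whose
expansion matches the boundary terms. -/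
theorem kernel_mul_formula {F₁ F₂ F₀ : K} (hx : x ≠ 0) (hw : w ≠ 0) (h0 : t ≠ 0)
    (hVY : V * (R * V + D * (1 - 2 * T * x * w)) ≠ 0)
    (ht : t = T * D ^ 2) (hR : R ^ 2 = D ^ 2 - 4 * x * T)
    (hV : V ^ 2 = 1 - 4 * w * T ^ 2) (hD : T ^ 2 = (1 - D ^ 2) / 4) (hW : w * W = (1 - V) / 2)
    (hF : t * x * V * (R * V + D * (1 - 2 * T * x * w)) * F =
      2 * (W * (R * V + D * (1 - 2 * T * x * w)) + T * (x - 2 * T) * D))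
    (h₁ : 2 * t ^ 2 * (1 + x ^ 2) * x * F₁ =
      x * (D * (2 - D ^ 2)) - (x - 2 * T) * D * R - 2 * t * (1 + x ^ 2))
    (h₂ : 2 * t ^ 2 * w ^ 2 * F₂ = w - 2 - (D ^ 2 * w - 2) * V)
    (h₀ : 2 * t ^ 2 * F₀ = -D ^ 3 + 2 * D - 1) :
    (x * (w - 1) - t * w * (1 + x ^ 2 * w)) * F =
      x * (w - 1) - t * (1 + x ^ 2) * F₁ - t * w * F₂ + t * F₀ := by
  have h : 2 * t * x * w * (V * (R * V + D * (1 - 2 * T * x * w))) ≠ 0 :=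
    mul_ne_zero (mul_ne_zero (mul_ne_zero (mul_ne_zero two_ne_zero h0) hx) hw) hVY
  apply mul_left_cancel₀ h
  linear_combination 2 * w * (x * (w - 1) - t * w * (1 + x ^ 2 * w)) * hF
    + 4 * (x * (w - 1) - t * w * (1 + x ^ 2 * w)) * (R * V + D * (1 - 2 * T * x * w)) * hW
    + V * (R * V + D * (1 - 2 * T * x * w)) * (w * h₁ + x * h₂ - x * w * h₀) - (
    (-8 * x ^ 2 * w ^ 3 * D * T ^ 2 + 2 * x ^ 2 * w ^ 2 * D + 2 * x ^ 2 * w ^ 2 * R * V - 8 * w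
    ^ 2 * D * T ^ 2 + 2 * w * D + 2 * w * R * V) * ht + (x * w * D * V ^ 2 - 2 * w * D * T * V ^
    2) * hR + (-2 * x ^ 2 * w ^ 2 * D ^ 3 * T + 2 * x * w * D ^ 3 + x * w * D ^ 2 * R * V + 8 *
    x * w * D * T ^ 2 - 2 * x * D - 2 * x * R * V - 2 * w * D ^ 3 * T) * hV + (-32 * x * w ^ 2 *
    D * T ^ 2 + 8 * x * w * D + 8 * x * w * R * V) * hD)

end Identities

/-! ### Specialisations of the explicit solution -/

/-- `specialise` as a ring homomorphism. -/
def specialiseHom (a b : MvPolynomial (Fin 2) ℚ) : Series →+* Series :=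
  PowerSeries.map (MvPolynomial.aeval ![a, b] :
    MvPolynomial (Fin 2) ℚ →ₐ[ℚ] MvPolynomial (Fin 2) ℚ).toRingHom

theorem specialise_eq (a b : MvPolynomial (Fin 2) ℚ) (F : Series) :
    specialise a b F = specialiseHom a b F := rfl

/-- The inclusion of `ℚ[[t]]` in `ℚ[x,y][[t]]`. -/
def seriesT : PowerSeries ℚ →+* Series := PowerSeries.map MvPolynomial.C

/-- The inclusion in `ℚ[x,y][[t]]` of `ℚ[X][[t]]` that sends `X` to the `i`-th variable. -/
def seriesVar (i : Fin 2) : PowerSeries (Polynomial ℚ) →+* Series :=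
  PowerSeries.map (Polynomial.aeval (MvPolynomial.X i : MvPolynomial (Fin 2) ℚ)).toRingHom

theorem map_map_apply {A B C : Type*} [CommRing A] [CommRing B] [CommRing C] (f : A →+* B)
    (g : B →+* C) (F : PowerSeries A) :
    PowerSeries.map g (PowerSeries.map f F) = PowerSeries.map (g.comp f) F := by
  ext n
  simp

theorem specialiseHom_C (a b p : MvPolynomial (Fin 2) ℚ) :
    specialiseHom a b (PowerSeries.C p) = PowerSeries.C (MvPolynomial.aeval ![a, b] p) :=
  PowerSeries.map_C _ _

theorem specialiseHom_seriesT (a b : MvPolynomial (Fin 2) ℚ) (F : PowerSeries ℚ) :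
    specialiseHom a b (seriesT F) = seriesT F := by
  unfold specialiseHom seriesT
  rw [map_map_apply]
  congr 2
  ext
  simp

theorem seriesVar_map_C (i : Fin 2) (F : PowerSeries ℚ) :
    seriesVar i (PowerSeries.map Polynomial.C F) = seriesT F := by
  unfold seriesVar seriesT
  rw [map_map_apply]
  congr 2
  ext
  simp

theorem seriesVar_C_X (i : Fin 2) :
    seriesVar i (PowerSeries.C Polynomial.X) = PowerSeries.C (MvPolynomial.X i) := by
  unfold seriesVar
  rw [PowerSeries.map_C]
  simp

theorem specialiseHom_seriesVar {a b : MvPolynomial (Fin 2) ℚ} {i : Fin 2}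
    (h : (![a, b] : Fin 2 → MvPolynomial (Fin 2) ℚ) i = MvPolynomial.X i)
    (F : PowerSeries (Polynomial ℚ)) :
    specialiseHom a b (seriesVar i F) = seriesVar i F := by
  unfold specialiseHom seriesVar
  rw [map_map_apply]
  congr 2
  ext
  · simp
  · simp [h]

theorem constantCoeff_map {A B : Type*} [CommRing A] [CommRing B] (f : A →+* B)
    (F : PowerSeries A) :
    PowerSeries.constantCoeff (PowerSeries.map f F) = f (PowerSeries.constantCoeff F) := by
  rw [← PowerSeries.coeff_zero_eq_constantCoeff_apply, PowerSeries.coeff_map,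
    PowerSeries.coeff_zero_eq_constantCoeff_apply]

theorem constantCoeff_specialiseHom (a b : MvPolynomial (Fin 2) ℚ) (F : Series) :
    PowerSeries.constantCoeff (specialiseHom a b F) =
      MvPolynomial.aeval ![a, b] (PowerSeries.constantCoeff F) := constantCoeff_map _ _

theorem constantCoeff_seriesT (F : PowerSeries ℚ) :
    PowerSeries.constantCoeff (seriesT F) = MvPolynomial.C (PowerSeries.constantCoeff F) :=
  constantCoeff_map _ _

theorem constantCoeff_seriesVar (i : Fin 2) (F : PowerSeries (Polynomial ℚ)) :
    PowerSeries.constantCoeff (seriesVar i F) =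
      Polynomial.aeval (MvPolynomial.X i) (PowerSeries.constantCoeff F) :=
  constantCoeff_map _ _

theorem emb_injective : Function.Injective emb := IsFractionRing.injective Series SeriesField

theorem charZero_seriesField : CharZero SeriesField :=
  charZero_of_injective_ringHom (f := emb.comp (PowerSeries.C (R := MvPolynomial (Fin 2) ℚ)))
    (emb_injective.comp PowerSeries.C_injective)

theorem emb_ne_zero {F : Series} (h : PowerSeries.constantCoeff F ≠ 0) : emb F ≠ 0 :=
  (map_ne_zero_iff emb emb_injective).2 (ne_zero_of_constantCoeff h)

theorem embT_apply (F : PowerSeries ℚ) : embT F = emb (seriesT F) := rfl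
theorem embX_apply (F : PowerSeries (Polynomial ℚ)) : embX F = emb (seriesVar 0 F) := rfl
theorem embY_apply (F : PowerSeries (Polynomial ℚ)) : embY F = emb (seriesVar 1 F) := rfl

section Solution

variable {D T : PowerSeries ℚ} {R V W : PowerSeries (Polynomial ℚ)}

theorem exists_mul_eq_of_constantCoeff {d : Series} (n : Series) {c : ℚ} (hc : c ≠ 0)
    (hd : PowerSeries.constantCoeff d = MvPolynomial.C c) : ∃ F, F * d = n := by
  have hu : IsUnit d := by
    rw [PowerSeries.isUnit_iff_constantCoeff, hd]
    exact (isUnit_iff_ne_zero.2 hc).map MvPolynomial.C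
  obtain ⟨u, rfl⟩ := hu
  exact ⟨n * ↑u⁻¹, by rw [mul_assoc, Units.inv_mul, mul_one]⟩

/-- The explicit form of `Q(x,y;t)` and of its specialisations. -/
theorem explicit_formulas (hT0 : PowerSeries.constantCoeff T = 0)
    (hT : T * D ^ 2 = PowerSeries.X)
    (hD0 : PowerSeries.constantCoeff D = 1) (hD : D ^ 2 = 1 - 4 * T ^ 2)
    (hR0 : PowerSeries.constantCoeff R = 1)
    (hR : R ^ 2 = PowerSeries.map Polynomial.C D ^ 2 -
      4 * PowerSeries.C Polynomial.X * PowerSeries.map Polynomial.C T)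
    (hW0 : PowerSeries.constantCoeff W = 0)
    (hW : W * (1 - (1 + PowerSeries.C Polynomial.X) * W) = PowerSeries.map Polynomial.C T ^ 2)
    (hV : V = 1 - 2 * (1 + PowerSeries.C Polynomial.X) * W) :
    2 * t ^ 2 * (1 + x ^ 2) * x * emb Qx0 =
      x * (embT D * (2 - embT D ^ 2)) - (x - 2 * embT T) * embT D * embX R - 2 * t * (1 + x ^ 2) ∧
    2 * t ^ 2 * (1 + y) ^ 2 * emb Q0y =
      (1 + y) - 2 - (embT D ^ 2 * (1 + y) - 2) * embY V ∧
    2 * t ^ 2 * emb Q00 = -embT D ^ 3 + 2 * embT D - 1 := by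
  have := charZero_seriesField
  have hxs : PowerSeries.C (MvPolynomial.X 0 : MvPolynomial (Fin 2) ℚ) ≠ 0 := by
    rw [Ne, map_eq_zero_iff _ PowerSeries.C_injective]
    exact MvPolynomial.X_ne_zero 0
  have hws : (1 + PowerSeries.C (MvPolynomial.X 1) : Series) ≠ 0 := by
    rw [← map_one PowerSeries.C, ← map_add, Ne, map_eq_zero_iff _ PowerSeries.C_injective]
    intro h
    have := congrArg (MvPolynomial.coeff 0) h
    simp at this
  have hts : (PowerSeries.X : Series) ≠ 0 := PowerSeries.X_ne_zero
  -- the series in `ℚ[x,y][[t]]`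
  set xs : Series := PowerSeries.C (MvPolynomial.X 0) with hxs'
  set ys : Series := PowerSeries.C (MvPolynomial.X 1) with hys'
  obtain ⟨Ts, hTs⟩ : ∃ Ts, Ts = seriesT T := ⟨_, rfl⟩
  obtain ⟨Ds, hDs⟩ : ∃ Ds, Ds = seriesT D := ⟨_, rfl⟩
  obtain ⟨Rs, hRs⟩ : ∃ Rs, Rs = seriesVar 0 R := ⟨_, rfl⟩
  obtain ⟨Ws, hWs⟩ : ∃ Ws, Ws = seriesVar 1 W := ⟨_, rfl⟩
  obtain ⟨Vs, hVs⟩ : ∃ Vs, Vs = seriesVar 1 V := ⟨_, rfl⟩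
  have cT : PowerSeries.constantCoeff Ts = 0 := by
    rw [hTs, constantCoeff_seriesT, hT0, map_zero]
  have cD : PowerSeries.constantCoeff Ds = 1 := by
    rw [hDs, constantCoeff_seriesT, hD0, map_one]
  have cR : PowerSeries.constantCoeff Rs = 1 := by
    rw [hRs, constantCoeff_seriesVar, hR0, map_one]
  have cV : PowerSeries.constantCoeff Vs = 1 := by
    rw [hVs, constantCoeff_seriesVar, hV]
    simp [hW0]
  have rT : PowerSeries.X = Ts * Ds ^ 2 := by
    rw [hTs, hDs, ← map_pow, ← map_mul, hT, seriesT, PowerSeries.map_X]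
  have rD : Ds ^ 2 = 1 - 4 * Ts ^ 2 := by
    rw [hTs, hDs, ← map_pow, hD]; simp only [map_sub, map_one, map_mul, map_pow, map_ofNat]
  have rR : Rs ^ 2 = Ds ^ 2 - 4 * xs * Ts := by
    rw [hRs, ← map_pow, hR]
    simp only [map_sub, map_mul, map_pow, map_ofNat, seriesVar_map_C, seriesVar_C_X, hTs, hDs, hxs']
  have rV : Vs = 1 - 2 * (1 + ys) * Ws := by
    rw [hVs, hV]
    simp only [map_sub, map_one, map_add, map_mul, map_ofNat, seriesVar_C_X, hWs, hys']
  have rW : Ws * (1 - (1 + ys) * Ws) = Ts ^ 2 := by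
    have := congrArg (seriesVar 1) hW
    simpa only [map_sub, map_one, map_add, map_mul, map_pow, seriesVar_map_C, seriesVar_C_X, ← hTs,
      ← hWs, ← hys'] using this
  have rV2 : Vs ^ 2 = 1 - 4 * (1 + ys) * Ts ^ 2 := by
    rw [rV]; linear_combination -4 * (1 + ys) * rW
  -- the explicit solution
  obtain ⟨P, hP⟩ := exists_mul_eq_of_constantCoeff
    (d := Ds ^ 2 * Vs * (Rs * Vs + Ds * (1 - 2 * Ts * xs * (1 + ys))) * (Rs + Ds) * (1 + Vs))
    (2 * (Ds * (1 + Vs) * (Rs + Ds) -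
      2 * Ts ^ 2 * (4 * Vs + 2 * Ds * (1 + ys) * (Rs + Ds)))) (c := 8) (by norm_num)
    (by simp only [map_mul, map_add, map_sub, map_pow, map_one, cT, cD, cR, cV]
        rw [show (MvPolynomial.C (8 : ℚ) : MvPolynomial (Fin 2) ℚ) = 8 from map_ofNat _ 8]
        simp
        norm_num)
  -- its specialisations
  have aX0 : ∀ a b : MvPolynomial (Fin 2) ℚ, specialiseHom a b xs = PowerSeries.C a := by
    intro a b; rw [hxs', specialiseHom_C]; simp
  have aX1 : ∀ a b : MvPolynomial (Fin 2) ℚ, specialiseHom a b ys = PowerSeries.C b := by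
    intro a b; rw [hys', specialiseHom_C]; simp
  have aT : ∀ a b : MvPolynomial (Fin 2) ℚ, specialiseHom a b Ts = Ts := by
    intro a b; rw [hTs, specialiseHom_seriesT]
  have aD : ∀ a b : MvPolynomial (Fin 2) ℚ, specialiseHom a b Ds = Ds := by
    intro a b; rw [hDs, specialiseHom_seriesT]
  have aR : ∀ b : MvPolynomial (Fin 2) ℚ, specialiseHom (MvPolynomial.X 0) b Rs = Rs := by
    intro b; rw [hRs, specialiseHom_seriesVar (by simp)]
  have aV : ∀ a : MvPolynomial (Fin 2) ℚ, specialiseHom a (MvPolynomial.X 1) Vs = Vs := by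
    intro a; rw [hVs, specialiseHom_seriesVar (by simp)]
  -- At x = 0 the square of R becomes D², and the constant term 1 selects the root D. Likewise V
  -- becomes D at y = 0.
  have aR0 : ∀ b : MvPolynomial (Fin 2) ℚ, specialiseHom 0 b Rs = Ds := by
    intro b
    apply eq_of_sq_eq_sq
    · rw [constantCoeff_specialiseHom, cR, map_one]
    · exact cD
    · rw [← map_pow, rR]
      simp only [map_sub, map_mul, map_pow, map_ofNat, aX0, aT, aD, map_zero, mul_zero, zero_mul,
        sub_zero]
  have aV0 : ∀ a : MvPolynomial (Fin 2) ℚ, specialiseHom a 0 Vs = Ds := by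
    intro b
    apply eq_of_sq_eq_sq
    · rw [constantCoeff_specialiseHom, cV, map_one]
    · exact cD
    · rw [← map_pow, rV2, rD]
      simp only [map_sub, map_mul, map_add, map_one, map_pow, map_ofNat, aX1, aT, map_zero, add_zero,
        mul_one]
  obtain ⟨P₁, hP₁⟩ : ∃ P₁, P₁ = specialiseHom (MvPolynomial.X 0) 0 P := ⟨_, rfl⟩
  obtain ⟨P₂, hP₂⟩ : ∃ P₂, P₂ = specialiseHom 0 (MvPolynomial.X 1) P := ⟨_, rfl⟩
  obtain ⟨P₀, hP₀⟩ : ∃ P₀, P₀ = specialiseHom 0 0 P := ⟨_, rfl⟩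
  have e₁ : P₁ * (Ds ^ 2 * Ds * (Rs * Ds + Ds * (1 - 2 * Ts * xs)) * (Rs + Ds) * (1 + Ds)) =
      2 * (Ds * (1 + Ds) * (Rs + Ds) - 2 * Ts ^ 2 * (4 * Ds + 2 * Ds * (Rs + Ds))) := by
    have := congrArg (specialiseHom (MvPolynomial.X 0) 0) hP
    simpa only [map_sub, map_mul, map_add, map_one, map_pow, map_ofNat, map_zero, add_zero, mul_zero,
      zero_mul, sub_zero, mul_one, aX0, aX1, aT, aD, aR, aV0, ← hP₁, ← hxs'] using this
  have e₂ : P₂ * (Ds ^ 2 * Vs * (Ds * Vs + Ds) * (Ds + Ds) * (1 + Vs)) =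
      2 * (Ds * (1 + Vs) * (Ds + Ds) -
        2 * Ts ^ 2 * (4 * Vs + 2 * Ds * (1 + ys) * (Ds + Ds))) := by
    have := congrArg (specialiseHom 0 (MvPolynomial.X 1)) hP
    simpa only [map_sub, map_mul, map_add, map_one, map_pow, map_ofNat, map_zero, add_zero, mul_zero,
      zero_mul, sub_zero, mul_one, aX0, aX1, aT, aD, aR0, aV, ← hP₂, ← hys'] using this
  have e₀ : P₀ * (Ds ^ 2 * Ds * (Ds * Ds + Ds) * (Ds + Ds) * (1 + Ds)) =
      2 * (Ds * (1 + Ds) * (Ds + Ds) - 2 * Ts ^ 2 * (4 * Ds + 2 * Ds * (Ds + Ds))) := by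
    have := congrArg (specialiseHom 0 0) hP
    simpa only [map_sub, map_mul, map_add, map_one, map_pow, map_ofNat, map_zero, add_zero, mul_zero,
      zero_mul, sub_zero, mul_one, aX0, aX1, aT, aD, aR0, aV0, ← hP₀] using this
  -- transfer to the field of fractions
  have fT : emb PowerSeries.X = emb Ts * emb Ds ^ 2 := by rw [rT]; simp
  have fD : emb Ts ^ 2 = (1 - emb Ds ^ 2) / 4 := by
    have : emb (Ds ^ 2) = emb (1 - 4 * Ts ^ 2) := by rw [rD]
    simp only [map_pow, map_sub, map_one, map_mul, map_ofNat] at this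
    rw [this]; ring
  have fR : emb Rs ^ 2 = emb Ds ^ 2 - 4 * emb xs * emb Ts := by
    rw [← map_pow, rR]; simp only [map_sub, map_mul, map_pow, map_ofNat]
  have fV : emb Vs ^ 2 = 1 - 4 * (1 + emb ys) * emb Ts ^ 2 := by
    rw [← map_pow, rV2]; simp only [map_sub, map_mul, map_add, map_one, map_pow, map_ofNat]
  have fW : (1 + emb ys) * emb Ws = (1 - emb Vs) / 2 := by
    rw [rV]; simp only [map_sub, map_mul, map_add, map_one, map_ofNat]; ring
  have fW' : emb Vs * emb Ws = 2 * emb Ts ^ 2 - emb Ws := by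
    have : emb (Ws * (1 - (1 + ys) * Ws)) = emb (Ts ^ 2) := by rw [rW]
    rw [rV]
    simp only [map_pow, map_sub, map_one, map_mul, map_add, map_ofNat] at this ⊢
    linear_combination 2 * this
  have n2 : (1 + 1 : MvPolynomial (Fin 2) ℚ) ≠ 0 := by norm_num
  have nD : emb Ds ≠ 0 := emb_ne_zero (by simp [cD])
  have nV : emb Vs ≠ 0 := emb_ne_zero (by simp [cV])
  have nRD : emb Rs + emb Ds ≠ 0 := by
    rw [← map_add]; exact emb_ne_zero (by simp [cR, cD])
  have nDD : emb Ds + emb Ds ≠ 0 := by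
    rw [← map_add]; exact emb_ne_zero (by simp [cD])
  have nV1 : 1 + emb Vs ≠ 0 := by
    rw [← map_one emb, ← map_add]; exact emb_ne_zero (by simp [cV])
  have nD1 : 1 + emb Ds ≠ 0 := by
    rw [← map_one emb, ← map_add]; exact emb_ne_zero (by simp [cD])
  have nY : emb Rs * emb Vs + emb Ds * (1 - 2 * emb Ts * emb xs * (1 + emb ys)) ≠ 0 := by
    have := emb_ne_zero (F := Rs * Vs + Ds * (1 - 2 * Ts * xs * (1 + ys)))
      (by simp [cR, cV, cD, cT])
    simpa only [map_sub, map_mul, map_add, map_one, map_ofNat] using this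
  have nY₁ : emb Rs * emb Ds + emb Ds * (1 - 2 * emb Ts * emb xs) ≠ 0 := by
    have := emb_ne_zero (F := Rs * Ds + Ds * (1 - 2 * Ts * xs)) (by simp [cR, cD, cT])
    simpa only [map_sub, map_mul, map_add, map_one, map_ofNat] using this
  have nY₂ : emb Ds * emb Vs + emb Ds ≠ 0 := by
    have := emb_ne_zero (F := Ds * Vs + Ds) (by simp [cV, cD])
    simpa only [map_sub, map_mul, map_add, map_one, map_ofNat] using this
  have nY₀ : emb Ds * emb Ds + emb Ds ≠ 0 := by
    have := emb_ne_zero (F := Ds * Ds + Ds) (by simp [cD])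
    simpa only [map_sub, map_mul, map_add, map_one, map_ofNat] using this
  have fP := congrArg emb hP
  have f₁ := congrArg emb e₁
  have f₂ := congrArg emb e₂
  have f₀ := congrArg emb e₀
  simp only [map_pow, map_sub, map_one, map_mul, map_add, map_ofNat] at fP f₁ f₂ f₀
  have g₁ := formula_x_zero fT fR fD (mul_ne_zero (mul_ne_zero (mul_ne_zero (mul_ne_zero
    (pow_ne_zero 2 nD) nD) nY₁) nRD) nD1) f₁
  have g₂ := formula_zero_y fT fV fD (mul_ne_zero (mul_ne_zero (mul_ne_zero (mul_ne_zero
    (pow_ne_zero 2 nD) nV) nY₂) nDD) nV1) f₂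
  have g₀ := formula_zero_zero fT fD (mul_ne_zero (mul_ne_zero (mul_ne_zero (mul_ne_zero
    (pow_ne_zero 2 nD) nD) nY₀) nDD) nD1) f₀
  have g := formula_x_y fT fR fW' (mul_ne_zero (mul_ne_zero
    (pow_ne_zero 2 nD) nRD) nV1) fP
  have nw : 1 + emb ys ≠ 0 := by
    rw [← map_one emb, ← map_add]; exact (map_ne_zero_iff emb emb_injective).2 hws
  have key := kernel_mul_formula ((map_ne_zero_iff emb emb_injective).2 hxs) nw
    ((map_ne_zero_iff emb emb_injective).2 hts) (mul_ne_zero nV nY) fT fR fV fD fW g g₁ g₂ g₀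
  -- The boundary series in `key` are the specialisations of P itself, so P solves the functional
  -- equation.
  have hPQ : P = Q := by
    apply FunctionalEquation.eq_Q
    apply emb_injective
    rw [specialise_eq, specialise_eq, specialise_eq, ← hP₁, ← hP₂, ← hP₀]
    simp only [kernel, map_pow, map_sub, map_one, map_mul, map_add]
    linear_combination key
  have h₁ : Qx0 = P₁ := by rw [hP₁, hPQ]; rfl
  have h₂ : Q0y = P₂ := by rw [hP₂, hPQ]; rfl
  have h₀ : Q00 = P₀ := by rw [hP₀, hPQ]; rfl
  rw [h₁, h₂, h₀, embT_apply, embT_apply, embX_apply, embY_apply, ← hTs, ← hDs, ← hRs, ← hVs]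
  exact ⟨g₁, g₂, g₀⟩

end Solution

/-! ### Degrees of field extensions -/

section Extension

variable {F K : Type*} [Field F] [Field K] [Algebra F K]

/-- The field generated by an intermediate field and one more element. -/
def extend (A : IntermediateField F K) (a : K) : IntermediateField F K :=
  (IntermediateField.adjoin A {a}).restrictScalars F

variable {A B : IntermediateField F K} {a : K}

theorem le_extend : A ≤ extend A a := fun z hz =>
  IntermediateField.algebraMap_mem (IntermediateField.adjoin A {a}) (⟨z, hz⟩ : A)

theorem mem_extend_self : a ∈ extend A a :=
  IntermediateField.mem_adjoin_simple_self A a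

/-- The target is any subfield, so the preimage of a subfield of a larger field is allowed. -/
theorem extend_induction {M : Subfield K} (hA : ∀ z ∈ A, z ∈ M) (ha : a ∈ M) :
    ∀ z ∈ extend A a, z ∈ M := by
  intro z hz
  refine IntermediateField.adjoin_induction (F := A) (s := {a}) (p := fun z _ => z ∈ M)
    ?_ ?_ ?_ ?_ ?_ hz
  · rintro z rfl; exact ha
  · intro z; exact hA _ z.2
  · intro _ _ _ _ h1 h2; exact add_mem h1 h2
  · intro _ _ h; exact inv_mem h
  · intro _ _ _ _ h1 h2; exact mul_mem h1 h2

theorem extend_le (hA : A ≤ B) (ha : a ∈ B) : extend A a ≤ B :=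
  extend_induction (M := B.toSubfield) hA ha

theorem adjoin_induction' {s : Set K} {M : Subfield K} (hF : ∀ c : F, algebraMap F K c ∈ M)
    (hs : ∀ z ∈ s, z ∈ M) : ∀ z ∈ IntermediateField.adjoin F s, z ∈ M := by
  intro z hz
  refine IntermediateField.adjoin_induction (F := F) (s := s) (p := fun z _ => z ∈ M)
    ?_ ?_ ?_ ?_ ?_ hz
  · exact hs
  · exact hF
  · intro _ _ _ _ h1 h2; exact add_mem h1 h2
  · intro _ _ h; exact inv_mem h
  · intro _ _ _ _ h1 h2; exact mul_mem h1 h2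

theorem relfinrank_extend (ha : IsIntegral A a) :
    A.relfinrank (extend A a) = (minpoly A a).natDegree := by
  rw [IntermediateField.relfinrank_eq_finrank_of_le le_extend,
    ← IntermediateField.adjoin.finrank ha]
  rfl

/-- The relative rank of an infinite extension is 0 by convention; a nonzero value therefore already
implies algebraicity. -/
theorem isAlgebraic_and_natDegree {d : ℕ} (hd : d ≠ 0)
    (h : A.relfinrank (extend A a) = d) : IsAlgebraic A a ∧ (minpoly A a).natDegree = d := by
  have hint : IsIntegral A a := by
    rw [IntermediateField.relfinrank_eq_finrank_of_le le_extend] at h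
    have : FiniteDimensional A (IntermediateField.adjoin A {a}) :=
      FiniteDimensional.of_finrank_pos (by
        refine lt_of_lt_of_eq (Nat.pos_of_ne_zero hd) h.symm)
    exact IntermediateField.isIntegral_iff.1
      (IsIntegral.of_finite A (IntermediateField.AdjoinSimple.gen A a))
  exact ⟨hint.isAlgebraic, by rw [← relfinrank_extend hint, h]⟩

theorem relfinrank_extend_sq (ha : a ∉ A) (h2 : a ^ 2 ∈ A) : A.relfinrank (extend A a) = 2 := by
  have hm : (Polynomial.X ^ 2 - Polynomial.C (⟨a ^ 2, h2⟩ : A)).Monic :=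
    Polynomial.monic_X_pow_sub_C _ two_ne_zero
  have h0 : Polynomial.aeval a (Polynomial.X ^ 2 - Polynomial.C (⟨a ^ 2, h2⟩ : A)) = 0 := by
    simp
  have hint : IsIntegral A a := ⟨_, hm, h0⟩
  rw [relfinrank_extend hint]
  have hle := Polynomial.natDegree_le_of_dvd (minpoly.dvd A a h0) hm.ne_zero
  rw [Polynomial.natDegree_X_pow_sub_C] at hle
  have hpos := minpoly.natDegree_pos hint
  have hne : (minpoly A a).natDegree ≠ 1 := by
    intro h
    rw [minpoly.natDegree_eq_one_iff] at h
    obtain ⟨z, hz⟩ := h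
    exact ha (hz ▸ z.2)
  omega

/-- In characteristic 0 the minimal polynomial has as many roots in Ω as its degree. If `a` is its
own only conjugate, the degree is 1. -/
theorem mem_of_forall_root {Ω : Type*} [CharZero K] [Field Ω] [IsAlgClosed Ω] [Algebra K Ω]
    (ha : IsAlgebraic A a) (h : ∀ b : Ω, (∀ p : Polynomial A,
      Polynomial.aeval a p = 0 → Polynomial.aeval b p = 0) → b = algebraMap K Ω a) : a ∈ A := by
  have hint := ha.isIntegral
  have hsep : (minpoly A a).Separable := (minpoly.irreducible hint).separable
  have hcard := Polynomial.card_rootSet_eq_natDegree (K := Ω) hsep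
    (IsAlgClosed.splits _)
  have hsub : Subsingleton ((minpoly A a).rootSet Ω) := by
    refine ⟨fun b c => Subtype.ext ?_⟩
    have key : ∀ b ∈ (minpoly A a).rootSet Ω, b = algebraMap K Ω a := by
      intro b hb
      refine h b fun p hp => ?_
      obtain ⟨r, rfl⟩ := minpoly.dvd A a hp
      rw [map_mul, (Polynomial.mem_rootSet.1 hb).2, zero_mul]
    rw [key b b.2, key c c.2]
  have hle := Fintype.card_le_one_iff_subsingleton.2 hsub
  rw [hcard] at hle
  have hpos := minpoly.natDegree_pos hint
  obtain ⟨z, hz⟩ := minpoly.natDegree_eq_one_iff.1 (le_antisymm hle hpos)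
  exact hz ▸ z.2

end Extension

/-! ### Square roots of linear polynomials -/

section SquareRoot

variable {k Ω : Type*} [Field k] [Field Ω] [Algebra k Ω]

/-- The field generated by `x` and all elements that are algebraic over `k`. -/
def algebraicAdjoin (k : Type*) {Ω : Type*} [Field k] [Field Ω] [Algebra k Ω] (x : Ω) :
    Subfield Ω :=
  (IntermediateField.adjoin (algebraicClosure k Ω) {x}).toSubfield

theorem mem_algebraicAdjoin_of_isAlgebraic {x c : Ω} (hc : IsAlgebraic k c) :
    c ∈ algebraicAdjoin k x :=
  IntermediateField.algebraMap_mem (IntermediateField.adjoin (algebraicClosure k Ω) {x})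
    (⟨c, mem_algebraicClosure_iff.2 hc⟩ : algebraicClosure k Ω)

theorem mem_algebraicAdjoin_self {x : Ω} : x ∈ algebraicAdjoin k x :=
  IntermediateField.mem_adjoin_simple_self (algebraicClosure k Ω) x

/-- Over the algebraic closure of k in Ω, x is still transcendental. If r = p/q with p, q
polynomials in x, then p² = (c+dx)q², where the left side has even degree and the right side odd
degree. -/
theorem not_mem_algebraicAdjoin {x r c d : Ω} (hx : Transcendental k x) (hc : IsAlgebraic k c)
    (hd : IsAlgebraic k d) (hd0 : d ≠ 0) (h : r ^ 2 = c + d * x) : r ∉ algebraicAdjoin k x := by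
  intro hr
  have hx' : Transcendental (algebraicClosure k Ω) x := hx.algebraicClosure
  obtain ⟨p, q, hpq⟩ := (IntermediateField.mem_adjoin_simple_iff _ _).1 hr
  let c' : algebraicClosure k Ω := ⟨c, mem_algebraicClosure_iff.2 hc⟩
  let d' : algebraicClosure k Ω := ⟨d, mem_algebraicClosure_iff.2 hd⟩
  have hd' : d' ≠ 0 := fun h => hd0 (congrArg Subtype.val h)
  have hlin : Polynomial.aeval x (Polynomial.C c' + Polynomial.C d' * Polynomial.X) = r ^ 2 := by
    rw [h]; simp [c', d']
  have hdeg : (Polynomial.C c' + Polynomial.C d' * Polynomial.X).natDegree = 1 := by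
    rw [add_comm]; exact Polynomial.natDegree_linear hd'
  have hinj : ∀ f : Polynomial (algebraicClosure k Ω), Polynomial.aeval x f = 0 → f = 0 :=
    fun f hf => by_contra fun hf0 => hx' ⟨f, hf0, hf⟩
  have hr0 : r ≠ 0 := by
    rintro rfl
    rw [zero_pow two_ne_zero] at hlin
    rw [hinj _ hlin] at hdeg
    simp at hdeg
  have hq0 : Polynomial.aeval x q ≠ 0 := by
    intro hq
    rw [hq, div_zero] at hpq
    exact hr0 hpq
  have hp0 : Polynomial.aeval x p ≠ 0 := by
    intro hp
    rw [hp, zero_div] at hpq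
    exact hr0 hpq
  have heq : p ^ 2 = (Polynomial.C c' + Polynomial.C d' * Polynomial.X) * q ^ 2 := by
    rw [← sub_eq_zero]
    apply hinj
    rw [map_sub, map_mul, map_pow, map_pow, hlin, hpq, div_pow]
    field_simp
    ring
  have hq : q ≠ 0 := by rintro rfl; exact hq0 (map_zero _)
  have hL : Polynomial.C c' + Polynomial.C d' * Polynomial.X ≠ 0 := by
    intro h0; rw [h0] at hdeg; simp at hdeg
  have := congrArg Polynomial.natDegree heq
  rw [Polynomial.natDegree_pow, Polynomial.natDegree_mul hL (pow_ne_zero 2 hq), hdeg,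
    Polynomial.natDegree_pow] at this
  omega

end SquareRoot

/-! ### The cubic equation for `T` -/

section Cubic

variable {F K : Type*} [Field F] [Field K] [Algebra F K] {A : IntermediateField F K} {t T : K}

/-- A root p/q would give 4p³ + tq³ = pq² with p, q polynomials in t. Whether deg p > deg q or not,
the left side has the larger degree. -/
theorem not_root_of_transcendental [CharZero K] (ht : Transcendental A t) {z : K}
    (hz : z ∈ extend A t) : 4 * z ^ 3 - z + t ≠ 0 := by
  intro h
  have : CharZero A := (algebraMap A K).charZero
  have hz' : z ∈ IntermediateField.adjoin A {t} := hz
  rw [IntermediateField.mem_adjoin_simple_iff] at hz'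
  obtain ⟨p, q, hpq⟩ := hz'
  have hinj : ∀ f : Polynomial A, Polynomial.aeval t f = 0 → f = 0 :=
    fun f hf => by_contra fun hf0 => ht ⟨f, hf0, hf⟩
  have ht0 : t ≠ 0 := by
    rintro rfl
    exact ht isAlgebraic_zero
  have hz0 : z ≠ 0 := by
    rintro rfl
    apply ht0
    linear_combination h
  have hq0 : Polynomial.aeval t q ≠ 0 := by
    intro hq; rw [hq, div_zero] at hpq; exact hz0 hpq
  have hp0 : Polynomial.aeval t p ≠ 0 := by
    intro hp; rw [hp, zero_div] at hpq; exact hz0 hpq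
  have hq : q ≠ 0 := by rintro rfl; exact hq0 (map_zero _)
  have hp : p ≠ 0 := by rintro rfl; exact hp0 (map_zero _)
  have heq : Polynomial.C 4 * p ^ 3 + Polynomial.X * q ^ 3 = p * q ^ 2 := by
    rw [← sub_eq_zero]
    apply hinj
    rw [hpq] at h
    field_simp at h
    simp only [map_sub, map_add, map_mul, map_pow, Polynomial.aeval_X, map_ofNat]
    linear_combination h
  have d1 : (Polynomial.C 4 * p ^ 3 : Polynomial A).natDegree = 3 * p.natDegree := by
    rw [Polynomial.natDegree_C_mul (by norm_num), Polynomial.natDegree_pow]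
  have d2 : (Polynomial.X * q ^ 3).natDegree = 3 * q.natDegree + 1 := by
    rw [Polynomial.natDegree_X_mul (pow_ne_zero 3 hq), Polynomial.natDegree_pow]
  have d3 : (p * q ^ 2).natDegree = p.natDegree + 2 * q.natDegree := by
    rw [Polynomial.natDegree_mul hp (pow_ne_zero 2 hq), Polynomial.natDegree_pow]
  rcases Nat.lt_or_ge q.natDegree p.natDegree with hlt | hle
  · have := Polynomial.natDegree_add_eq_left_of_natDegree_lt
      (p := Polynomial.C 4 * p ^ 3) (q := Polynomial.X * q ^ 3) (by omega)
    rw [heq] at this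
    omega
  · have := Polynomial.natDegree_add_eq_right_of_natDegree_lt
      (p := Polynomial.C 4 * p ^ 3) (q := Polynomial.X * q ^ 3) (by omega)
    rw [heq] at this
    omega

/-- A cubic without roots in the base field is irreducible, so it is the minimal polynomial of T up
to a constant. -/
theorem relfinrank_extend_cubic [CharZero K] (ht : Transcendental A t)
    (hT : T - 4 * T ^ 3 = t) : (extend A t).relfinrank (extend (extend A t) T) = 3 := by
  have : CharZero (extend A t) :=
    (algebraMap (extend A t) K).charZero
  let t' : extend A t := ⟨t, mem_extend_self⟩
  let f : Polynomial (extend A t) :=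
    Polynomial.C 4 * Polynomial.X ^ 3 + Polynomial.C 0 * Polynomial.X ^ 2 +
      Polynomial.C (-1) * Polynomial.X + Polynomial.C t'
  have h4 : (4 : extend A t) ≠ 0 := by norm_num
  have hdeg : f.natDegree = 3 := Polynomial.natDegree_cubic h4
  have hirr : Irreducible f := by
    refine Polynomial.irreducible_of_degree_le_three_of_not_isRoot (by rw [hdeg]; decide) ?_
    intro z hz
    apply not_root_of_transcendental ht z.2
    have := congrArg (algebraMap (extend A t) K) hz
    simp only [f, Polynomial.eval_add, Polynomial.eval_mul, Polynomial.eval_C, Polynomial.eval_pow,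
      Polynomial.eval_X, Polynomial.eval_ofNat, Polynomial.eval_zero, Polynomial.eval_neg,
      Polynomial.eval_one, map_add, map_mul, map_pow, map_ofNat, map_zero, map_neg, map_one] at this
    have e : algebraMap (extend A t) K t' = t := rfl
    have e' : algebraMap (extend A t) K z = z := rfl
    rw [e, e'] at this
    linear_combination this
  have hroot : Polynomial.aeval T f = 0 := by
    simp only [f, map_add, map_mul, map_pow, Polynomial.aeval_X, Polynomial.aeval_C, map_ofNat,
      map_zero, map_neg, map_one]
    have e : algebraMap (extend A t) K t' = t := rfl
    rw [e]
    linear_combination -hT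
  have hint : IsIntegral (extend A t) T :=
    IsAlgebraic.isIntegral ⟨f, hirr.ne_zero, hroot⟩
  rw [relfinrank_extend hint, ← minpoly.eq_of_irreducible hirr hroot,
    Polynomial.natDegree_mul_C (inv_ne_zero (Polynomial.leadingCoeff_ne_zero.2 hirr.ne_zero)), hdeg]

end Cubic

/-! ### Recovering `T` and `D` from the generating functions -/

section Algebra

/-- Reducing powers of T by the cubic leaves a relation linear in T, so T is a rational function of
t and ξ wherever the second expression is nonzero. -/
theorem cubic_resolvent {K : Type*} [Field K] {T t ξ : K}
    (hT : T - 4 * T ^ 3 = t) (hξ : T ^ 2 - 6 * T ^ 4 = ξ) :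
    T * (36 * t ^ 2 - 8 * ξ - 1) = 24 * t * ξ - t ∧
      36 * t ^ 2 - 8 * ξ - 1 = (12 * T ^ 2 - 1) ^ 2 * (4 * T ^ 2 - 1) := by
  subst hT hξ
  constructor <;> ring

theorem cubic_unique {K : Type*} [Field K] {T T' t ξ : K} (hT : T - 4 * T ^ 3 = t)
    (hT' : T' - 4 * T' ^ 3 = t) (hξ : T ^ 2 - 6 * T ^ 4 = ξ) (hξ' : T' ^ 2 - 6 * T' ^ 4 = ξ)
    (h12 : 12 * T ^ 2 - 1 ≠ 0) (h4 : 4 * T ^ 2 - 1 ≠ 0) : T' = T := by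
  obtain ⟨h1, h2⟩ := cubic_resolvent hT hξ
  obtain ⟨h1', -⟩ := cubic_resolvent hT' hξ'
  have h0 : 36 * t ^ 2 - 8 * ξ - 1 ≠ 0 := by
    rw [h2]; exact mul_ne_zero (pow_ne_zero 2 h12) h4
  exact mul_right_cancel₀ h0 (h1'.trans h1.symm)

theorem mem_of_resolvent {F K : Type*} [Field F] [Field K] [Algebra F K]
    {L : IntermediateField F K} {T t : K} (hT : T - 4 * T ^ 3 = t) (ht : t ∈ L)
    (hξ : T ^ 2 - 6 * T ^ 4 ∈ L) (h12 : 12 * T ^ 2 - 1 ≠ 0) (h4 : 4 * T ^ 2 - 1 ≠ 0) : T ∈ L := by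
  obtain ⟨h1, h2⟩ := cubic_resolvent hT rfl
  have h0 : 36 * t ^ 2 - 8 * (T ^ 2 - 6 * T ^ 4) - 1 ≠ 0 := by
    rw [h2]; exact mul_ne_zero (pow_ne_zero 2 h12) h4
  have e := eq_div_of_mul_eq h0 h1
  lift t to L using ht
  obtain ⟨ξ, hξ'⟩ : ∃ ξ : L, (ξ : K) = T ^ 2 - 6 * T ^ 4 := ⟨⟨_, hξ⟩, rfl⟩
  rw [← hξ'] at e
  have : T = (((24 * t * ξ - t) / (36 * t ^ 2 - 8 * ξ - 1) : L) : K) := by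
    rw [e]
    norm_cast
  rw [this]
  exact Subtype.coe_prop _

/-- If D² ≠ b², the first two equations give D²+b² = 4/3 and D²b² = 4/9, whence (D²-b²)² = 0. The
third equation then fixes the sign. -/
theorem eq_of_trace_eq {K : Type*} [Field K] [CharZero K] {D b : K}
    (h1 : D ^ 4 - D ^ 6 = b ^ 4 - b ^ 6)
    (h2 : 2 * (1 - D ^ 2) - 3 * (1 - D ^ 2) ^ 2 = 2 * (1 - b ^ 2) - 3 * (1 - b ^ 2) ^ 2)
    (h3 : D * (2 - D ^ 2) = b * (2 - b ^ 2)) (hD : 2 - D ^ 2 ≠ 0) : b = D := by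
  have hs : (D ^ 2 - b ^ 2) * (4 - 3 * (D ^ 2 + b ^ 2)) = 0 := by linear_combination h2
  have hs' : (D ^ 2 - b ^ 2) * ((D ^ 2 + b ^ 2) - (D ^ 4 + D ^ 2 * b ^ 2 + b ^ 4)) = 0 := by
    linear_combination h1
  have hsq : D ^ 2 - b ^ 2 = 0 := by
    by_contra h0
    have e1 := (mul_eq_zero.1 hs).resolve_left h0
    have e2 := (mul_eq_zero.1 hs').resolve_left h0
    have : (D ^ 2 - b ^ 2) ^ 2 = 0 := by
      linear_combination (D ^ 2 + b ^ 2) * e1 - 4 * e2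
    exact h0 (pow_eq_zero_iff two_ne_zero |>.1 this)
  have : (D - b) * (2 - D ^ 2) = 0 := by linear_combination h3 + b * hsq
  have := (mul_eq_zero.1 this).resolve_right hD
  linear_combination -this

/-- The square is a polynomial in T² of degree 3; t² absorbs its T⁶ term, and what remains depends
on T only through ξ. In `sq_x_part` the same term 8ξ appears. -/
theorem sq_y_part {K : Type*} [Field K] {w t T V ξ : K} (hw : w ≠ 0) (hT : T - 4 * T ^ 3 = t)
    (hξ : T ^ 2 - 6 * T ^ 4 = ξ) (hV : V ^ 2 = 1 - 4 * w * T ^ 2) :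
    ((1 - 4 * T ^ 2 - 2 / w) * V) ^ 2 =
      -4 * t ^ 2 * w + 1 - 4 / w + 4 / w ^ 2 + 8 * ξ := by
  rw [mul_pow, hV, ← hT, ← hξ]
  field_simp
  ring

theorem sq_x_part {K : Type*} [Field K] {x t T R ξ : K} (hx : x ≠ 0) (hT : T - 4 * T ^ 3 = t)
    (hξ : T ^ 2 - 6 * T ^ 4 = ξ) (hR : R ^ 2 = (1 - 4 * T ^ 2) * (1 - 4 * T ^ 2 - 4 * x * T)) :
    ((1 - 2 * T / x) * R) ^ 2 =
      -4 * t * x + 1 - 4 * t / x + 4 * t ^ 2 / x ^ 2 + 8 * ξ := by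
  rw [mul_pow, hR, ← hT, ← hξ]
  field_simp
  ring

end Algebra

/-! ### Generators of the extensions, by conjugates -/

theorem subfield_subtype_mem {K : Type*} [Field K] (M : Subfield K) (z : M) : M.subtype z ∈ M :=
  z.2

section Conjugates

variable {F K : Type*} [Field F] [Field K] [CharZero K] [Algebra F K]
  {L : IntermediateField F K}

omit [CharZero K] in
theorem algebraMap_subtype {Ω : Type*} [Field Ω] [Algebra K Ω] {z : K} (hz : z ∈ L) :
    algebraMap L Ω ⟨z, hz⟩ = algebraMap K Ω z := rfl

/-- If `α + β` lies in `L`, where `α² = a + 8ξ`, `β² = b + 8ξ` and `ξ = T² - 6T⁴`, and if `β` is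
independent of all conjugates of `T`, then `T` lies in `L`. -/
theorem mem_of_add_sqrt {Ω : Type*} [Field Ω] [IsAlgClosed Ω] [Algebra K Ω] {M : Subfield Ω}
    {t T α β a b : K} (hT : T - 4 * T ^ 3 = t) (h12 : 12 * T ^ 2 - 1 ≠ 0)
    (h4 : 4 * T ^ 2 - 1 ≠ 0) (hα : α ^ 2 = a + 8 * (T ^ 2 - 6 * T ^ 4))
    (hβ : β ^ 2 = b + 8 * (T ^ 2 - 6 * T ^ 4)) (hα0 : α ≠ 0)
    (hroot : ∀ T' : Ω, T' - 4 * T' ^ 3 = algebraMap K Ω t → T' ∈ M)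
    (hαM : algebraMap K Ω α ∈ M) (haM : algebraMap K Ω a ∈ M) (hbM : algebraMap K Ω b ∈ M)
    (hβM : algebraMap K Ω β ∉ M) (htL : t ∈ L) (haL : a ∈ L) (hbL : b ∈ L) (hL : α + β ∈ L) :
    T ∈ L := by
  have : CharZero Ω := charZero_of_injective_algebraMap (algebraMap K Ω).injective
  have : CharZero L := (algebraMap L K).charZero
  let p₁ : Polynomial L := Polynomial.X - 4 * Polynomial.X ^ 3 - Polynomial.C ⟨t, htL⟩
  let ξ : Polynomial L := Polynomial.X ^ 2 - 6 * Polynomial.X ^ 4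
  -- This polynomial squares away the product αβ, with ξ as a function of the unknown T.
  let p₂ : Polynomial L := (Polynomial.C ⟨α + β, hL⟩ ^ 2 - Polynomial.C ⟨a, haL⟩ -
    Polynomial.C ⟨b, hbL⟩ - 16 * ξ) ^ 2 -
      4 * (Polynomial.C ⟨a, haL⟩ + 8 * ξ) * (Polynomial.C ⟨b, hbL⟩ + 8 * ξ)
  have e₁ : Polynomial.aeval T p₁ = 0 := by
    simp only [p₁, map_sub, map_mul, map_pow, map_ofNat, Polynomial.aeval_X, Polynomial.aeval_C,
      IntermediateField.algebraMap_apply]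
    linear_combination hT
  have e₂ : Polynomial.aeval T p₂ = 0 := by
    simp only [p₂, ξ, map_sub, map_add, map_mul, map_pow, map_ofNat, Polynomial.aeval_X,
      Polynomial.aeval_C, IntermediateField.algebraMap_apply]
    have e : (α + β) ^ 2 - a - b - 16 * (T ^ 2 - 6 * T ^ 4) = 2 * (α * β) := by
      linear_combination hα + hβ
    rw [e, ← hα, ← hβ]
    ring
  have halg : IsAlgebraic L T := by
    refine ⟨p₁, fun h => ?_, e₁⟩
    have := congrArg (fun p => Polynomial.coeff p 1) h
    simp [p₁, Polynomial.coeff_X] at this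
  refine mem_of_forall_root (Ω := Ω) halg fun T' h => ?_
  have g₁ := h p₁ e₁
  have g₂ := h p₂ e₂
  simp only [p₁, p₂, ξ, map_sub, map_add, map_mul, map_pow, map_ofNat, Polynomial.aeval_X,
    Polynomial.aeval_C, algebraMap_subtype] at g₁ g₂
  have fT := congrArg (algebraMap K Ω) hT
  have fα := congrArg (algebraMap K Ω) hα
  have fβ := congrArg (algebraMap K Ω) hβ
  simp only [map_sub, map_add, map_mul, map_pow, map_ofNat] at fT fα fβ
  have f0 := (map_ne_zero (algebraMap K Ω)).2 hα0
  have f12 := (map_ne_zero (algebraMap K Ω)).2 h12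
  have f4 := (map_ne_zero (algebraMap K Ω)).2 h4
  simp only [map_sub, map_mul, map_pow, map_ofNat, map_one] at f12 f4
  have hT'M := hroot T' (by linear_combination g₁)
  have hTM := hroot _ fT
  generalize algebraMap K Ω T = Tc at *
  generalize algebraMap K Ω α = αc at *
  generalize algebraMap K Ω β = βc at *
  generalize algebraMap K Ω a = ac at *
  generalize algebraMap K Ω b = bc at *
  generalize algebraMap K Ω t = tc at *
  refine cubic_unique fT (by linear_combination g₁) rfl ?_ f12 f4
  by_contra hne
  apply hβM
  have hδ : (Tc ^ 2 - 6 * Tc ^ 4) - (T' ^ 2 - 6 * T' ^ 4) ≠ 0 :=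
    sub_ne_zero.2 fun h => hne h.symm
  -- If ξ changes under conjugation by δ ≠ 0, then (2αβ+16δ)² is known; as α²β² is also known, the
  -- cross term 64αβδ gives β rationally in elements of M.
  have hβ' : βc = (4 * (ac + 8 * (T' ^ 2 - 6 * T' ^ 4)) * (bc + 8 * (T' ^ 2 - 6 * T' ^ 4)) -
      4 * (ac + 8 * (Tc ^ 2 - 6 * Tc ^ 4)) * (bc + 8 * (Tc ^ 2 - 6 * Tc ^ 4)) -
      256 * ((Tc ^ 2 - 6 * Tc ^ 4) - (T' ^ 2 - 6 * T' ^ 4)) ^ 2) /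
      (64 * ((Tc ^ 2 - 6 * Tc ^ 4) - (T' ^ 2 - 6 * T' ^ 4)) * αc) := by
    rw [eq_div_iff (mul_ne_zero (mul_ne_zero (by norm_num) hδ) f0)]
    have e : (αc + βc) ^ 2 - ac - bc - 16 * (T' ^ 2 - 6 * T' ^ 4) =
        2 * (αc * βc) + 16 * ((Tc ^ 2 - 6 * Tc ^ 4) - (T' ^ 2 - 6 * T' ^ 4)) := by
      linear_combination fα + fβ
    rw [e] at g₂
    linear_combination g₂ - 4 * βc ^ 2 * fα - 4 * (ac + 8 * (Tc ^ 2 - 6 * Tc ^ 4)) * fβ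
  lift αc to M using hαM
  lift ac to M using haM
  lift bc to M using hbM
  lift T' to M using hT'M
  lift Tc to M using hTM
  rw [hβ', show (4 * ((ac : Ω) + 8 * ((T' : Ω) ^ 2 - 6 * (T' : Ω) ^ 4)) *
      (bc + 8 * ((T' : Ω) ^ 2 - 6 * (T' : Ω) ^ 4)) -
      4 * (ac + 8 * ((Tc : Ω) ^ 2 - 6 * (Tc : Ω) ^ 4)) *
        (bc + 8 * ((Tc : Ω) ^ 2 - 6 * (Tc : Ω) ^ 4)) -
      256 * (((Tc : Ω) ^ 2 - 6 * (Tc : Ω) ^ 4) - ((T' : Ω) ^ 2 - 6 * (T' : Ω) ^ 4)) ^ 2) /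
      (64 * (((Tc : Ω) ^ 2 - 6 * (Tc : Ω) ^ 4) - ((T' : Ω) ^ 2 - 6 * (T' : Ω) ^ 4)) * αc) =
    M.subtype ((4 * (ac + 8 * (T' ^ 2 - 6 * T' ^ 4)) * (bc + 8 * (T' ^ 2 - 6 * T' ^ 4)) -
      4 * (ac + 8 * (Tc ^ 2 - 6 * Tc ^ 4)) * (bc + 8 * (Tc ^ 2 - 6 * Tc ^ 4)) -
      256 * ((Tc ^ 2 - 6 * Tc ^ 4) - (T' ^ 2 - 6 * T' ^ 4)) ^ 2) /
      (64 * ((Tc ^ 2 - 6 * Tc ^ 4) - (T' ^ 2 - 6 * T' ^ 4)) * αc)) by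
    simp only [map_div₀, map_sub, map_add, map_mul, map_pow, map_ofNat, Subfield.subtype_apply]]
  exact subfield_subtype_mem _ _

/-- If `D (2 - D²) - β` lies in `L`, where `β²` is a certain polynomial in `D` over `L`, and if `β`
is independent of all conjugates of `D`, then `D` lies in `L`. -/
theorem mem_of_sub_sqrt {Ω : Type*} [Field Ω] [IsAlgClosed Ω] [Algebra K Ω] {M : Subfield Ω}
    {t D β b : K} (hD : D ^ 4 - D ^ 6 = 4 * t ^ 2) (hD2 : 2 - D ^ 2 ≠ 0)
    (hβ : β ^ 2 = b + (2 * (1 - D ^ 2) - 3 * (1 - D ^ 2) ^ 2))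
    (hroot : ∀ D' : Ω, D' ^ 4 - D' ^ 6 = 4 * algebraMap K Ω t ^ 2 → D' ∈ M)
    (hbM : algebraMap K Ω b ∈ M)
    (hβM : algebraMap K Ω β ∉ M) (htL : t ∈ L) (hbL : b ∈ L) (hL : D * (2 - D ^ 2) - β ∈ L) :
    D ∈ L := by
  have : CharZero Ω := charZero_of_injective_algebraMap (algebraMap K Ω).injective
  let p₁ : Polynomial L := Polynomial.X ^ 4 - Polynomial.X ^ 6 - 4 * Polynomial.C ⟨t, htL⟩ ^ 2
  -- The square of β, with β written as D(2-D²) minus the given element of L, and D replaced by the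
  -- unknown.
  let p₂ : Polynomial L := (Polynomial.C ⟨D * (2 - D ^ 2) - β, hL⟩ -
    Polynomial.X * (2 - Polynomial.X ^ 2)) ^ 2 -
      (Polynomial.C ⟨b, hbL⟩ +
        (2 * (1 - Polynomial.X ^ 2) - 3 * (1 - Polynomial.X ^ 2) ^ 2))
  have e₁ : Polynomial.aeval D p₁ = 0 := by
    simp only [p₁, map_sub, map_mul, map_pow, map_ofNat, Polynomial.aeval_X, Polynomial.aeval_C,
      IntermediateField.algebraMap_apply]
    linear_combination hD
  have e₂ : Polynomial.aeval D p₂ = 0 := by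
    simp only [p₂, map_sub, map_add, map_mul, map_pow, map_ofNat, map_one, Polynomial.aeval_X,
      Polynomial.aeval_C, IntermediateField.algebraMap_apply]
    linear_combination hβ
  have halg : IsAlgebraic L D := by
    refine ⟨p₁, fun h => ?_, e₁⟩
    have := congrArg (fun p => Polynomial.coeff p 6) h
    have h3 : p₁ = Polynomial.X ^ 4 - Polynomial.X ^ 6 - Polynomial.C (4 * ⟨t, htL⟩ ^ 2) := by
      simp only [p₁, map_mul, map_pow, map_ofNat]
    rw [h3, Polynomial.coeff_sub, Polynomial.coeff_sub, Polynomial.coeff_X_pow,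
      Polynomial.coeff_X_pow, Polynomial.coeff_C] at this
    norm_num at this
  refine mem_of_forall_root (Ω := Ω) halg fun D' h => ?_
  have g₁ := h p₁ e₁
  have g₂ := h p₂ e₂
  simp only [p₁, p₂, map_sub, map_add, map_mul, map_pow, map_ofNat, map_one, Polynomial.aeval_X,
    Polynomial.aeval_C, algebraMap_subtype] at g₁ g₂
  have fD := congrArg (algebraMap K Ω) hD
  have fβ := congrArg (algebraMap K Ω) hβ
  have fD2 := (map_ne_zero (algebraMap K Ω)).2 hD2
  simp only [map_sub, map_add, map_mul, map_pow, map_ofNat, map_one] at fD fβ fD2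
  have hD'M := hroot D' (by linear_combination g₁)
  have hDM := hroot _ fD
  generalize algebraMap K Ω D = Dc at *
  generalize algebraMap K Ω β = βc at *
  generalize algebraMap K Ω b = bc at *
  generalize algebraMap K Ω t = tc at *
  -- Otherwise subtracting the two equations for β² leaves a linear equation for β over M.
  have h3 : Dc * (2 - Dc ^ 2) = D' * (2 - D' ^ 2) := by
    by_contra hne
    apply hβM
    have hδ : Dc * (2 - Dc ^ 2) - D' * (2 - D' ^ 2) ≠ 0 := sub_ne_zero.2 hne
    have hβ' : βc = ((Dc * (2 - Dc ^ 2) - D' * (2 - D' ^ 2)) ^ 2 +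
        (2 * (1 - Dc ^ 2) - 3 * (1 - Dc ^ 2) ^ 2) - (2 * (1 - D' ^ 2) - 3 * (1 - D' ^ 2) ^ 2)) /
        (2 * (Dc * (2 - Dc ^ 2) - D' * (2 - D' ^ 2))) := by
      rw [eq_div_iff (mul_ne_zero two_ne_zero hδ)]
      linear_combination fβ - g₂
    lift bc to M using hbM
    lift D' to M using hD'M
    lift Dc to M using hDM
    rw [hβ', show (((Dc : Ω) * (2 - (Dc : Ω) ^ 2) - D' * (2 - (D' : Ω) ^ 2)) ^ 2 +
        (2 * (1 - (Dc : Ω) ^ 2) - 3 * (1 - (Dc : Ω) ^ 2) ^ 2) -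
          (2 * (1 - (D' : Ω) ^ 2) - 3 * (1 - (D' : Ω) ^ 2) ^ 2)) /
        (2 * ((Dc : Ω) * (2 - (Dc : Ω) ^ 2) - D' * (2 - (D' : Ω) ^ 2))) =
      M.subtype (((Dc * (2 - Dc ^ 2) - D' * (2 - D' ^ 2)) ^ 2 +
        (2 * (1 - Dc ^ 2) - 3 * (1 - Dc ^ 2) ^ 2) - (2 * (1 - D' ^ 2) - 3 * (1 - D' ^ 2) ^ 2)) /
        (2 * (Dc * (2 - Dc ^ 2) - D' * (2 - D' ^ 2)))) by
      simp only [map_div₀, map_sub, map_add, map_mul, map_pow, map_ofNat, map_one,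
        Subfield.subtype_apply]]
    exact subfield_subtype_mem _ _
  refine eq_of_trace_eq (by linear_combination fD - g₁) ?_ h3 fD2
  rw [← h3] at g₂
  linear_combination g₂ - fβ

end Conjugates

/-! ### The degrees of the generating functions -/

section Degrees

variable {K : Type*} [Field K] [CharZero K] [Algebra ℚ K]

theorem isAlgebraic_cubic {k Ω : Type*} [Field k] [Field Ω] [Algebra k Ω] (t : k) {T : Ω}
    (h : T - 4 * T ^ 3 = algebraMap k Ω t) : IsAlgebraic k T := by
  refine ⟨Polynomial.X - 4 * Polynomial.X ^ 3 - Polynomial.C t, fun h0 => ?_, ?_⟩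
  · have := congrArg (fun p => Polynomial.coeff p 1) h0
    simp [Polynomial.coeff_X] at this
  · simp only [map_sub, map_mul, map_pow, map_ofNat, Polynomial.aeval_X, Polynomial.aeval_C]
    linear_combination h

theorem isAlgebraic_sextic {k Ω : Type*} [Field k] [Field Ω] [Algebra k Ω] (t : k) {D : Ω}
    (h : D ^ 4 - D ^ 6 = 4 * algebraMap k Ω t ^ 2) : IsAlgebraic k D := by
  refine ⟨Polynomial.X ^ 4 - Polynomial.X ^ 6 - Polynomial.C (4 * t ^ 2), fun h0 => ?_, ?_⟩
  · have := congrArg (fun p => Polynomial.coeff p 6) h0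
    rw [Polynomial.coeff_sub, Polynomial.coeff_sub, Polynomial.coeff_X_pow,
      Polynomial.coeff_X_pow, Polynomial.coeff_C] at this
    norm_num at this
  · simp only [map_sub, map_mul, map_pow, map_ofNat, Polynomial.aeval_X, Polynomial.aeval_C]
    linear_combination h

theorem isAlgebraic_four {k Ω : Type*} [Field k] [Field Ω] [Algebra k Ω] :
    IsAlgebraic k (4 : Ω) := by
  simpa using isAlgebraic_natCast (R := k) (A := Ω) 4

omit [CharZero K] in
theorem map_mem_of_mem_adjoin {Ω : Type*} [Field Ω] [Algebra K Ω] {s : Set K} {M : Subfield Ω}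
    (hs : ∀ z ∈ s, algebraMap K Ω z ∈ M) :
    ∀ z ∈ IntermediateField.adjoin ℚ s, algebraMap K Ω z ∈ M :=
  adjoin_induction' (M := M.comap (algebraMap K Ω))
    (fun c => by
      have h : algebraMap K Ω (algebraMap ℚ K c) = ((algebraMap K Ω).comp (algebraMap ℚ K)) c := rfl
      rw [Subfield.mem_comap, h, eq_ratCast]
      exact SubfieldClass.ratCast_mem M c) hs

omit [CharZero K] in
theorem map_mem_of_mem_extend {Ω : Type*} [Field Ω] [Algebra K Ω] {A : IntermediateField ℚ K}
    {a : K} {M : Subfield Ω} (hA : ∀ z ∈ A, algebraMap K Ω z ∈ M) (ha : algebraMap K Ω a ∈ M) :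
    ∀ z ∈ extend A a, algebraMap K Ω z ∈ M :=
  extend_induction (M := M.comap (algebraMap K Ω)) hA ha

omit [CharZero K] in
theorem extend_adjoin_pair (x t : K) :
    extend (IntermediateField.adjoin ℚ {x}) t = IntermediateField.adjoin ℚ {x, t} := by
  apply le_antisymm
  · refine extend_le (IntermediateField.adjoin.mono _ _ _ (by simp))
      (IntermediateField.subset_adjoin _ _ (by simp))
  · rw [IntermediateField.adjoin_le_iff]
    rintro z (rfl | rfl)
    · exact le_extend (IntermediateField.mem_adjoin_simple_self ℚ _)
    · exact mem_extend_self

omit [CharZero K] in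
theorem extend_adjoin_triple (x y t : K) :
    extend (IntermediateField.adjoin ℚ {x, y}) t = IntermediateField.adjoin ℚ {x, y, t} := by
  apply le_antisymm
  · refine extend_le (IntermediateField.adjoin.mono _ _ _ ?_)
      (IntermediateField.subset_adjoin _ _ (by simp))
    intro z hz
    rcases hz with rfl | rfl <;> simp
  · rw [IntermediateField.adjoin_le_iff]
    rintro z (rfl | rfl | rfl)
    · exact le_extend (IntermediateField.subset_adjoin _ _ (by simp))
    · exact le_extend (IntermediateField.subset_adjoin _ _ (by simp))
    · exact mem_extend_self

variable {x y t T D R V : K}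

/-- T and D are algebraic over k, so R is the square root of a linear polynomial in x with algebraic
coefficients, and the other factors already lie in the field. -/
theorem sqrt_x_not_mem {Ω : Type*} [Field Ω] [Algebra K Ω] {k : IntermediateField ℚ K}
    (hx : Transcendental k x) (htk : t ∈ k) (hT : T - 4 * T ^ 3 = t) (hD : D ^ 2 = 1 - 4 * T ^ 2)
    (hR : R ^ 2 = D ^ 2 - 4 * x * T) (hT0 : T ≠ 0) (hC : 1 - 2 * T / x ≠ 0) (hD0 : D ≠ 0) :
    algebraMap K Ω ((1 - 2 * T / x) * (D * R)) ∉ algebraicAdjoin k (algebraMap K Ω x) := by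
  have : CharZero Ω := charZero_of_injective_algebraMap (algebraMap K Ω).injective
  have hinj := (algebraMap K Ω).injective
  have aT : IsAlgebraic k T := isAlgebraic_cubic (⟨t, htk⟩ : k) hT
  have aT' := (isAlgebraic_algebraMap_iff (R := k) hinj).2 aT
  have aD : IsAlgebraic k D := IsAlgebraic.of_pow two_pos (by
    rw [hD]
    exact isAlgebraic_one.sub (isAlgebraic_four.mul (aT.pow 2)))
  have aD' := (isAlgebraic_algebraMap_iff (R := k) hinj).2 aD
  have hRM : algebraMap K Ω R ∉ algebraicAdjoin k (algebraMap K Ω x) := by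
    refine not_mem_algebraicAdjoin (c := algebraMap K Ω D ^ 2) (d := -4 * algebraMap K Ω T)
      ((transcendental_algebraMap_iff hinj).2 hx) (aD'.pow 2) ?_ ?_ ?_
    · exact (isAlgebraic_four.neg).mul aT'
    · exact mul_ne_zero (by norm_num) ((map_ne_zero _).2 hT0)
    · rw [← map_pow, hR]
      simp only [map_sub, map_mul, map_pow, map_ofNat]
      ring
  intro h
  apply hRM
  have hCD : algebraMap K Ω ((1 - 2 * T / x) * D) ∈ algebraicAdjoin k (algebraMap K Ω x) := by
    have h1 := mem_algebraicAdjoin_of_isAlgebraic (x := algebraMap K Ω x) aT'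
    have h2 := mem_algebraicAdjoin_of_isAlgebraic (x := algebraMap K Ω x) aD'
    have h3 := mem_algebraicAdjoin_self (k := k) (x := algebraMap K Ω x)
    simp only [map_sub, map_mul, map_div₀, map_one, map_ofNat]
    exact mul_mem (sub_mem (one_mem _) (div_mem (mul_mem (ofNat_mem _ 2) h1) h3)) h2
  have e : algebraMap K Ω R = algebraMap K Ω ((1 - 2 * T / x) * (D * R)) /
      algebraMap K Ω ((1 - 2 * T / x) * D) := by
    rw [← map_div₀]
    congr 1
    field_simp
  rw [e]
  exact div_mem h hCD

/-- The degree of `Q(x,y;t)`. -/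
theorem relfinrank_extend_add {x y t T D R V Z : K}
    (hx : Transcendental (IntermediateField.adjoin ℚ {y, t}) x)
    (hy : Transcendental (IntermediateField.adjoin ℚ {x, t}) y)
    (ht : Transcendental (IntermediateField.adjoin ℚ {x, y}) t)
    (hT : T - 4 * T ^ 3 = t) (hD : D ^ 2 = 1 - 4 * T ^ 2)
    (hR : R ^ 2 = D ^ 2 - 4 * x * T) (hV : V ^ 2 = 1 - 4 * (1 + y) * T ^ 2)
    (hT0 : T ≠ 0) (hC : 1 - 2 * T / x ≠ 0) (hD0 : D ≠ 0) (hx0 : x ≠ 0) (hw0 : 1 + y ≠ 0)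
    (hA : 1 - 4 * T ^ 2 - 2 / (1 + y) ≠ 0) (hV0 : V ≠ 0) (h12 : 12 * T ^ 2 - 1 ≠ 0)
    (hZ : Z = (1 - 4 * T ^ 2 - 2 / (1 + y)) * V + (1 - 2 * T / x) * (D * R)) :
    (IntermediateField.adjoin ℚ {x, y, t}).relfinrank
      (extend (IntermediateField.adjoin ℚ {x, y, t}) Z) = 12 := by
  rw [← extend_adjoin_triple]
  set k := extend (IntermediateField.adjoin ℚ {x, y}) t with hk
  have hxk : x ∈ k := le_extend (IntermediateField.subset_adjoin _ _ (by simp))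
  have hyk : y ∈ k := le_extend (IntermediateField.subset_adjoin _ _ (by simp))
  have htk : t ∈ k := mem_extend_self
  have h4 : 4 * T ^ 2 - 1 ≠ 0 := by
    intro h
    apply hD0
    rw [← pow_eq_zero_iff two_ne_zero, hD]
    linear_combination -h
  -- algebraic elements
  let Ω := AlgebraicClosure K
  have hinj := (algebraMap K Ω).injective
  have htyt : t ∈ IntermediateField.adjoin ℚ {y, t} :=
    IntermediateField.subset_adjoin _ _ (by simp)
  have hyyt : y ∈ IntermediateField.adjoin ℚ {y, t} :=
    IntermediateField.subset_adjoin _ _ (by simp)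
  have htxt : t ∈ IntermediateField.adjoin ℚ {x, t} :=
    IntermediateField.subset_adjoin _ _ (by simp)
  have hxxt : x ∈ IntermediateField.adjoin ℚ {x, t} :=
    IntermediateField.subset_adjoin _ _ (by simp)
  -- Two test fields: M contains T with all its conjugates and V, but not β; N contains T but not V.
  set M := algebraicAdjoin (IntermediateField.adjoin ℚ {y, t}) (algebraMap K Ω x) with hM
  set N := algebraicAdjoin (IntermediateField.adjoin ℚ {x, t}) (algebraMap K Ω y) with hN
  have xM : algebraMap K Ω x ∈ M := mem_algebraicAdjoin_self
  have yM : algebraMap K Ω y ∈ M := mem_algebraicAdjoin_of_isAlgebraic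
    (isAlgebraic_algebraMap (⟨y, hyyt⟩ : IntermediateField.adjoin ℚ {y, t}))
  have tM : algebraMap K Ω t ∈ M := mem_algebraicAdjoin_of_isAlgebraic
    (isAlgebraic_algebraMap (⟨t, htyt⟩ : IntermediateField.adjoin ℚ {y, t}))
  have xN : algebraMap K Ω x ∈ N := mem_algebraicAdjoin_of_isAlgebraic
    (isAlgebraic_algebraMap (⟨x, hxxt⟩ : IntermediateField.adjoin ℚ {x, t}))
  have yN : algebraMap K Ω y ∈ N := mem_algebraicAdjoin_self
  have tN : algebraMap K Ω t ∈ N := mem_algebraicAdjoin_of_isAlgebraic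
    (isAlgebraic_algebraMap (⟨t, htxt⟩ : IntermediateField.adjoin ℚ {x, t}))
  have rootM : ∀ T' : Ω, T' - 4 * T' ^ 3 = algebraMap K Ω t → T' ∈ M := fun T' h =>
    mem_algebraicAdjoin_of_isAlgebraic
      (isAlgebraic_cubic (⟨t, htyt⟩ : IntermediateField.adjoin ℚ {y, t}) h)
  have aT : IsAlgebraic (IntermediateField.adjoin ℚ {x, t}) T :=
    isAlgebraic_cubic (⟨t, htxt⟩ : IntermediateField.adjoin ℚ {x, t}) hT
  have aT' := (isAlgebraic_algebraMap_iff (R := IntermediateField.adjoin ℚ {x, t}) hinj).2 aT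
  have TN : algebraMap K Ω T ∈ N := mem_algebraicAdjoin_of_isAlgebraic aT'
  have TM : algebraMap K Ω T ∈ M := rootM _ (by
    rw [← hT]; simp only [map_sub, map_mul, map_pow, map_ofNat])
  have bT : IsAlgebraic (IntermediateField.adjoin ℚ {y, t}) T :=
    isAlgebraic_cubic (⟨t, htyt⟩ : IntermediateField.adjoin ℚ {y, t}) hT
  have bV : IsAlgebraic (IntermediateField.adjoin ℚ {y, t}) V := IsAlgebraic.of_pow two_pos (by
    rw [hV]
    exact isAlgebraic_one.sub ((isAlgebraic_four.mul (isAlgebraic_one.add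
      (isAlgebraic_algebraMap (⟨y, hyyt⟩ : IntermediateField.adjoin ℚ {y, t})))).mul (bT.pow 2)))
  have VM : algebraMap K Ω V ∈ M := mem_algebraicAdjoin_of_isAlgebraic
    ((isAlgebraic_algebraMap_iff (R := IntermediateField.adjoin ℚ {y, t}) hinj).2 bV)
  have VN : algebraMap K Ω V ∉ N := by
    refine not_mem_algebraicAdjoin (c := 1 - 4 * algebraMap K Ω T ^ 2)
      (d := -4 * algebraMap K Ω T ^ 2)
      ((transcendental_algebraMap_iff hinj).2 hy) ?_ ?_ ?_ ?_
    · exact isAlgebraic_one.sub (isAlgebraic_four.mul (aT'.pow 2))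
    · exact (isAlgebraic_four.neg).mul (aT'.pow 2)
    · exact mul_ne_zero (by norm_num) (pow_ne_zero 2 ((map_ne_zero _).2 hT0))
    · rw [← map_pow, hV]
      simp only [map_sub, map_add, map_mul, map_pow, map_ofNat, map_one]
      ring
  have βM := sqrt_x_not_mem (Ω := Ω) hx htyt hT hD hR hT0 hC hD0
  rw [← hM] at βM
  -- the tower
  obtain ⟨α, hα⟩ : ∃ α, α = (1 - 4 * T ^ 2 - 2 / (1 + y)) * V := ⟨_, rfl⟩
  obtain ⟨β, hβ⟩ : ∃ β, β = (1 - 2 * T / x) * (D * R) := ⟨_, rfl⟩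
  rw [← hα, ← hβ] at hZ
  rw [← hβ] at βM
  have hα2 := sq_y_part hw0 hT rfl hV
  rw [← hα] at hα2
  have hβ2 := sq_x_part (R := D * R) hx0 hT rfl (by rw [mul_pow, hR, hD])
  rw [← hβ] at hβ2
  have hα0 : α ≠ 0 := by rw [hα]; exact mul_ne_zero hA hV0
  have αM : algebraMap K Ω α ∈ M := by
    rw [hα]
    simp only [map_sub, map_add, map_mul, map_div₀, map_pow, map_ofNat, map_one]
    exact mul_mem (sub_mem (sub_mem (one_mem _) (mul_mem (ofNat_mem _ 4) (pow_mem TM 2)))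
      (div_mem (ofNat_mem _ 2) (add_mem (one_mem _) yM))) VM
  -- Over k, the element Z generates the same field as T, V and β together.
  have key : ∀ B : IntermediateField ℚ K, k ≤ B → (Z ∈ B ↔ (T ∈ B ∧ V ∈ B) ∧ β ∈ B) := by
    intro B hB
    have xB := hB hxk
    have yB := hB hyk
    have tB := hB htk
    have wB : 1 + y ∈ B := add_mem (one_mem _) yB
    have AB : T ∈ B → 1 - 4 * T ^ 2 - 2 / (1 + y) ∈ B := fun hTB =>
      sub_mem (sub_mem (one_mem _) (mul_mem (ofNat_mem _ 4) (pow_mem hTB 2)))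
        (div_mem (ofNat_mem _ 2) wB)
    constructor
    · intro hZB
      rw [hZ] at hZB
      have aB : -4 * t ^ 2 * (1 + y) + 1 - 4 / (1 + y) + 4 / (1 + y) ^ 2 ∈ B :=
        add_mem (sub_mem (add_mem (mul_mem (mul_mem (neg_mem (ofNat_mem _ 4)) (pow_mem tB 2)) wB)
          (one_mem _)) (div_mem (ofNat_mem _ 4) wB)) (div_mem (ofNat_mem _ 4) (pow_mem wB 2))
      have bB : -4 * t * x + 1 - 4 * t / x + 4 * t ^ 2 / x ^ 2 ∈ B :=
        add_mem (sub_mem (add_mem (mul_mem (mul_mem (neg_mem (ofNat_mem _ 4)) tB) xB)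
          (one_mem _)) (div_mem (mul_mem (ofNat_mem _ 4) tB) xB))
          (div_mem (mul_mem (ofNat_mem _ 4) (pow_mem tB 2)) (pow_mem xB 2))
      have hTB : T ∈ B := by
        refine mem_of_add_sqrt (Ω := Ω) (M := M) hT h12 h4 hα2 hβ2 hα0 rootM αM ?_ ?_ βM tB aB bB
          hZB
        · have wM := add_mem (one_mem M) yM
          simp only [map_sub, map_add, map_mul, map_neg, map_div₀, map_pow, map_ofNat, map_one]
          exact add_mem (sub_mem (add_mem (mul_mem (mul_mem (neg_mem (ofNat_mem _ 4))
            (pow_mem tM 2)) wM) (one_mem _)) (div_mem (ofNat_mem _ 4) wM))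
            (div_mem (ofNat_mem _ 4) (pow_mem wM 2))
        · simp only [map_sub, map_add, map_mul, map_neg, map_div₀, map_pow, map_ofNat, map_one]
          exact add_mem (sub_mem (add_mem (mul_mem (mul_mem (neg_mem (ofNat_mem _ 4)) tM) xM)
            (one_mem _)) (div_mem (mul_mem (ofNat_mem _ 4) tM) xM))
            (div_mem (mul_mem (ofNat_mem _ 4) (pow_mem tM 2)) (pow_mem xM 2))
      have ξB : 8 * (T ^ 2 - 6 * T ^ 4) ∈ B :=
        mul_mem (ofNat_mem _ 8) (sub_mem (pow_mem hTB 2) (mul_mem (ofNat_mem _ 6) (pow_mem hTB 4)))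
      have α2B : α ^ 2 ∈ B := hα2 ▸ add_mem aB ξB
      have β2B : β ^ 2 ∈ B := hβ2 ▸ add_mem bB ξB
      -- From α+β, α² and β² one recovers α, provided α² ≠ β²; equality would put β = ±α in M.
      have hne : β ^ 2 - α ^ 2 ≠ 0 := by
        intro h
        have : (β - α) * (β + α) = 0 := by linear_combination h
        apply βM
        rcases mul_eq_zero.1 this with h | h
        · rw [sub_eq_zero.1 h]; exact αM
        · rw [eq_neg_of_add_eq_zero_left h, map_neg]; exact neg_mem αM
      have αB : α ∈ B := by
        have : α = ((α + β) * (((α + β) ^ 2 - α ^ 2 - β ^ 2) / 2) - α ^ 2 * (α + β)) /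
            (β ^ 2 - α ^ 2) := by
          rw [eq_div_iff hne]; ring
        rw [this]
        exact div_mem (sub_mem (mul_mem hZB (div_mem (sub_mem (sub_mem (pow_mem hZB 2) α2B) β2B)
          (ofNat_mem _ 2))) (mul_mem α2B hZB)) (sub_mem β2B α2B)
      refine ⟨⟨hTB, ?_⟩, ?_⟩
      · have : V = α / (1 - 4 * T ^ 2 - 2 / (1 + y)) := by rw [hα, mul_div_cancel_left₀ _ hA]
        rw [this]
        exact div_mem αB (AB hTB)
      · have : β = (α + β) - α := by ring
        rw [this]
        exact sub_mem hZB αB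
    · rintro ⟨⟨hTB, hVB⟩, hβB⟩
      rw [hZ, hα]
      exact add_mem (mul_mem (AB hTB) hVB) hβB
  have htower : extend k Z = extend (extend (extend k T) V) β := by
    apply le_antisymm
    · refine extend_le (le_extend.trans (le_extend.trans le_extend)) ?_
      exact (key _ (le_extend.trans (le_extend.trans le_extend))).2
        ⟨⟨le_extend (le_extend mem_extend_self), le_extend mem_extend_self⟩, mem_extend_self⟩
    · obtain ⟨⟨h1, h2⟩, h3⟩ := (key (extend k Z) le_extend).1 mem_extend_self
      exact extend_le (extend_le (extend_le le_extend h1) h2) h3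
  have kM : ∀ z ∈ k, algebraMap K Ω z ∈ M := by
    rw [hk, extend_adjoin_triple]
    exact map_mem_of_mem_adjoin (by rintro z (rfl | rfl | rfl) <;> assumption)
  have kN : ∀ z ∈ k, algebraMap K Ω z ∈ N := by
    rw [hk, extend_adjoin_triple]
    exact map_mem_of_mem_adjoin (by rintro z (rfl | rfl | rfl) <;> assumption)
  have d1 : k.relfinrank (extend k T) = 3 := relfinrank_extend_cubic ht hT
  have T1 : T ∈ extend k T := mem_extend_self
  have d2 : (extend k T).relfinrank (extend (extend k T) V) = 2 := by
    apply relfinrank_extend_sq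
    · exact fun h => VN (map_mem_of_mem_extend kN TN _ h)
    · rw [hV]
      exact sub_mem (one_mem _) (mul_mem (mul_mem (ofNat_mem _ 4)
        (add_mem (one_mem _) (le_extend hyk))) (pow_mem T1 2))
  have d3 : (extend (extend k T) V).relfinrank (extend (extend (extend k T) V) β) = 2 := by
    apply relfinrank_extend_sq
    · exact fun h => βM (map_mem_of_mem_extend (map_mem_of_mem_extend kM TM) VM _ h)
    · have tB : t ∈ extend (extend k T) V := le_extend (le_extend htk)
      have xB : x ∈ extend (extend k T) V := le_extend (le_extend hxk)
      have TB : T ∈ extend (extend k T) V := le_extend T1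
      rw [hβ2]
      exact add_mem (add_mem (sub_mem (add_mem (mul_mem (mul_mem (neg_mem (ofNat_mem _ 4)) tB) xB)
          (one_mem _)) (div_mem (mul_mem (ofNat_mem _ 4) tB) xB))
          (div_mem (mul_mem (ofNat_mem _ 4) (pow_mem tB 2)) (pow_mem xB 2)))
        (mul_mem (ofNat_mem _ 8) (sub_mem (pow_mem TB 2) (mul_mem (ofNat_mem _ 6) (pow_mem TB 4))))
  rw [htower, ← IntermediateField.relfinrank_mul_relfinrank
      ((le_extend (A := k) (a := T)).trans (le_extend (A := extend k T) (a := V))) le_extend,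
    ← IntermediateField.relfinrank_mul_relfinrank (le_extend (A := k) (a := T)) le_extend,
    d1, d2, d3]

/-- The degree of `Q(0,y;t)`. -/
theorem relfinrank_extend_zero_y {y t T V : K}
    (hy : Transcendental (IntermediateField.adjoin ℚ {t}) y)
    (ht : Transcendental (IntermediateField.adjoin ℚ {y}) t)
    (hT : T - 4 * T ^ 3 = t) (hV : V ^ 2 = 1 - 4 * (1 + y) * T ^ 2)
    (hT0 : T ≠ 0) (hw0 : 1 + y ≠ 0) (hA : 1 - 4 * T ^ 2 - 2 / (1 + y) ≠ 0)
    (h12 : 12 * T ^ 2 - 1 ≠ 0) (h4 : 4 * T ^ 2 - 1 ≠ 0) :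
    (IntermediateField.adjoin ℚ {y, t}).relfinrank
      (extend (IntermediateField.adjoin ℚ {y, t}) ((1 - 4 * T ^ 2 - 2 / (1 + y)) * V)) = 6 := by
  rw [← extend_adjoin_pair]
  set k := extend (IntermediateField.adjoin ℚ {y}) t with hk
  have hyk : y ∈ k := le_extend (IntermediateField.mem_adjoin_simple_self ℚ y)
  have htk : t ∈ k := mem_extend_self
  have htt : t ∈ IntermediateField.adjoin ℚ {t} := IntermediateField.mem_adjoin_simple_self ℚ t
  have hinj : Function.Injective (algebraMap K K) := Function.injective_id
  set N := algebraicAdjoin (IntermediateField.adjoin ℚ {t}) y with hN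
  have yN : y ∈ N := mem_algebraicAdjoin_self
  have tN : t ∈ N := mem_algebraicAdjoin_of_isAlgebraic
    (isAlgebraic_algebraMap (⟨t, htt⟩ : IntermediateField.adjoin ℚ {t}))
  have aT : IsAlgebraic (IntermediateField.adjoin ℚ {t}) T :=
    isAlgebraic_cubic (⟨t, htt⟩ : IntermediateField.adjoin ℚ {t}) hT
  have TN : T ∈ N := mem_algebraicAdjoin_of_isAlgebraic aT
  have VN : V ∉ N := by
    refine not_mem_algebraicAdjoin (c := 1 - 4 * T ^ 2) (d := -4 * T ^ 2) hy ?_ ?_ ?_ ?_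
    · exact isAlgebraic_one.sub (isAlgebraic_four.mul (aT.pow 2))
    · exact (isAlgebraic_four.neg).mul (aT.pow 2)
    · exact mul_ne_zero (by norm_num) (pow_ne_zero 2 hT0)
    · rw [hV]; ring
  have hα2 := sq_y_part hw0 hT rfl hV
  have AB : ∀ B : IntermediateField ℚ K, k ≤ B → T ∈ B → 1 - 4 * T ^ 2 - 2 / (1 + y) ∈ B :=
    fun B hB hTB => sub_mem (sub_mem (one_mem _) (mul_mem (ofNat_mem _ 4) (pow_mem hTB 2)))
      (div_mem (ofNat_mem _ 2) (add_mem (one_mem _) (hB hyk)))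
  have htower : extend k ((1 - 4 * T ^ 2 - 2 / (1 + y)) * V) = extend (extend k T) V := by
    apply le_antisymm
    · exact extend_le (le_extend.trans le_extend) (mul_mem
        (AB _ (le_extend.trans le_extend) (le_extend mem_extend_self)) mem_extend_self)
    · have hT' : T ∈ extend k ((1 - 4 * T ^ 2 - 2 / (1 + y)) * V) := by
        set B := extend k ((1 - 4 * T ^ 2 - 2 / (1 + y)) * V) with hB
        have hmem : (1 - 4 * T ^ 2 - 2 / (1 + y)) * V ∈ B := mem_extend_self
        have tB : t ∈ B := le_extend htk
        have wB : 1 + y ∈ B := add_mem (one_mem _) (le_extend hyk)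
        -- Squaring the element gives ξ, and ξ with t gives T; no conjugates are needed here.
        refine mem_of_resolvent hT tB ?_ h12 h4
        have : T ^ 2 - 6 * T ^ 4 = (((1 - 4 * T ^ 2 - 2 / (1 + y)) * V) ^ 2 -
            (-4 * t ^ 2 * (1 + y) + 1 - 4 / (1 + y) + 4 / (1 + y) ^ 2)) / 8 := by
          rw [hα2]; ring
        rw [this]
        exact div_mem (sub_mem (pow_mem hmem 2) (add_mem (sub_mem (add_mem (mul_mem (mul_mem
          (neg_mem (ofNat_mem _ 4)) (pow_mem tB 2)) wB) (one_mem _)) (div_mem (ofNat_mem _ 4) wB))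
          (div_mem (ofNat_mem _ 4) (pow_mem wB 2)))) (ofNat_mem _ 8)
      refine extend_le (extend_le le_extend hT') ?_
      have : V = ((1 - 4 * T ^ 2 - 2 / (1 + y)) * V) / (1 - 4 * T ^ 2 - 2 / (1 + y)) := by
        rw [mul_div_cancel_left₀ _ hA]
      rw [this]
      refine div_mem ?_ (AB _ ?_ ?_)
      · rw [← this]; exact mem_extend_self
      · rw [← this]; exact le_extend
      · rw [← this]; exact hT'
  have kN : ∀ z ∈ k, algebraMap K K z ∈ N := by
    rw [hk, extend_adjoin_pair]
    exact map_mem_of_mem_adjoin (by rintro z (rfl | rfl) <;> assumption)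
  have d2 : (extend k T).relfinrank (extend (extend k T) V) = 2 := by
    apply relfinrank_extend_sq
    · exact fun h => VN (map_mem_of_mem_extend kN TN _ h)
    · rw [hV]
      exact sub_mem (one_mem _) (mul_mem (mul_mem (ofNat_mem _ 4)
        (add_mem (one_mem _) (le_extend hyk))) (pow_mem mem_extend_self 2))
  rw [htower, ← IntermediateField.relfinrank_mul_relfinrank (le_extend (A := k) (a := T)) le_extend,
    relfinrank_extend_cubic ht hT, d2]

/-- D² = (1-2T)(1+2T), so with u = 1/(1-2T), which is transcendental over ℚ(x), one has (D/(1-2T))²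
= 2u-1. This is linear in u, and the field in question is contained in the rational functions of u
over algebraic elements. -/
theorem not_mem_extend_cubic {x t T D : K} (ht : Transcendental (IntermediateField.adjoin ℚ {x}) t)
    (hT : T - 4 * T ^ 3 = t) (hD : D ^ 2 = 1 - 4 * T ^ 2) :
    D ∉ extend (extend (IntermediateField.adjoin ℚ {x}) t) T := by
  have tT : Transcendental (IntermediateField.adjoin ℚ {x}) T := by
    intro h
    apply ht
    rw [← hT]
    exact h.sub (isAlgebraic_four.mul (h.pow 3))
  have h2 : IsAlgebraic (IntermediateField.adjoin ℚ {x}) (2 : K) := by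
    simpa using isAlgebraic_natCast (R := IntermediateField.adjoin ℚ {x}) (A := K) 2
  have tu : Transcendental (IntermediateField.adjoin ℚ {x}) (1 - 2 * T)⁻¹ := by
    intro h
    apply tT
    have h1 := h.inv
    rw [inv_inv] at h1
    have : T = (1 - (1 - 2 * T)) * (2 : K)⁻¹ := by
      rw [sub_sub_cancel, mul_comm, ← mul_assoc, inv_mul_cancel₀ two_ne_zero, one_mul]
    rw [this]
    exact (isAlgebraic_one.sub h1).mul h2.inv
  have u0 : 1 - 2 * T ≠ 0 := by
    intro h
    rw [h, inv_zero] at tu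
    exact tu isAlgebraic_zero
  have uM : 1 - 2 * T ∈ algebraicAdjoin (IntermediateField.adjoin ℚ {x}) (1 - 2 * T)⁻¹ := by
    have := inv_mem (mem_algebraicAdjoin_self (k := IntermediateField.adjoin ℚ {x})
      (x := (1 - 2 * T)⁻¹))
    rwa [inv_inv] at this
  have hr : D / (1 - 2 * T) ∉ algebraicAdjoin (IntermediateField.adjoin ℚ {x}) (1 - 2 * T)⁻¹ := by
    refine not_mem_algebraicAdjoin (c := -1) (d := 2) tu isAlgebraic_one.neg h2 two_ne_zero ?_
    rw [div_pow, hD, div_eq_iff (pow_ne_zero 2 u0)]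
    linear_combination (-2 * (1 - 2 * T)) * mul_inv_cancel₀ u0
  intro h
  apply hr
  set M := algebraicAdjoin (IntermediateField.adjoin ℚ {x}) (1 - 2 * T)⁻¹ with hM
  have TM : T ∈ M := by
    have : T = (1 - (1 - 2 * T)) / 2 := by
      rw [sub_sub_cancel, mul_div_cancel_left₀ _ two_ne_zero]
    rw [this]
    exact div_mem (sub_mem (one_mem _) uM) (ofNat_mem _ 2)
  have tM : t ∈ M := by
    rw [← hT]
    exact sub_mem TM (mul_mem (ofNat_mem _ 4) (pow_mem TM 3))
  have xM : ∀ z ∈ IntermediateField.adjoin ℚ {x}, z ∈ M := fun z hz =>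
    mem_algebraicAdjoin_of_isAlgebraic
      (isAlgebraic_algebraMap (⟨z, hz⟩ : IntermediateField.adjoin ℚ {x}))
  exact div_mem (extend_induction (extend_induction xM tM) TM _ h) uM

/-- The degree of `Q(x,0;t)`. -/
theorem relfinrank_extend_x_zero {x t T D R : K}
    (hx : Transcendental (IntermediateField.adjoin ℚ {t}) x)
    (ht : Transcendental (IntermediateField.adjoin ℚ {x}) t)
    (hT : T - 4 * T ^ 3 = t) (hD : D ^ 2 = 1 - 4 * T ^ 2)
    (hR : R ^ 2 = D ^ 2 - 4 * x * T) (hT0 : T ≠ 0) (hC : 1 - 2 * T / x ≠ 0) (hD0 : D ≠ 0)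
    (hx0 : x ≠ 0) (hD2 : 2 - D ^ 2 ≠ 0) :
    (IntermediateField.adjoin ℚ {x, t}).relfinrank (extend (IntermediateField.adjoin ℚ {x, t})
      (D * (2 - D ^ 2) - (1 - 2 * T / x) * (D * R))) = 12 ∧
    ∀ A : IntermediateField ℚ K, x ∈ A → T ∈ A → D ∈ A →
      A ≤ extend (extend (IntermediateField.adjoin ℚ {x, t}) T) D →
      A.relfinrank (extend A (D * (2 - D ^ 2) - (1 - 2 * T / x) * (D * R))) = 2 := by
  rw [← extend_adjoin_pair]
  set k := extend (IntermediateField.adjoin ℚ {x}) t with hk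
  have hxk : x ∈ k := le_extend (IntermediateField.mem_adjoin_simple_self ℚ x)
  have htk : t ∈ k := mem_extend_self
  have htt : t ∈ IntermediateField.adjoin ℚ {t} := IntermediateField.mem_adjoin_simple_self ℚ t
  let Ω := AlgebraicClosure K
  have hinj := (algebraMap K Ω).injective
  set M := algebraicAdjoin (IntermediateField.adjoin ℚ {t}) (algebraMap K Ω x) with hM
  have xM : algebraMap K Ω x ∈ M := mem_algebraicAdjoin_self
  have tM : algebraMap K Ω t ∈ M := mem_algebraicAdjoin_of_isAlgebraic
    (isAlgebraic_algebraMap (⟨t, htt⟩ : IntermediateField.adjoin ℚ {t}))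
  have rootM : ∀ D' : Ω, D' ^ 4 - D' ^ 6 = 4 * algebraMap K Ω t ^ 2 → D' ∈ M := fun D' h =>
    mem_algebraicAdjoin_of_isAlgebraic
      (isAlgebraic_sextic (⟨t, htt⟩ : IntermediateField.adjoin ℚ {t}) h)
  have aT : IsAlgebraic (IntermediateField.adjoin ℚ {t}) T :=
    isAlgebraic_cubic (⟨t, htt⟩ : IntermediateField.adjoin ℚ {t}) hT
  have TM : algebraMap K Ω T ∈ M := mem_algebraicAdjoin_of_isAlgebraic
    ((isAlgebraic_algebraMap_iff (R := IntermediateField.adjoin ℚ {t}) hinj).2 aT)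
  have htD : t = T * D ^ 2 := by rw [hD, ← hT]; ring
  have hD4 : D ^ 4 - D ^ 6 = 4 * t ^ 2 := by
    rw [htD]; linear_combination -D ^ 4 * hD
  have DM : algebraMap K Ω D ∈ M := rootM _ (by
    simp only [← map_pow, ← map_sub, hD4]
    simp only [map_mul, map_pow, map_ofNat])
  have βM := sqrt_x_not_mem (Ω := Ω) hx htt hT hD hR hT0 hC hD0
  rw [← hM] at βM
  obtain ⟨β, hβ⟩ : ∃ β, β = (1 - 2 * T / x) * (D * R) := ⟨_, rfl⟩
  rw [← hβ] at βM ⊢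
  have hβ2 := sq_x_part (R := D * R) hx0 hT rfl (by rw [mul_pow, hR, hD])
  rw [← hβ] at hβ2
  have hβ2' : β ^ 2 = (-4 * t * x + 1 - 4 * t / x + 4 * t ^ 2 / x ^ 2) +
      (2 * (1 - D ^ 2) - 3 * (1 - D ^ 2) ^ 2) := by
    rw [hβ2, hD]; ring
  have kM : ∀ z ∈ k, algebraMap K Ω z ∈ M := by
    rw [hk, extend_adjoin_pair]
    exact map_mem_of_mem_adjoin (by rintro z (rfl | rfl) <;> assumption)
  have bB : ∀ B : IntermediateField ℚ K, x ∈ B → t ∈ B →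
      -4 * t * x + 1 - 4 * t / x + 4 * t ^ 2 / x ^ 2 ∈ B := fun B xB tB =>
    add_mem (sub_mem (add_mem (mul_mem (mul_mem (neg_mem (ofNat_mem _ 4)) tB) xB)
      (one_mem _)) (div_mem (mul_mem (ofNat_mem _ 4) tB) xB))
      (div_mem (mul_mem (ofNat_mem _ 4) (pow_mem tB 2)) (pow_mem xB 2))
  have eB : ∀ B : IntermediateField ℚ K, D ∈ B → D * (2 - D ^ 2) ∈ B := fun B DB =>
    mul_mem DB (sub_mem (ofNat_mem _ 2) (pow_mem DB 2))
  have hquad : ∀ A : IntermediateField ℚ K, x ∈ A → T ∈ A → D ∈ A → A ≤ extend (extend k T) D →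
      A.relfinrank (extend A β) = 2 := by
    intro A xA TA DA hA
    apply relfinrank_extend_sq
    · exact fun h => βM (map_mem_of_mem_extend (map_mem_of_mem_extend kM TM) DM _ (hA h))
    · have tA : t ∈ A := htD ▸ mul_mem TA (pow_mem DA 2)
      rw [hβ2]
      exact add_mem (bB A xA tA) (mul_mem (ofNat_mem _ 8) (sub_mem (pow_mem TA 2)
        (mul_mem (ofNat_mem _ 6) (pow_mem TA 4))))
  have hext : ∀ A : IntermediateField ℚ K, D ∈ A →
      extend A (D * (2 - D ^ 2) - β) = extend A β := by
    intro A DA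
    apply le_antisymm
    · exact extend_le le_extend (sub_mem (eB _ (le_extend DA)) mem_extend_self)
    · refine extend_le le_extend ?_
      have : β = D * (2 - D ^ 2) - (D * (2 - D ^ 2) - β) := by ring
      have h2 := sub_mem (eB _ (le_extend (a := D * (2 - D ^ 2) - β) DA)) mem_extend_self
      rwa [← this] at h2
  refine ⟨?_, fun A xA TA DA hA => by rw [hext A DA]; exact hquad A xA TA DA hA⟩
  -- The element recovers D by the conjugate argument, then T = t/D², then β.
  have htower : extend k (D * (2 - D ^ 2) - β) = extend (extend (extend k T) D) β := by
    rw [← hext _ mem_extend_self]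
    apply le_antisymm
    · exact extend_le (le_extend.trans (le_extend.trans le_extend)) mem_extend_self
    · have hD' : D ∈ extend k (D * (2 - D ^ 2) - β) := by
        refine mem_of_sub_sqrt (Ω := Ω) (M := M) hD4 hD2 hβ2' rootM ?_ βM (le_extend htk)
          (bB _ (le_extend hxk) (le_extend htk)) mem_extend_self
        simp only [map_sub, map_add, map_mul, map_neg, map_div₀, map_pow, map_ofNat, map_one]
        exact add_mem (sub_mem (add_mem (mul_mem (mul_mem (neg_mem (ofNat_mem _ 4)) tM) xM)
          (one_mem _)) (div_mem (mul_mem (ofNat_mem _ 4) tM) xM))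
          (div_mem (mul_mem (ofNat_mem _ 4) (pow_mem tM 2)) (pow_mem xM 2))
      have hT' : T ∈ extend k (D * (2 - D ^ 2) - β) := by
        have : T = t / D ^ 2 := by rw [htD, mul_div_cancel_right₀ _ (pow_ne_zero 2 hD0)]
        have h2 := div_mem (le_extend (a := D * (2 - D ^ 2) - β) htk) (pow_mem hD' 2)
        rwa [← this] at h2
      exact extend_le (extend_le (extend_le le_extend hT') hD') mem_extend_self
  have d2 : (extend k T).relfinrank (extend (extend k T) D) = 2 := by
    apply relfinrank_extend_sq
    · exact not_mem_extend_cubic ht hT hD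
    · rw [hD]
      exact sub_mem (one_mem _) (mul_mem (ofNat_mem _ 4) (pow_mem mem_extend_self 2))
  have d3 := hquad (extend (extend k T) D) (le_extend (le_extend hxk)) (le_extend mem_extend_self)
    mem_extend_self le_rfl
  rw [htower, ← IntermediateField.relfinrank_mul_relfinrank
      ((le_extend (A := k) (a := T)).trans (le_extend (A := extend k T) (a := D))) le_extend,
    ← IntermediateField.relfinrank_mul_relfinrank (le_extend (A := k) (a := T)) le_extend,
    relfinrank_extend_cubic ht hT, d2, d3]

end Degrees

/-! ### Differential equations -/

/-- The derivation `t d/dt`. -/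
def eulerT (A : Type*) [CommRing A] : PowerSeries A →+ PowerSeries A where
  toFun F := PowerSeries.mk fun n => n * PowerSeries.coeff n F
  map_zero' := by ext n; simp
  map_add' F G := by ext n; simp [mul_add]

theorem coeff_eulerT {A : Type*} [CommRing A] (F : PowerSeries A) (n : ℕ) :
    PowerSeries.coeff n (eulerT A F) = n * PowerSeries.coeff n F := by
  simp [eulerT]

theorem eulerT_mul {A : Type*} [CommRing A] (F G : PowerSeries A) :
    eulerT A (F * G) = F * eulerT A G + G * eulerT A F := by
  ext n
  rw [mul_comm G]
  simp only [coeff_eulerT, PowerSeries.coeff_mul, map_add, Finset.mul_sum,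
    ← Finset.sum_add_distrib]
  refine Finset.sum_congr rfl fun p hp => ?_
  have hp' : p.1 + p.2 = n := by simpa using hp
  rw [← hp']
  push_cast
  ring

theorem eulerT_sq {A : Type*} [CommRing A] (F : PowerSeries A) :
    eulerT A (F ^ 2) = 2 * F * eulerT A F := by
  rw [sq, eulerT_mul]; ring

theorem eulerT_X (A : Type*) [CommRing A] : eulerT A PowerSeries.X = PowerSeries.X := by
  ext n
  rw [coeff_eulerT, PowerSeries.coeff_X]
  split_ifs with h
  · subst h; simp
  · simp

theorem eulerT_C {A : Type*} [CommRing A] (a : A) : eulerT A (PowerSeries.C a) = 0 := by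
  ext n
  rw [coeff_eulerT, PowerSeries.coeff_C]
  split_ifs with h
  · subst h; simp
  · simp

theorem eulerT_one {A : Type*} [CommRing A] : eulerT A 1 = 0 := by
  rw [← map_one PowerSeries.C, eulerT_C]

theorem eulerT_ofNat {A : Type*} [CommRing A] (m : ℕ) [m.AtLeastTwo] :
    eulerT A (ofNat(m) : PowerSeries A) = 0 := by
  rw [← map_ofNat PowerSeries.C, eulerT_C]

/-- The coefficientwise derivative on `ℚ[Y][[t]]`. -/
def derivY : PowerSeries (Polynomial ℚ) →+ PowerSeries (Polynomial ℚ) where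
  toFun F := PowerSeries.mk fun n => Polynomial.derivative (PowerSeries.coeff n F)
  map_zero' := by ext1 n; simp
  map_add' F G := by ext1 n; simp

theorem coeff_derivY (F : PowerSeries (Polynomial ℚ)) (n : ℕ) :
    PowerSeries.coeff n (derivY F) = Polynomial.derivative (PowerSeries.coeff n F) := by
  simp [derivY]

theorem derivY_mul (F G : PowerSeries (Polynomial ℚ)) :
    derivY (F * G) = F * derivY G + G * derivY F := by
  ext1 n
  rw [mul_comm G]
  simp only [coeff_derivY, PowerSeries.coeff_mul, map_add, Polynomial.derivative_sum,
    ← Finset.sum_add_distrib, Polynomial.derivative_mul]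
  refine Finset.sum_congr rfl fun p hp => ?_
  ring

theorem derivY_sq (F : PowerSeries (Polynomial ℚ)) : derivY (F ^ 2) = 2 * F * derivY F := by
  rw [sq, derivY_mul]; ring

theorem derivY_map_C (F : PowerSeries ℚ) : derivY (PowerSeries.map Polynomial.C F) = 0 := by
  ext1 n
  rw [coeff_derivY, PowerSeries.coeff_map, Polynomial.derivative_C, map_zero]

theorem derivY_one : derivY 1 = 0 := by
  rw [← map_one (PowerSeries.map Polynomial.C), derivY_map_C]

theorem derivY_ofNat (m : ℕ) [m.AtLeastTwo] :
    derivY (ofNat(m) : PowerSeries (Polynomial ℚ)) = 0 := by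
  rw [← map_ofNat (PowerSeries.map Polynomial.C), derivY_map_C]

theorem derivY_C_X : derivY (PowerSeries.C Polynomial.X) = 1 := by
  ext1 n
  rw [coeff_derivY, PowerSeries.coeff_C, PowerSeries.coeff_one]
  split_ifs <;> simp

/-- The differential equation of `t² Q(0,y;t)`. -/
theorem pde_of_isW {T : PowerSeries ℚ} {W g : PowerSeries (Polynomial ℚ)} (hT : IsT T)
    (hW : IsW T W) (hg : g = W * (1 - 4 * PowerSeries.map Polynomial.C T ^ 2 - 2 * W)) :
    2 * derivY (2 * eulerT _ g + 2 * (PowerSeries.C Polynomial.X * derivY g) - g) =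
      2 * PowerSeries.C Polynomial.X *
        derivY (eulerT _ g - 2 * g - 2 * (PowerSeries.C Polynomial.X * derivY g)) +
      3 * (eulerT _ g - 2 * g - 2 * (PowerSeries.C Polynomial.X * derivY g)) := by
  have hW0 := hW.1
  have hT' := congrArg (PowerSeries.map (Polynomial.C (R := ℚ))) hT.2
  have hW' := hW.2
  have cT := constantCoeff_map_C hT.1
  have dT := derivY_map_C T
  simp only [map_mul, map_sub, map_one, map_pow, map_ofNat, PowerSeries.map_X] at hT'
  generalize PowerSeries.map (Polynomial.C (R := ℚ)) T = τ at *
  have hYy := derivY_C_X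
  have hYt := eulerT_C (Polynomial.X : Polynomial ℚ)
  generalize PowerSeries.C (Polynomial.X : Polynomial ℚ) = Y at *
  have hTt := congrArg (eulerT (Polynomial ℚ)) hT'
  have hWt := congrArg (eulerT (Polynomial ℚ)) hW'
  have hWy := congrArg derivY hW'
  have hgt := congrArg (eulerT (Polynomial ℚ)) hg
  have hgy := congrArg derivY hg
  simp only [eulerT_mul, eulerT_ofNat, eulerT_sq, eulerT_one, eulerT_X, derivY_mul,
    derivY_ofNat, derivY_sq, derivY_one, map_sub, map_add, hYy, hYt, dT] at hTt hWt hWy hgt hgy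
  generalize eulerT (Polynomial ℚ) τ = Tt at *
  generalize eulerT (Polynomial ℚ) W = Wt at *
  have hV0 : (1 - 2 * (1 + Y) * W) ≠ 0 := ne_zero_of_constantCoeff (by simp [hW0])
  have hWyV : (1 - 2 * (1 + Y) * W) * derivY W = W ^ 2 := by
    linear_combination hWy
  have hTt' : Tt * (1 - 12 * τ ^ 2) = τ * (1 - 4 * τ ^ 2) := by
    linear_combination hTt - hT'
  have hWtV : (1 - 2 * (1 + Y) * W) * Wt = 2 * τ * Tt := by
    linear_combination hWt
  -- The factor 1-12T² produced by the equation of W cancels the one in the derivative of T.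
  have hgtV : (1 - 2 * (1 + Y) * W) * eulerT (Polynomial ℚ) g = 2 * τ ^ 2 * (1 - 4 * τ ^ 2) := by
    linear_combination (1 - 2 * (1 + Y) * W) * hgt + (1 - 4 * τ ^ 2 - 4 * W) * hWtV +
      2 * τ * hTt' - 16 * τ * Tt * hW'
  have hgyV : derivY g = derivY W * (1 - 4 * τ ^ 2 - 4 * W) := by
    linear_combination hgy
  obtain ⟨P, hP⟩ : ∃ P, P = 2 * eulerT (Polynomial ℚ) g + 2 * (Y * derivY g) - g := ⟨_, rfl⟩
  obtain ⟨P₂, hP₂⟩ : ∃ P, P = eulerT (Polynomial ℚ) g - 2 * g - 2 * (Y * derivY g) := ⟨_, rfl⟩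
  rw [← hP, ← hP₂]
  -- The equation of W eliminates y from the right side, here and for P₂, which leaves only W and T²
  -- to differentiate.
  have hPV : (1 - 2 * (1 + Y) * W) * P = W * (3 - (12 - 8 * τ ^ 2) * W + 8 * W ^ 2) := by
    linear_combination (1 - 2 * (1 + Y) * W) * (hP - hg + 2 * Y * hgyV) + 2 * hgtV +
      2 * Y * (1 - 4 * τ ^ 2 - 4 * W) * hWyV - (4 * (1 - 4 * τ ^ 2) - 12 * W) * hW'
  have hP₂V : (1 - 2 * (1 + Y) * W) * P₂ = W ^ 2 * (6 - 8 * τ ^ 2 - 8 * W) := by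
    linear_combination (1 - 2 * (1 + Y) * W) * (hP₂ - 2 * hg - 2 * Y * hgyV) + hgtV -
      2 * Y * (1 - 4 * τ ^ 2 - 4 * W) * hWyV - 2 * (1 - 4 * τ ^ 2) * hW'
  have hPy := congrArg derivY hPV
  have hP₂y := congrArg derivY hP₂V
  simp only [derivY_mul, derivY_ofNat, derivY_sq, derivY_one, map_sub, map_add, hYy, dT]
    at hPy hP₂y
  obtain ⟨V, hV⟩ : ∃ V, V = 1 - 2 * (1 + Y) * W := ⟨_, rfl⟩
  rw [← hV] at hV0 hWyV hPV hP₂V hPy hP₂y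
  have hPy' : V ^ 3 * derivY P = V * (3 - 2 * (12 - 8 * τ ^ 2) * W + 24 * W ^ 2) * W ^ 2 +
      (2 * V * W + 2 * (1 + Y) * W ^ 2) * (W * (3 - (12 - 8 * τ ^ 2) * W + 8 * W ^ 2)) := by
    linear_combination V ^ 2 * hPy + (V * (3 - 2 * (12 - 8 * τ ^ 2) * W + 24 * W ^ 2) +
      2 * (1 + Y) * V * P) * hWyV + (2 * V * W + 2 * (1 + Y) * W ^ 2) * hPV
  have hP₂y' : V ^ 3 * derivY P₂ = V * (2 * W * (6 - 8 * τ ^ 2) - 24 * W ^ 2) * W ^ 2 +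
      (2 * V * W + 2 * (1 + Y) * W ^ 2) * (W ^ 2 * (6 - 8 * τ ^ 2 - 8 * W)) := by
    linear_combination V ^ 2 * hP₂y + (V * (2 * W * (6 - 8 * τ ^ 2) - 24 * W ^ 2) +
      2 * (1 + Y) * V * P₂) * hWyV + (2 * V * W + 2 * (1 + Y) * W ^ 2) * hP₂V
  apply mul_left_cancel₀ (pow_ne_zero 3 hV0)
  -- After substituting T² = W(1-(1+y)W) this is an identity in the free variables W and y.
  have key : 2 * (V * (3 - 2 * (12 - 8 * τ ^ 2) * W + 24 * W ^ 2) * W ^ 2 +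
      (2 * V * W + 2 * (1 + Y) * W ^ 2) * (W * (3 - (12 - 8 * τ ^ 2) * W + 8 * W ^ 2))) =
      2 * Y * (V * (2 * W * (6 - 8 * τ ^ 2) - 24 * W ^ 2) * W ^ 2 +
      (2 * V * W + 2 * (1 + Y) * W ^ 2) * (W ^ 2 * (6 - 8 * τ ^ 2 - 8 * W))) +
      3 * V ^ 2 * (W ^ 2 * (6 - 8 * τ ^ 2 - 8 * W)) := by
    rw [← hW', hV]
    ring
  linear_combination 2 * hPy' - 2 * Y * hP₂y' - 3 * V ^ 2 * hP₂V + key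

/-- The differential equation of `2 t² Q(0,0;t) + 1`. -/
theorem ode_of_sqrt {T D : PowerSeries ℚ} (hT : T * D ^ 2 = PowerSeries.X)
    (hD0 : PowerSeries.constantCoeff D = 1) (hD : D ^ 2 = 1 - 4 * T ^ 2) {f : PowerSeries ℚ}
    (hf : f = D * (2 - D ^ 2)) :
    4 * eulerT ℚ (eulerT ℚ (eulerT ℚ f)) - 8 * eulerT ℚ (eulerT ℚ f) + 3 * eulerT ℚ f =
      PowerSeries.X ^ 2 * (12 * (9 * eulerT ℚ (eulerT ℚ (eulerT ℚ f)) -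
        9 * eulerT ℚ (eulerT ℚ f) - eulerT ℚ f + f)) := by
  have hX : 4 * PowerSeries.X ^ 2 = (1 - D ^ 2) * (D ^ 2) ^ 2 := by
    rw [← hT, hD]; ring
  have hD' : D ≠ 0 := by
    rintro rfl
    simp at hD0
  have hu : 2 - 3 * D ^ 2 ≠ 0 := by
    intro h
    have := congrArg PowerSeries.constantCoeff h
    simp only [map_sub, map_mul, map_pow, map_ofNat, hD0, map_zero] at this
    norm_num at this
  have h1 := congrArg (eulerT ℚ) hX
  simp only [eulerT_mul, eulerT_ofNat, eulerT_sq, eulerT_one, eulerT_X, map_sub] at h1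
  have hD1 : eulerT ℚ D * (2 - 3 * D ^ 2) = (1 - D ^ 2) * D := by
    apply mul_left_cancel₀ (mul_ne_zero (ne_zero_of_constantCoeff
      (by rw [map_ofNat]; exact two_ne_zero) : (2 : PowerSeries ℚ) ≠ 0) (pow_ne_zero 3 hD'))
    linear_combination 2 * hX - h1
  have hf1 := congrArg (eulerT ℚ) hf
  simp only [eulerT_mul, eulerT_ofNat, eulerT_sq, map_sub] at hf1
  -- The derivative of D(2-D²) with respect to D is 2-3D², exactly the denominator of the derivative
  -- of D.
  replace hf1 : eulerT ℚ f = D - D * D ^ 2 := by linear_combination hf1 + hD1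
  have hf2 := congrArg (eulerT ℚ) hf1
  simp only [eulerT_mul, eulerT_sq, map_sub] at hf2
  replace hf2 : eulerT ℚ (eulerT ℚ f) = (1 - 3 * D ^ 2) * eulerT ℚ D := by
    linear_combination hf2
  have hf3 := congrArg (eulerT ℚ) hf2
  have hD2 := congrArg (eulerT ℚ) hD1
  simp only [eulerT_mul, eulerT_ofNat, eulerT_sq, eulerT_one, map_sub] at hf3 hD2
  rw [hf3, hf2, hf1, hf]
  generalize eulerT ℚ (eulerT ℚ D) = D2 at *
  generalize eulerT ℚ D = D1 at *
  obtain ⟨u, hu'⟩ : ∃ u, u = 2 - 3 * D ^ 2 := ⟨_, rfl⟩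
  rw [← hu'] at hu hD1 hD2
  have hD2' : u ^ 3 * D2 = u * (1 - 3 * D ^ 2) * ((1 - D ^ 2) * D) +
      6 * D * ((1 - D ^ 2) * D) ^ 2 := by
    linear_combination u ^ 2 * hD2 + (u * (1 - 3 * D ^ 2) +
      6 * D * (D1 * u + (1 - D ^ 2) * D)) * hD1
  have hD1' : (u * D1) ^ 2 = ((1 - D ^ 2) * D) ^ 2 := by rw [mul_comm, hD1]
  have e : PowerSeries.X ^ 2 * (12 * (9 * ((1 - 3 * D ^ 2) * D2 + D1 * (0 - 3 * (2 * D * D1))) -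
      9 * ((1 - 3 * D ^ 2) * D1) - (D - D * D ^ 2) + D * (2 - D ^ 2))) =
      3 * ((1 - D ^ 2) * (D ^ 2) ^ 2) * (9 * ((1 - 3 * D ^ 2) * D2 - 6 * D * D1 ^ 2) -
      9 * ((1 - 3 * D ^ 2) * D1) - (D - D * D ^ 2) + D * (2 - D ^ 2)) := by
    rw [← hX]; ring
  apply mul_left_cancel₀ (pow_ne_zero 3 hu)
  subst hu'
  linear_combination (4 - 27 * (1 - D ^ 2) * D ^ 4) *
      ((1 - 3 * D ^ 2) * hD2' - 6 * D * (2 - 3 * D ^ 2) * hD1') +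
    (27 * (1 - D ^ 2) * D ^ 4 - 8) * (1 - 3 * D ^ 2) * (2 - 3 * D ^ 2) ^ 2 * hD1 -
    (2 - 3 * D ^ 2) ^ 3 * e

/-! ### Recurrences from the differential equations -/

theorem coeff_ofNat_mul {A : Type*} [CommRing A] (c : ℕ) [c.AtLeastTwo] (k : ℕ)
    (F : PowerSeries A) :
    PowerSeries.coeff k (ofNat(c) * F) = ofNat(c) * PowerSeries.coeff k F := by
  rw [← map_ofNat PowerSeries.C, PowerSeries.coeff_C_mul]

theorem coeff_X_mul_derivative {A : Type*} [CommRing A] (p : Polynomial A) (j : ℕ) :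
    (Polynomial.X * Polynomial.derivative p).coeff j = j * p.coeff j := by
  cases j with
  | zero => simp
  | succ j =>
    rw [Polynomial.coeff_X_mul, Polynomial.coeff_derivative]
    push_cast
    ring

/-- With θ = t d/dt, the two sides of the equation are θ(2θ-1)(2θ-3) and 12t²(θ-1)(9θ²-1) applied to
the series. -/
theorem coeff_succ_succ_of_ode {T D : PowerSeries ℚ} (hT : T * D ^ 2 = PowerSeries.X)
    (hD0 : PowerSeries.constantCoeff D = 1) (hD : D ^ 2 = 1 - 4 * T ^ 2) (n : ℕ) :
    ((n : ℚ) + 2) * (2 * n + 1) * (2 * n + 3) *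
        PowerSeries.coeff (n + 2) (D * (2 - D ^ 2)) =
      12 * ((n : ℚ) - 1) * (9 * n ^ 2 - 1) * PowerSeries.coeff n (D * (2 - D ^ 2)) := by
  have h := congrArg (PowerSeries.coeff (n + 2)) (ode_of_sqrt hT hD0 hD rfl)
  simp only [map_add, map_sub, coeff_ofNat_mul, coeff_eulerT, PowerSeries.coeff_X_pow_mul] at h
  push_cast at h
  linear_combination h

/-- With θ = t d/dt and ∂ = d/dy, the equation is 2∂(2θ+2y∂-1)g = (2y∂+3)(θ-2-2y∂)g. On y^j t^n the
operators θ and y∂ act as n and j, and the outer ∂ lowers j by one. -/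
theorem coeff_succ_of_pde {T : PowerSeries ℚ} {W : PowerSeries (Polynomial ℚ)} (hT : IsT T)
    (hW : IsW T W) {g : PowerSeries (Polynomial ℚ)}
    (hg : g = W * (1 - 4 * PowerSeries.map Polynomial.C T ^ 2 - 2 * W)) (n j : ℕ) :
    2 * ((j : ℚ) + 1) * (2 * n + 2 * j + 1) * (PowerSeries.coeff n g).coeff (j + 1) =
      (2 * (j : ℚ) + 3) * (n - 2 - 2 * j) * (PowerSeries.coeff n g).coeff j := by
  have h := pde_of_isW hT hW hg
  have h₂ : ∀ j, (PowerSeries.coeff n (eulerT _ g - 2 * g -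
      2 * (PowerSeries.C Polynomial.X * derivY g))).coeff j =
      (n - 2 - 2 * j) * (PowerSeries.coeff n g).coeff j := by
    intro j
    simp only [map_sub, coeff_ofNat_mul, PowerSeries.coeff_C_mul, coeff_eulerT, coeff_derivY,
      Polynomial.coeff_sub, Polynomial.coeff_ofNat_mul, Polynomial.coeff_natCast_mul,
      coeff_X_mul_derivative]
    ring
  have h₁ : ∀ j, (PowerSeries.coeff n (2 * eulerT _ g +
      2 * (PowerSeries.C Polynomial.X * derivY g) - g)).coeff j =
      (2 * n + 2 * j - 1) * (PowerSeries.coeff n g).coeff j := by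
    intro j
    simp only [map_add, map_sub, coeff_ofNat_mul, PowerSeries.coeff_C_mul, coeff_eulerT,
      coeff_derivY, Polynomial.coeff_add, Polynomial.coeff_sub, Polynomial.coeff_ofNat_mul,
      Polynomial.coeff_natCast_mul, coeff_X_mul_derivative]
    ring
  replace h := congrArg (fun F => (PowerSeries.coeff n F).coeff j) h
  simp only [map_add, mul_assoc 2 (PowerSeries.C _), coeff_ofNat_mul, PowerSeries.coeff_C_mul,
    coeff_derivY, Polynomial.coeff_add, Polynomial.coeff_ofNat_mul, coeff_X_mul_derivative] at h
  rw [Polynomial.coeff_derivative, h₁, h₂] at h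
  push_cast at h
  linear_combination h

/-! ### The hypergeometric coefficients -/

theorem coeffFormula_zero_zero : coeffFormula 0 0 = 1 := by
  norm_num [coeffFormula, Nat.factorial]

theorem coeffFormula_succ_left {n j : ℕ} (h : j ≤ n) :
    (4 * n + 2 * j + 5) * (4 * n + 2 * j + 7) * (n + 1 - j) * (n + 2) * coeffFormula (n + 1) j =
      6 * (2 * n + 1) * (6 * n + 5) * (6 * n + 7) * (n + 1) * coeffFormula n j := by
  -- Writing n = j+d removes the truncated subtraction from the factorials.
  obtain ⟨d, rfl⟩ := Nat.exists_eq_add_of_le h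
  have e1 : j + d + 1 - j = d + 1 := by omega
  have e2 : j + d - j = d := by omega
  have f1 : ∀ m : ℕ, (m.factorial : ℚ) ≠ 0 := fun m => by exact_mod_cast m.factorial_ne_zero
  simp only [coeffFormula, e1, e2]
  rw [show 6 * (j + d + 1) + 1 = (6 * (j + d) + 1) + 1 + 1 + 1 + 1 + 1 + 1 by ring,
    show 2 * (j + d + 1) + j + 1 = (2 * (j + d) + j + 1) + 1 + 1 by ring,
    show 3 * (j + d + 1) = 3 * (j + d) + 1 + 1 + 1 by ring,
    show 4 * (j + d + 1) + 2 * j + 3 = (4 * (j + d) + 2 * j) + 1 + 1 + 1 + 1 + 1 + 1 + 1 by ring,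
    show 4 * (j + d) + 2 * j + 3 = (4 * (j + d) + 2 * j) + 1 + 1 + 1 by ring]
  simp only [Nat.factorial_succ]
  have g1 := f1 (3 * (j + d))
  have g2 := f1 (4 * (j + d) + 2 * j)
  have g3 := f1 d
  have g4 := f1 j
  generalize Nat.factorial (6 * (j + d)) = a1 at *
  generalize Nat.factorial (2 * (j + d) + j) = a2 at *
  generalize Nat.factorial (3 * (j + d)) = a3 at *
  generalize Nat.factorial (4 * (j + d) + 2 * j) = a4 at *
  generalize Nat.factorial (2 * j) = a5 at *
  push_cast
  field_simp
  ring

theorem coeffFormula_succ_right {n j : ℕ} (h : j < n) :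
    (j + 1) * (4 * n + 2 * j + 5) * coeffFormula n (j + 1) =
      (2 * j + 3) * (n - j) * coeffFormula n j := by
  obtain ⟨d, rfl⟩ := Nat.exists_eq_add_of_lt h
  have e1 : j + d + 1 - (j + 1) = d := by omega
  have e2 : j + d + 1 - j = d + 1 := by omega
  have f1 : ∀ m : ℕ, (m.factorial : ℚ) ≠ 0 := fun m => by exact_mod_cast m.factorial_ne_zero
  simp only [coeffFormula, e1, e2]
  rw [show 2 * (j + 1) + 1 = 2 * j + 1 + 1 + 1 by ring,
    show 2 * (j + d + 1) + (j + 1) + 1 = (2 * (j + d + 1) + j + 1) + 1 by ring,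
    show 4 * (j + d + 1) + 2 * (j + 1) + 3 =
      (4 * (j + d + 1) + 2 * j) + 1 + 1 + 1 + 1 + 1 by ring,
    show 4 * (j + d + 1) + 2 * j + 3 = (4 * (j + d + 1) + 2 * j) + 1 + 1 + 1 by ring]
  have g1 := f1 (3 * (j + d + 1))
  have g2 := f1 (4 * (j + d + 1) + 2 * j)
  have g3 := f1 d
  have g4 := f1 j
  generalize Nat.factorial (6 * (j + d + 1) + 1) = a1 at *
  generalize Nat.factorial (3 * (j + d + 1)) = a3 at *
  simp only [Nat.factorial_succ]
  generalize Nat.factorial (2 * (j + d + 1) + j) = a2 at *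
  generalize Nat.factorial (4 * (j + d + 1) + 2 * j) = a4 at *
  generalize Nat.factorial (2 * j) = a5 at *
  push_cast
  field_simp
  ring

/-! ### The square roots in terms of S -/

/-- As T = S/(1+S²), the series 1-4T² is the square of (1-S²)/(1+S²). -/
theorem exists_sqrt_of_isS {T S : PowerSeries ℚ} (hT : IsT T) (hS : IsS T S) :
    ∃ D : PowerSeries ℚ, PowerSeries.constantCoeff D = 1 ∧ D ^ 2 = 1 - 4 * T ^ 2 ∧
      T * D ^ 2 = PowerSeries.X ∧ (1 + S ^ 2) * D = 1 - S ^ 2 := by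
  have hc : PowerSeries.constantCoeff (1 + S ^ 2) = 1 := by simp [hS.1]
  have hc0 : (1 + S ^ 2) ≠ 0 := ne_zero_of_constantCoeff (by rw [hc]; exact one_ne_zero)
  have hm : (1 + S ^ 2) * (1 + S ^ 2)⁻¹ = 1 :=
    PowerSeries.mul_inv_cancel _ (by rw [hc]; exact one_ne_zero)
  have hD : (1 + S ^ 2) * ((1 - S ^ 2) * (1 + S ^ 2)⁻¹) = 1 - S ^ 2 := by
    linear_combination (1 - S ^ 2) * hm
  generalize (1 - S ^ 2) * (1 + S ^ 2)⁻¹ = D at hD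
  have hD2 : D ^ 2 = 1 - 4 * T ^ 2 := by
    apply mul_left_cancel₀ (pow_ne_zero 2 hc0)
    linear_combination ((1 + S ^ 2) * D + (1 - S ^ 2)) * hD -
      4 * (S + T * (1 + S ^ 2)) * hS.2
  refine ⟨D, ?_, hD2, by rw [hD2]; exact hT.2, hD⟩
  have := congrArg PowerSeries.constantCoeff hD
  simpa [hS.1] using this

/-- R₁ is R/(1+S²), which passes from the radicand of the statement to D²-4xT. -/
theorem exists_sqrt_of_isR {T S D : PowerSeries ℚ} {R : PowerSeries (Polynomial ℚ)}
    (hS : IsS T S) (hR : IsR S R) (hD : (1 + S ^ 2) * D = 1 - S ^ 2) :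
    ∃ R₁ : PowerSeries (Polynomial ℚ), PowerSeries.constantCoeff R₁ = 1 ∧
      R₁ ^ 2 = PowerSeries.map Polynomial.C D ^ 2 -
        4 * PowerSeries.C Polynomial.X * PowerSeries.map Polynomial.C T ∧
      PowerSeries.map Polynomial.C (1 + S ^ 2) * R₁ = R := by
  have hc : PowerSeries.constantCoeff (1 + S ^ 2) = 1 := by simp [hS.1]
  have hm : PowerSeries.map (Polynomial.C (R := ℚ)) (1 + S ^ 2) *
      PowerSeries.map Polynomial.C (1 + S ^ 2)⁻¹ = 1 := by
    rw [← map_mul, PowerSeries.mul_inv_cancel _ (by rw [hc]; exact one_ne_zero), map_one]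
  have hR₁ : PowerSeries.map (Polynomial.C (R := ℚ)) (1 + S ^ 2) *
      (R * PowerSeries.map Polynomial.C (1 + S ^ 2)⁻¹) = R := by
    linear_combination R * hm
  generalize R * PowerSeries.map (Polynomial.C (R := ℚ)) (1 + S ^ 2)⁻¹ = R₁ at hR₁
  have hc1 : PowerSeries.constantCoeff (PowerSeries.map (Polynomial.C (R := ℚ)) (1 + S ^ 2)) = 1 := by
    rw [constantCoeff_map, hc, map_one]
  have hc0 : PowerSeries.map (Polynomial.C (R := ℚ)) (1 + S ^ 2) ≠ 0 :=
    ne_zero_of_constantCoeff (by rw [hc1]; exact one_ne_zero)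
  refine ⟨R₁, ?_, ?_, hR₁⟩
  · have := congrArg PowerSeries.constantCoeff hR₁
    rwa [map_mul, hc1, one_mul, hR.1] at this
  · apply mul_left_cancel₀ (pow_ne_zero 2 hc0)
    have h1 := congrArg (PowerSeries.map (Polynomial.C (R := ℚ))) hD
    have h2 := congrArg (PowerSeries.map (Polynomial.C (R := ℚ))) hS.2
    have h3 := hR.2
    simp only [map_mul, map_add, map_sub, map_one, map_pow] at h1 h2 hR₁ ⊢
    generalize PowerSeries.map (Polynomial.C (R := ℚ)) S = s at *
    generalize PowerSeries.map (Polynomial.C (R := ℚ)) T = τ at *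
    generalize PowerSeries.map (Polynomial.C (R := ℚ)) D = d at *
    linear_combination ((1 + s ^ 2) * R₁ + R) * hR₁ + h3 - ((1 + s ^ 2) * d + (1 - s ^ 2)) * h1 -
      4 * PowerSeries.C Polynomial.X * (1 + s ^ 2) * h2

theorem embY_C_X : embY (PowerSeries.C Polynomial.X) = y := by
  rw [embY_apply, seriesVar_C_X]; rfl

theorem embY_map_C (F : PowerSeries ℚ) : embY (PowerSeries.map Polynomial.C F) = embT F := by
  rw [embY_apply, seriesVar_map_C]; rfl

theorem embX_C_X : embX (PowerSeries.C Polynomial.X) = x := by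
  rw [embX_apply, seriesVar_C_X]; rfl

theorem embX_map_C (F : PowerSeries ℚ) : embX (PowerSeries.map Polynomial.C F) = embT F := by
  rw [embX_apply, seriesVar_map_C]; rfl

theorem one_add_y_ne_zero : 1 + y ≠ 0 := by
  have h : emb (PowerSeries.C (1 + MvPolynomial.X 1)) ≠ 0 := by
    apply emb_ne_zero
    rw [PowerSeries.constantCoeff_C]
    intro h
    have := congrArg (MvPolynomial.eval 0) h
    simp at this
  simpa [y] using h

/-! ### The coefficients of `Q(0,y;t)` -/

theorem coeff_aeval_X (i : Fin 2) (p : Polynomial ℚ) (j : ℕ) :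
    MvPolynomial.coeff (Finsupp.single i j)
      (Polynomial.aeval (MvPolynomial.X i : MvPolynomial (Fin 2) ℚ) p) = p.coeff j := by
  induction p using Polynomial.induction_on' with
  | add p q hp hq => rw [map_add, MvPolynomial.coeff_add, hp, hq, Polynomial.coeff_add]
  | monomial n a =>
    rw [Polynomial.aeval_monomial, MvPolynomial.algebraMap_eq, MvPolynomial.X_pow_eq_monomial,
      MvPolynomial.C_mul_monomial, mul_one, MvPolynomial.coeff_monomial, Polynomial.coeff_monomial]
    exact if_congr (Finsupp.single_injective i).eq_iff rfl rfl

theorem sq_t_mul_Q0y {T : PowerSeries ℚ} {W : PowerSeries (Polynomial ℚ)} (hT : IsT T)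
    (hW : IsW T W) :
    t ^ 2 * emb Q0y = embY W * (1 - 4 * embT T ^ 2 - 2 * embY W) := by
  obtain ⟨S, hS⟩ := exists_isS hT
  obtain ⟨R, hR⟩ := exists_isR hS
  obtain ⟨D, hD0, hD, hTD, hSD⟩ := exists_sqrt_of_isS hT hS
  obtain ⟨R₁, hR0, hR₁, -⟩ := exists_sqrt_of_isR hS hR hSD
  obtain ⟨-, h, -⟩ := explicit_formulas hT.1 hTD hD0 hD hR0 hR₁ hW.1 hW.2 rfl
  have e1 := congrArg embT hD
  have e2 := congrArg embY hW.2
  simp only [map_mul, map_sub, map_add, map_one, map_pow, map_ofNat] at e1 e2 h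
  rw [embY_C_X, embY_map_C] at e2
  rw [embY_C_X] at h
  have := charZero_seriesField
  have hw : (2 : SeriesField) * (1 + y) ^ 2 ≠ 0 :=
    mul_ne_zero two_ne_zero (pow_ne_zero 2 one_add_y_ne_zero)
  apply mul_left_cancel₀ hw
  linear_combination h + (2 * (1 + y) ^ 2 * embY W - (1 + y)) * e1 - 4 * (1 + y) * e2

theorem two_mul_sq_t_mul_Q00 {T D : PowerSeries ℚ} (hT : IsT T)
    (hD0 : PowerSeries.constantCoeff D = 1) (hD : D ^ 2 = 1 - 4 * T ^ 2)
    (hTD : T * D ^ 2 = PowerSeries.X) :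
    2 * t ^ 2 * emb Q00 = embT (D * (2 - D ^ 2)) - 1 := by
  obtain ⟨S, hS⟩ := exists_isS hT
  obtain ⟨W, hW⟩ := exists_isW hT
  obtain ⟨R, hR⟩ := exists_isR hS
  obtain ⟨D', hD0', hD', -, hSD⟩ := exists_sqrt_of_isS hT hS
  obtain rfl : D' = D := eq_of_sq_eq_sq hD0' hD0 (hD'.trans hD.symm)
  obtain ⟨R₁, hR0, hR₁, -⟩ := exists_sqrt_of_isR hS hR hSD
  obtain ⟨-, -, h⟩ := explicit_formulas hT.1 hTD hD0 hD hR0 hR₁ hW.1 hW.2 rfl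
  rw [h]
  simp only [map_mul, map_sub, map_pow, map_ofNat]
  ring

theorem q_zero_zero_zero : q 0 0 0 = 1 := by
  have h := coeff_Q 0 0
  rw [show PowerSeries.coeff 0 Q = 1 from Qn_zero] at h
  simp only [Finsupp.coe_zero, Pi.zero_apply, MvPolynomial.coeff_zero_one] at h
  exact_mod_cast h.symm

theorem coeff_Q0y (m : Fin 2 →₀ ℕ) (n : ℕ) :
    MvPolynomial.coeff m (PowerSeries.coeff n Q0y) = if m 0 = 0 then (q 0 (m 1) n : ℚ) else 0 := by
  rw [Q0y, coeff_specialise, coeff_aeval_zero_left, coeff_Q]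
  split_ifs with h
  · rw [h]
  · rfl

theorem q_zero_left_eq {T : PowerSeries ℚ} {W : PowerSeries (Polynomial ℚ)} (hT : IsT T)
    (hW : IsW T W) (j n : ℕ) :
    (q 0 j n : ℚ) = (PowerSeries.coeff (n + 2)
      (W * (1 - 4 * PowerSeries.map Polynomial.C T ^ 2 - 2 * W))).coeff j := by
  have h : PowerSeries.X ^ 2 * Q0y =
      seriesVar 1 (W * (1 - 4 * PowerSeries.map Polynomial.C T ^ 2 - 2 * W)) := by
    apply emb_injective
    rw [map_mul, map_pow]
    refine (sq_t_mul_Q0y hT hW).trans ?_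
    rw [← embY_apply]
    simp only [map_mul, map_sub, map_one, map_pow, map_ofNat, embY_map_C]
  have h' := congrArg (fun F => MvPolynomial.coeff (Finsupp.single 1 j)
    (PowerSeries.coeff (n + 2) F)) h
  simp only [PowerSeries.coeff_X_pow_mul, coeff_Q0y] at h'
  rw [if_pos (by simp), Finsupp.single_eq_same] at h'
  rw [h', seriesVar, PowerSeries.coeff_map]
  exact coeff_aeval_X 1 _ j

theorem q_zero_zero_eq {T D : PowerSeries ℚ} (hT : IsT T)
    (hD0 : PowerSeries.constantCoeff D = 1) (hD : D ^ 2 = 1 - 4 * T ^ 2)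
    (hTD : T * D ^ 2 = PowerSeries.X) (n : ℕ) :
    2 * (q 0 0 n : ℚ) = PowerSeries.coeff (n + 2) (D * (2 - D ^ 2)) := by
  have h : 2 * PowerSeries.X ^ 2 * Q00 = seriesT (D * (2 - D ^ 2)) - 1 := by
    apply emb_injective
    have := two_mul_sq_t_mul_Q00 hT hD0 hD hTD
    rw [embT_apply] at this
    simp only [map_mul, map_pow, map_sub, map_ofNat, map_one] at this ⊢
    exact this
  have h' := congrArg (fun F => MvPolynomial.coeff 0 (PowerSeries.coeff (n + 2) F)) h
  simp only [mul_assoc, coeff_ofNat_mul, PowerSeries.coeff_X_pow_mul, map_sub, Q00,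
    coeff_specialise, aeval_zero_zero] at h'
  rw [← map_ofNat MvPolynomial.C, MvPolynomial.coeff_C_mul, coeff_aeval_zero_left,
    coeff_aeval_zero_right, coeff_Q, seriesT, PowerSeries.coeff_map, PowerSeries.coeff_one,
    if_neg (show ¬n + 2 = 0 by omega), sub_zero, MvPolynomial.coeff_C] at h'
  simpa using h'

theorem q_zero_zero_recursion (n : ℕ) :
    ((n : ℚ) + 4) * (2 * n + 5) * (2 * n + 7) * q 0 0 (n + 2) =
      12 * ((n : ℚ) + 1) * (9 * (n + 2) ^ 2 - 1) * q 0 0 n := by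
  obtain ⟨T, hT⟩ := exists_isT
  obtain ⟨S, hS⟩ := exists_isS hT
  obtain ⟨D, hD0, hD, hTD, -⟩ := exists_sqrt_of_isS hT hS
  have h := coeff_succ_succ_of_ode hTD hD0 hD (n + 2)
  rw [← q_zero_zero_eq hT hD0 hD hTD, ← q_zero_zero_eq hT hD0 hD hTD] at h
  push_cast at h
  linear_combination h / 2

/-- The factor n-1 of the recurrence vanishes at n = 1, which starts the induction over odd lengths.
-/
theorem q_zero_zero_one : q 0 0 1 = 0 := by
  obtain ⟨T, hT⟩ := exists_isT
  obtain ⟨S, hS⟩ := exists_isS hT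
  obtain ⟨D, hD0, hD, hTD, -⟩ := exists_sqrt_of_isS hT hS
  have h := coeff_succ_succ_of_ode hTD hD0 hD 1
  rw [← q_zero_zero_eq hT hD0 hD hTD] at h
  norm_num at h
  exact h

theorem q_zero_left_recursion (n j : ℕ) :
    2 * ((j : ℚ) + 1) * (2 * n + 2 * j + 5) * q 0 (j + 1) n =
      (2 * (j : ℚ) + 3) * (n - 2 * j) * q 0 j n := by
  obtain ⟨T, hT⟩ := exists_isT
  obtain ⟨W, hW⟩ := exists_isW hT
  have h := coeff_succ_of_pde hT hW rfl (n + 2) j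
  rw [← q_zero_left_eq hT hW, ← q_zero_left_eq hT hW] at h
  push_cast at h
  linear_combination h

theorem q_odd (n j : ℕ) : q 0 j (2 * n + 1) = 0 := by
  induction j with
  | zero =>
    induction n with
    | zero => exact q_zero_zero_one
    | succ n ih =>
      have := q_zero_zero_recursion (2 * n + 1)
      rw [ih] at this
      push_cast at this
      rw [mul_zero] at this
      have e : ((2 * (n : ℚ) + 1 + 4) * (2 * (2 * n + 1) + 5) * (2 * (2 * n + 1) + 7)) ≠ 0 := by
        positivity
      exact_mod_cast (mul_eq_zero.1 this).resolve_left e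
  | succ j ih =>
    have := q_zero_left_recursion (2 * n + 1) j
    rw [ih] at this
    push_cast at this
    rw [mul_zero] at this
    have e : (2 * ((j : ℚ) + 1) * (2 * (2 * n + 1) + 2 * j + 5)) ≠ 0 := by
      positivity
    exact_mod_cast (mul_eq_zero.1 this).resolve_left e

theorem q_even_of_lt {n j : ℕ} (h : n < j) : q 0 j (2 * n) = 0 := by
  obtain ⟨d, rfl⟩ := Nat.exists_eq_add_of_lt h
  have e : ∀ j : ℕ, (2 * ((j : ℚ) + 1) * (2 * (2 * n : ℕ) + 2 * j + 5)) ≠ 0 := by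
    intro j; positivity
  induction d with
  | zero =>
    -- At j = n the factor 2n-2j is zero, and every later coefficient vanishes with this one.
    have := q_zero_left_recursion (2 * n) n
    rw [show (((2 * n : ℕ) : ℚ) - 2 * n) = 0 by push_cast; ring, mul_zero, zero_mul] at this
    exact_mod_cast (mul_eq_zero.1 this).resolve_left (e n)
  | succ d ih =>
    have := q_zero_left_recursion (2 * n) (n + d + 1)
    rw [ih (by omega), Nat.cast_zero, mul_zero] at this
    exact_mod_cast (mul_eq_zero.1 this).resolve_left (e _)

theorem q_even_of_le {n j : ℕ} (h : j ≤ n) : (q 0 j (2 * n) : ℚ) = coeffFormula n j := by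
  induction j with
  | zero =>
    induction n with
    | zero => rw [coeffFormula_zero_zero, mul_zero, q_zero_zero_zero, Nat.cast_one]
    | succ n ih =>
      have r := q_zero_zero_recursion (2 * n)
      have r' := coeffFormula_succ_left (Nat.zero_le n)
      rw [ih (Nat.zero_le n)] at r
      push_cast at r r'
      have e : ((4 * (n : ℚ) + 5) * (4 * n + 7) * (n + 1) * (n + 2)) ≠ 0 := by positivity
      apply mul_left_cancel₀ e
      linear_combination (n + 1) / 2 * r - r'
  | succ j ih =>
    have r := q_zero_left_recursion (2 * n) j
    have r' := coeffFormula_succ_right (Nat.lt_of_succ_le h)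
    rw [ih (by omega)] at r
    push_cast at r r'
    have e : (((j : ℚ) + 1) * (4 * n + 2 * j + 5)) ≠ 0 := by positivity
    apply mul_left_cancel₀ e
    linear_combination r / 2 - r'

theorem doublyHypergeometric_q : DoublyHypergeometric (fun n j => (q 0 j (2 * n) : ℚ)) := by
  have ne : ∀ (A : MvPolynomial (Fin 2) ℚ) (n j : ℚ), MvPolynomial.eval ![n, j] A ≠ 0 → A ≠ 0 := by
    rintro A n j h rfl
    exact h (map_zero _)
  constructor
  · refine ⟨(4 * .X 0 + 2 * .X 1 + 5) * (4 * .X 0 + 2 * .X 1 + 7) * (.X 0 + 1 - .X 1) * (.X 0 + 2),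
      6 * (2 * .X 0 + 1) * (6 * .X 0 + 5) * (6 * .X 0 + 7) * (.X 0 + 1),
      ne _ 0 0 (by norm_num), ne _ 0 0 (by norm_num), fun n j => ?_⟩
    simp only [map_mul, map_add, map_sub, map_one, map_ofNat, MvPolynomial.eval_X,
      Matrix.cons_val_zero, Matrix.cons_val_one]
    -- At j = n+1 the product formula gives no ratio, but n+1-j = 0 on the left and the coefficient
    -- on the right vanishes.
    rcases lt_trichotomy j (n + 1) with h | h | h
    · rw [q_even_of_le (by omega), q_even_of_le (by omega)]
      exact coeffFormula_succ_left (by omega)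
    · rw [q_even_of_lt (show n < j by omega), h]
      push_cast
      ring
    · rw [q_even_of_lt (show n < j by omega), q_even_of_lt h]
      simp
  · refine ⟨(.X 1 + 1) * (4 * .X 0 + 2 * .X 1 + 5), (2 * .X 1 + 3) * (.X 0 - .X 1),
      ne _ 0 0 (by norm_num), ne _ 1 0 (by norm_num), fun n j => ?_⟩
    have := q_zero_left_recursion (2 * n) j
    push_cast at this
    simp only [map_mul, map_add, map_sub, map_one, map_ofNat, MvPolynomial.eval_X,
      Matrix.cons_val_zero, Matrix.cons_val_one]
    linear_combination this / 2

theorem Q0y_eq : Q0y = PowerSeries.mk (fun m =>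
      if Even m then
        ∑ j ∈ Finset.range (m / 2 + 1),
          MvPolynomial.C (coeffFormula (m / 2) j) * MvPolynomial.X 1 ^ j
      else 0) := by
  ext1 n
  rw [PowerSeries.coeff_mk]
  ext m
  rw [coeff_Q0y]
  split_ifs with h hn hn
  · obtain ⟨k, rfl⟩ := hn.two_dvd
    rw [Nat.mul_div_cancel_left k two_pos, MvPolynomial.coeff_sum]
    have e : ∀ j, MvPolynomial.coeff m (MvPolynomial.C (coeffFormula k j) *
        (MvPolynomial.X 1 : MvPolynomial (Fin 2) ℚ) ^ j) =
        if j = m 1 then coeffFormula k j else 0 := by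
      intro j
      rw [MvPolynomial.X_pow_eq_monomial, MvPolynomial.C_mul_monomial, mul_one,
        MvPolynomial.coeff_monomial]
      refine if_congr ?_ rfl rfl
      rw [Finsupp.ext_iff, Fin.forall_fin_two]
      simp [h]
    simp only [e, Finset.sum_ite_eq', Finset.mem_range]
    split_ifs with hm
    · exact q_even_of_le (by omega)
    · rw [q_even_of_lt (by omega), Nat.cast_zero]
  · obtain ⟨k, rfl⟩ := Nat.not_even_iff_odd.1 hn
    rw [q_odd, Nat.cast_zero, MvPolynomial.coeff_zero]
  · rw [MvPolynomial.coeff_sum]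
    refine (Finset.sum_eq_zero fun j _ => ?_).symm
    rw [MvPolynomial.X_pow_eq_monomial, MvPolynomial.C_mul_monomial, mul_one,
      MvPolynomial.coeff_monomial, if_neg]
    rintro rfl
    simp at h
  · rw [MvPolynomial.coeff_zero]

/-! ### Degrees -/

/-- Replaces a generating function by the combination of square roots to which it is affinely
related. -/
theorem extend_eq_of_affine {F K : Type*} [Field F] [Field K] [Algebra F K]
    {A : IntermediateField F K} {a b c d : K} (hc : c ∈ A) (hd : d ∈ A) (hc0 : c ≠ 0)
    (h : a = c * b + d) : extend A a = extend A b := by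
  apply le_antisymm
  · refine extend_le le_extend ?_
    rw [h]
    exact add_mem (mul_mem (le_extend hc) mem_extend_self) (le_extend hd)
  · refine extend_le le_extend ?_
    have : b = (a - d) * c⁻¹ := by rw [h]; field_simp; ring
    rw [this]
    exact mul_mem (sub_mem mem_extend_self (le_extend hd)) (inv_mem (le_extend hc))

section Degrees

variable {K : Type*} [Field K] [CharZero K] [Algebra ℚ K] {x y t T D R V F G Q Q₀ : K}

theorem degree_x_y
    (hx : Transcendental (IntermediateField.adjoin ℚ {y, t}) x)
    (hy : Transcendental (IntermediateField.adjoin ℚ {x, t}) y)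
    (ht : Transcendental (IntermediateField.adjoin ℚ {x, y}) t)
    (hT : T - 4 * T ^ 3 = t) (hD : D ^ 2 = 1 - 4 * T ^ 2)
    (hR : R ^ 2 = D ^ 2 - 4 * x * T) (hV : V ^ 2 = 1 - 4 * (1 + y) * T ^ 2)
    (hT0 : T ≠ 0) (hC : 1 - 2 * T / x ≠ 0) (hD0 : D ≠ 0) (hx0 : x ≠ 0) (hw0 : 1 + y ≠ 0)
    (hA : 1 - 4 * T ^ 2 - 2 / (1 + y) ≠ 0) (hV0 : V ≠ 0) (h12 : 12 * T ^ 2 - 1 ≠ 0)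
    (ht0 : t ≠ 0) (hK : x * y - t * (1 + y) * (1 + x ^ 2 * (1 + y)) ≠ 0)
    (hF : 2 * t ^ 2 * (1 + x ^ 2) * x * F =
      x * (D * (2 - D ^ 2)) - (x - 2 * T) * D * R - 2 * t * (1 + x ^ 2))
    (hG : 2 * t ^ 2 * (1 + y) ^ 2 * G = (1 + y) - 2 - (D ^ 2 * (1 + y) - 2) * V)
    (hQ₀ : 2 * t ^ 2 * Q₀ = -D ^ 3 + 2 * D - 1)
    (hQ : (x * y - t * (1 + y) * (1 + x ^ 2 * (1 + y))) * Q =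
      x * y - t * (1 + x ^ 2) * F - t * (1 + y) * G + t * Q₀) :
    IsAlgebraic (IntermediateField.adjoin ℚ {x, y, t}) Q ∧
      (minpoly (IntermediateField.adjoin ℚ {x, y, t}) Q).natDegree = 12 := by
  apply isAlgebraic_and_natDegree (by norm_num)
  have hxk : x ∈ IntermediateField.adjoin ℚ {x, y, t} :=
    IntermediateField.subset_adjoin _ _ (by simp)
  have hyk : y ∈ IntermediateField.adjoin ℚ {x, y, t} :=
    IntermediateField.subset_adjoin _ _ (by simp)
  have htk : t ∈ IntermediateField.adjoin ℚ {x, y, t} :=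
    IntermediateField.subset_adjoin _ _ (by simp)
  have h := relfinrank_extend_add hx hy ht hT hD hR hV hT0 hC hD0 hx0 hw0 hA hV0 h12 rfl
  generalize IntermediateField.adjoin ℚ {x, y, t} = k at *
  rw [← h]
  congr 1
  have h2 : (2 : K) ∈ k := ofNat_mem k 2
  refine extend_eq_of_affine
    (c := (2 * t * (x * y - t * (1 + y) * (1 + x ^ 2 * (1 + y))))⁻¹)
    (d := (2 * t * (x * y - t * (1 + y) * (1 + x ^ 2 * (1 + y))))⁻¹ *
      (2 * t * x * y + 2 * t * (1 + x ^ 2) / x - ((1 + y) - 2) / (1 + y) - 1)) ?_ ?_ ?_ ?_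
  · repeat' first | assumption | exact one_mem _ | apply neg_mem | apply inv_mem | apply div_mem |
        apply mul_mem | apply add_mem | apply sub_mem | apply pow_mem
  · repeat' first | assumption | exact one_mem _ | apply neg_mem | apply inv_mem | apply div_mem |
        apply mul_mem | apply add_mem | apply sub_mem | apply pow_mem
  · exact inv_ne_zero (mul_ne_zero (mul_ne_zero two_ne_zero ht0) hK)
  · obtain ⟨k', hk'⟩ : ∃ k', k' = x * y - t * (1 + y) * (1 + x ^ 2 * (1 + y)) := ⟨_, rfl⟩
    rw [← hk'] at hK hQ ⊢
    obtain ⟨w, hw⟩ : ∃ w, w = 1 + y := ⟨_, rfl⟩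
    rw [← hw] at hw0 hQ hG ⊢
    rw [← hD]
    -- The radical-free terms of the three boundary series lie in ℚ(x,y,t), except D(2-D²), which
    -- occurs in both Q(x,0) and Q(0,0) and cancels.
    have e : 2 * t * k' * x * w * Q =
        x * w * ((D ^ 2 - 2 / w) * V + (1 - 2 * T / x) * (D * R)) + x * w * (2 * t * x * y +
        2 * t * (1 + x ^ 2) / x - (w - 2) / w - 1) := by
      field_simp
      linear_combination 2 * t * x * w * hQ - w * hF - x * hG + x * w * hQ₀
    rw [← mul_add]
    have hxw := mul_ne_zero hx0 hw0
    rw [eq_inv_mul_iff_mul_eq₀ (mul_ne_zero (mul_ne_zero two_ne_zero ht0) hK)]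
    apply mul_left_cancel₀ hxw
    linear_combination e

theorem degree_zero_y
    (hy : Transcendental (IntermediateField.adjoin ℚ {t}) y)
    (ht : Transcendental (IntermediateField.adjoin ℚ {y}) t)
    (hT : T - 4 * T ^ 3 = t) (hD : D ^ 2 = 1 - 4 * T ^ 2)
    (hV : V ^ 2 = 1 - 4 * (1 + y) * T ^ 2) (hT0 : T ≠ 0) (hw0 : 1 + y ≠ 0)
    (hA : 1 - 4 * T ^ 2 - 2 / (1 + y) ≠ 0) (h12 : 12 * T ^ 2 - 1 ≠ 0) (hD0 : D ≠ 0) (ht0 : t ≠ 0)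
    (hG : 2 * t ^ 2 * (1 + y) ^ 2 * G = (1 + y) - 2 - (D ^ 2 * (1 + y) - 2) * V) :
    IsAlgebraic (IntermediateField.adjoin ℚ {y, t}) G ∧
      (minpoly (IntermediateField.adjoin ℚ {y, t}) G).natDegree = 6 := by
  apply isAlgebraic_and_natDegree (by norm_num)
  have hyk : y ∈ IntermediateField.adjoin ℚ {y, t} :=
    IntermediateField.subset_adjoin _ _ (by simp)
  have htk : t ∈ IntermediateField.adjoin ℚ {y, t} :=
    IntermediateField.subset_adjoin _ _ (by simp)
  have h4 : 4 * T ^ 2 - 1 ≠ 0 := by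
    rw [← neg_ne_zero, neg_sub, ← hD]
    exact pow_ne_zero 2 hD0
  have h := relfinrank_extend_zero_y hy ht hT hV hT0 hw0 hA h12 h4
  generalize IntermediateField.adjoin ℚ {y, t} = k at *
  rw [← h]
  congr 1
  have h2 : (2 : K) ∈ k := ofNat_mem k 2
  have hne : 2 * t ^ 2 * (1 + y) ≠ 0 := mul_ne_zero (mul_ne_zero two_ne_zero (pow_ne_zero 2 ht0)) hw0
  refine extend_eq_of_affine (c := -(2 * t ^ 2 * (1 + y))⁻¹)
    (d := (2 * t ^ 2 * (1 + y))⁻¹ * ((1 + y - 2) / (1 + y))) ?_ ?_ ?_ ?_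
  · repeat' first | assumption | exact one_mem _ | apply neg_mem | apply inv_mem | apply div_mem |
        apply mul_mem | apply add_mem | apply sub_mem | apply pow_mem
  · repeat' first | assumption | exact one_mem _ | apply neg_mem | apply inv_mem | apply div_mem |
        apply mul_mem | apply add_mem | apply sub_mem | apply pow_mem
  · exact neg_ne_zero.2 (inv_ne_zero hne)
  · rw [neg_mul, neg_add_eq_sub, ← mul_sub, eq_inv_mul_iff_mul_eq₀ hne, ← hD]
    field_simp
    linear_combination hG

theorem degree_x_zero
    (hx : Transcendental (IntermediateField.adjoin ℚ {t}) x)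
    (ht : Transcendental (IntermediateField.adjoin ℚ {x}) t)
    (hT : T - 4 * T ^ 3 = t) (hD : D ^ 2 = 1 - 4 * T ^ 2)
    (hR : R ^ 2 = D ^ 2 - 4 * x * T) (hT0 : T ≠ 0) (hC : 1 - 2 * T / x ≠ 0) (hD0 : D ≠ 0)
    (hx0 : x ≠ 0) (hD2 : 2 - D ^ 2 ≠ 0) (ht0 : t ≠ 0) (hx1 : 1 + x ^ 2 ≠ 0) {S : K}
    (hS : S = T * (1 + S ^ 2)) (hSD : (1 + S ^ 2) * D = 1 - S ^ 2) (hS1 : 1 + S ^ 2 ≠ 0)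
    (hF : 2 * t ^ 2 * (1 + x ^ 2) * x * F =
      x * (D * (2 - D ^ 2)) - (x - 2 * T) * D * R - 2 * t * (1 + x ^ 2)) :
    (IsAlgebraic (IntermediateField.adjoin ℚ {x, t}) F ∧
      (minpoly (IntermediateField.adjoin ℚ {x, t}) F).natDegree = 12) ∧
    (IsAlgebraic (IntermediateField.adjoin ℚ {x, S}) F ∧
      (minpoly (IntermediateField.adjoin ℚ {x, S}) F).natDegree = 2) := by
  have h2 : ∀ k : IntermediateField ℚ K, (2 : K) ∈ k := fun k => ofNat_mem k 2
  have h4 : ∀ k : IntermediateField ℚ K, (4 : K) ∈ k := fun k => ofNat_mem k 4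
  have hD1 : 1 + D ≠ 0 := by
    intro h
    have : (2 : K) = 0 := by linear_combination (1 + S ^ 2) * h - hSD
    exact two_ne_zero this
  have key : ∀ k : IntermediateField ℚ K, x ∈ k → t ∈ k →
      extend k F = extend k (D * (2 - D ^ 2) - (1 - 2 * T / x) * (D * R)) := by
    intro k hxk htk
    have h2 := h2 k
    have hne : 2 * t ^ 2 * (1 + x ^ 2) ≠ 0 :=
      mul_ne_zero (mul_ne_zero two_ne_zero (pow_ne_zero 2 ht0)) hx1
    refine extend_eq_of_affine (c := (2 * t ^ 2 * (1 + x ^ 2))⁻¹)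
      (d := -(2 * t ^ 2 * (1 + x ^ 2))⁻¹ * (2 * t * (1 + x ^ 2) / x)) ?_ ?_ (inv_ne_zero hne) ?_
    · repeat' first | assumption | exact one_mem _ | apply neg_mem | apply inv_mem | apply div_mem |
        apply mul_mem | apply add_mem | apply sub_mem | apply pow_mem
    · repeat' first | assumption | exact one_mem _ | apply neg_mem | apply inv_mem | apply div_mem |
        apply mul_mem | apply add_mem | apply sub_mem | apply pow_mem
    · rw [neg_mul, ← sub_eq_add_neg, ← mul_sub, eq_inv_mul_iff_mul_eq₀ hne]
      field_simp
      linear_combination hF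
  obtain ⟨h12, hdeg2⟩ := relfinrank_extend_x_zero hx ht hT hD hR hT0 hC hD0 hx0 hD2
  constructor
  · apply isAlgebraic_and_natDegree (by norm_num)
    rw [← h12, key _ (IntermediateField.subset_adjoin _ _ (by simp))
      (IntermediateField.subset_adjoin _ _ (by simp))]
  · apply isAlgebraic_and_natDegree (by norm_num)
    have hxk : x ∈ IntermediateField.adjoin ℚ {x, S} :=
      IntermediateField.subset_adjoin _ _ (by simp)
    have hSk : S ∈ IntermediateField.adjoin ℚ {x, S} :=
      IntermediateField.subset_adjoin _ _ (by simp)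
    have hTS : T = S / (1 + S ^ 2) := by rw [eq_div_iff hS1]; exact hS.symm
    have hDS : D = (1 - S ^ 2) / (1 + S ^ 2) := by rw [eq_div_iff hS1]; linear_combination hSD
    have hTk : T ∈ IntermediateField.adjoin ℚ {x, S} := by
      rw [hTS]
      repeat' first | assumption | exact one_mem _ | apply neg_mem | apply inv_mem | apply div_mem |
        apply mul_mem | apply add_mem | apply sub_mem | apply pow_mem
    have hDk : D ∈ IntermediateField.adjoin ℚ {x, S} := by
      rw [hDS]
      repeat' first | assumption | exact one_mem _ | apply neg_mem | apply inv_mem | apply div_mem |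
        apply mul_mem | apply add_mem | apply sub_mem | apply pow_mem
    have htk : t ∈ IntermediateField.adjoin ℚ {x, S} := by
      have h4 := h4 (IntermediateField.adjoin ℚ {x, S})
      rw [← hT]
      repeat' first | assumption | exact one_mem _ | apply neg_mem | apply inv_mem | apply div_mem |
        apply mul_mem | apply add_mem | apply sub_mem | apply pow_mem
    rw [key _ hxk htk]
    refine hdeg2 _ hxk hTk hDk ?_
    rw [IntermediateField.adjoin_le_iff]
    rintro z (rfl | rfl)
    · exact le_extend (le_extend (IntermediateField.subset_adjoin _ _ (by simp)))
    · have : z = 2 * T / (1 + D) := by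
        rw [eq_div_iff hD1]
        apply mul_left_cancel₀ hS1
        linear_combination 2 * hS + z * hSD
      rw [this]
      have h2 := h2 (extend (extend (IntermediateField.adjoin ℚ {x, t}) T) D)
      have hDm : D ∈ extend (extend (IntermediateField.adjoin ℚ {x, t}) T) D := mem_extend_self
      have hTm : T ∈ extend (extend (IntermediateField.adjoin ℚ {x, t}) T) D :=
        le_extend mem_extend_self
      exact div_mem (mul_mem h2 hTm) (add_mem (one_mem _) hDm)

end Degrees

/-! ### Algebraic independence of the variables -/

/-- Polynomials in t, x, y are polynomials in t over ℚ[x,y], and these embed in ℚ[x,y][[t]]. The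
variable t comes first to match `MvPolynomial.finSuccEquiv`. -/
theorem algebraicIndependent_t_x_y : AlgebraicIndependent ℚ ![t, x, y] := by
  have h : (MvPolynomial.aeval ![t, x, y] : MvPolynomial (Fin 3) ℚ →ₐ[ℚ] SeriesField).toRingHom =
      emb.comp (Polynomial.coeToPowerSeries.ringHom.comp
        (MvPolynomial.finSuccEquiv ℚ 2 : MvPolynomial (Fin 3) ℚ →ₐ[ℚ] _).toRingHom) := by
    apply MvPolynomial.ringHom_ext
    · intro r
      rw [← RingHom.comp_apply, ← RingHom.comp_apply]
      exact RingHom.congr_fun (Subsingleton.elim _ _) r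
    · intro i
      refine Fin.cases ?_ (fun i => ?_) i
      · simp [t, MvPolynomial.finSuccEquiv_X_zero]
      · have e : MvPolynomial.finSuccEquiv ℚ 2 (MvPolynomial.X i.succ) =
            Polynomial.C (MvPolynomial.X i) := MvPolynomial.finSuccEquiv_X_succ
        simp only [AlgHom.toRingHom_eq_coe, RingHom.coe_coe, RingHom.comp_apply,
          MvPolynomial.aeval_X, Matrix.cons_val_succ]
        refine Eq.trans ?_ (congrArg (fun p => emb (Polynomial.coeToPowerSeries.ringHom p)) e.symm)
        fin_cases i <;> simp [x, y]
  have h' : Function.Injective (MvPolynomial.aeval ![t, x, y] :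
      MvPolynomial (Fin 3) ℚ →ₐ[ℚ] SeriesField).toRingHom := by
    rw [h]
    exact emb_injective.comp ((Polynomial.coe_injective _).comp
      (MvPolynomial.finSuccEquiv ℚ 2).injective)
  exact h'

theorem transcendental_adjoin_of_notMem {I : Set (Fin 3)} {i : Fin 3} {s : Set SeriesField}
    (hs : ![t, x, y] '' I = s) (h : i ∉ I) :
    Transcendental (IntermediateField.adjoin ℚ s) (![t, x, y] i) := by
  subst hs
  exact IntermediateField.transcendental_adjoin_iff.2
    (algebraicIndependent_t_x_y.transcendental_adjoin h)

theorem transcendental_x_y_t : Transcendental (IntermediateField.adjoin ℚ {y, t}) x := 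
  transcendental_adjoin_of_notMem (I := {2, 0}) (i := 1) (by simp [Set.image_pair]) (by simp)

theorem transcendental_y_x_t : Transcendental (IntermediateField.adjoin ℚ {x, t}) y := 
  transcendental_adjoin_of_notMem (I := {1, 0}) (i := 2) (by simp [Set.image_pair]) (by simp)

theorem transcendental_t_x_y : Transcendental (IntermediateField.adjoin ℚ {x, y}) t := 
  transcendental_adjoin_of_notMem (I := {1, 2}) (i := 0) (by simp [Set.image_pair]) (by simp)

theorem transcendental_x_t : Transcendental (IntermediateField.adjoin ℚ {t}) x := 
  transcendental_adjoin_of_notMem (I := {0}) (i := 1) (by simp) (by simp)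

theorem transcendental_y_t : Transcendental (IntermediateField.adjoin ℚ {t}) y := 
  transcendental_adjoin_of_notMem (I := {0}) (i := 2) (by simp) (by simp)

theorem transcendental_t_x : Transcendental (IntermediateField.adjoin ℚ {x}) t := 
  transcendental_adjoin_of_notMem (I := {1}) (i := 0) (by simp) (by simp)

theorem transcendental_t_y : Transcendental (IntermediateField.adjoin ℚ {y}) t := 
  transcendental_adjoin_of_notMem (I := {2}) (i := 0) (by simp) (by simp)

/-! ### The formulas in the field of fractions -/

theorem formula_of_sqrt {K : Type*} [Field K] {x t S T D R R₁ F : K} (hx : x ≠ 0)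
    (hx1 : 1 + x ^ 2 ≠ 0) (hS0 : S ≠ 0) (hS1 : 1 - S ^ 2 ≠ 0) (h2 : (2 : K) ≠ 0)
    (hS : S = T * (1 + S ^ 2)) (hD : (1 + S ^ 2) * D = 1 - S ^ 2) (ht : T * D ^ 2 = t)
    (hR : (1 + S ^ 2) * R₁ = R)
    (hF : 2 * t ^ 2 * (1 + x ^ 2) * x * F =
      x * (D * (2 - D ^ 2)) - (x - 2 * T) * D * R₁ - 2 * t * (1 + x ^ 2)) :
    F = ((1 + S ^ 2) / (1 - S ^ 2)) ^ 3 *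
      ((x * (1 + 6 * S ^ 2 + S ^ 4) - 2 * S * (1 - S ^ 2) * (1 + x ^ 2) -
        (x - 2 * S + x * S ^ 2) * R) / (2 * x * (1 + x ^ 2) * S ^ 2)) := by
  rw [div_pow, div_mul_div_comm, eq_div_iff (by
    simp only [ne_eq, mul_eq_zero, pow_eq_zero_iff two_ne_zero, pow_eq_zero_iff three_ne_zero,
      h2, hx, hx1, hS0, hS1, or_self, not_false_eq_true])]
  apply mul_left_cancel₀ hS1
  have e1 : x * (1 + 6 * S ^ 2 + S ^ 4) = x * (2 * (1 + S ^ 2) ^ 2 - (1 - S ^ 2) ^ 2) := by ring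
  have e2 : x - 2 * S + x * S ^ 2 = x * (1 + S ^ 2) - 2 * S := by ring
  rw [e1, e2]
  generalize 1 + S ^ 2 = u at *
  generalize 1 - S ^ 2 = v at *
  subst hD hR ht
  rw [hS]
  linear_combination u ^ 6 * hF

theorem kernel_eq {K : Type*} [Field K] {x y t : K} (hx : x ≠ 0) (hy : y ≠ 0) :
    x * y * (1 - t * (1 + y⁻¹) * (x⁻¹ + x * (1 + y))) =
      x * y - t * (1 + y) * (1 + x ^ 2 * (1 + y)) := by
  field_simp
  ring

/-- Nonvanishing is certified by one rational value of the coefficient of t^0. -/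
theorem emb_ne_zero_of_eval {F : Series} (v : Fin 2 → ℚ)
    (h : MvPolynomial.eval v (PowerSeries.constantCoeff F) ≠ 0) : emb F ≠ 0 :=
  emb_ne_zero fun h0 => h (by rw [h0, map_zero])

theorem x_ne_zero : x ≠ 0 := emb_ne_zero_of_eval 1 (by simp)

theorem y_ne_zero : y ≠ 0 := emb_ne_zero_of_eval 1 (by simp)

theorem t_ne_zero : t ≠ 0 := (map_ne_zero_iff emb emb_injective).2 PowerSeries.X_ne_zero

theorem one_add_sq_x_ne_zero : 1 + x ^ 2 ≠ 0 := by
  have := emb_ne_zero_of_eval (F := 1 + PowerSeries.C (MvPolynomial.X 0) ^ 2) 0 (by simp)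
  simp only [map_add, map_one, map_pow] at this
  exact this

theorem embT_X : embT PowerSeries.X = t := by
  rw [embT_apply, seriesT, PowerSeries.map_X, t]

theorem embT_ne_zero {F : PowerSeries ℚ} (h : PowerSeries.constantCoeff F ≠ 0) : embT F ≠ 0 := by
  rw [embT_apply]
  apply emb_ne_zero_of_eval 0
  rw [constantCoeff_seriesT]
  simpa using h

theorem emb_kernel : emb kernel = x * y - t * (1 + y) * (1 + x ^ 2 * (1 + y)) := by
  simp only [kernel, map_sub, map_mul, map_add, map_one, map_pow]
  rfl

theorem emb_kernel_ne_zero : x * y - t * (1 + y) * (1 + x ^ 2 * (1 + y)) ≠ 0 := by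
  rw [← emb_kernel]
  exact emb_ne_zero_of_eval 1 (by simp [kernel])

theorem emb_functionalEquation :
    (x * y - t * (1 + y) * (1 + x ^ 2 * (1 + y))) * emb Q =
      x * y - t * (1 + x ^ 2) * emb Qx0 - t * (1 + y) * emb Q0y + t * emb Q00 := by
  have h := congrArg emb functionalEquation_Q
  rw [map_mul, emb_kernel] at h
  rw [h]
  simp only [map_sub, map_mul, map_add, map_one, map_pow]
  rfl

theorem two_ne_zero_seriesField : (2 : SeriesField) ≠ 0 := by
  have := charZero_seriesField
  exact two_ne_zero

/-- The series `T, S, R, W` and the series for `Q`, in the field of fractions. -/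
theorem exists_series : ∃ (T S : PowerSeries ℚ) (R W : PowerSeries (Polynomial ℚ)),
    (IsT T ∧ IsS T S ∧ IsR S R ∧ IsW T W) ∧
    ∃ D R₁ V : SeriesField, embT T - 4 * embT T ^ 3 = t ∧ D ^ 2 = 1 - 4 * embT T ^ 2 ∧
      R₁ ^ 2 = D ^ 2 - 4 * x * embT T ∧ V ^ 2 = 1 - 4 * (1 + y) * embT T ^ 2 ∧
      embT S = embT T * (1 + embT S ^ 2) ∧ (1 + embT S ^ 2) * D = 1 - embT S ^ 2 ∧
      embT T * D ^ 2 = t ∧ (1 + embT S ^ 2) * R₁ = embX R ∧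
      2 * t ^ 2 * (1 + x ^ 2) * x * emb Qx0 =
        x * (D * (2 - D ^ 2)) - (x - 2 * embT T) * D * R₁ - 2 * t * (1 + x ^ 2) ∧
      2 * t ^ 2 * (1 + y) ^ 2 * emb Q0y = (1 + y) - 2 - (D ^ 2 * (1 + y) - 2) * V ∧
      2 * t ^ 2 * emb Q00 = -D ^ 3 + 2 * D - 1 ∧
      1 - 2 * embT T / x ≠ 0 ∧ D ≠ 0 ∧ 1 - 4 * embT T ^ 2 - 2 / (1 + y) ≠ 0 ∧ V ≠ 0 ∧
      12 * embT T ^ 2 - 1 ≠ 0 ∧ 2 - D ^ 2 ≠ 0 ∧ 1 + embT S ^ 2 ≠ 0 ∧ 1 - embT S ^ 2 ≠ 0 := by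
  obtain ⟨T, hT⟩ := exists_isT
  obtain ⟨S, hS⟩ := exists_isS hT
  obtain ⟨R, hR⟩ := exists_isR hS
  obtain ⟨W, hW⟩ := exists_isW hT
  obtain ⟨D, hD0, hD, hTD, hSD⟩ := exists_sqrt_of_isS hT hS
  obtain ⟨R₁, hR0, hR₁, hSR⟩ := exists_sqrt_of_isR hS hR hSD
  obtain ⟨hF, hG, hQ₀⟩ := explicit_formulas hT.1 hTD hD0 hD hR0 hR₁ hW.1 hW.2 rfl
  obtain ⟨V, hV⟩ : ∃ V, V = 1 - 2 * (1 + PowerSeries.C Polynomial.X) * W := ⟨_, rfl⟩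
  rw [← hV] at hG
  have hV2 : V ^ 2 = 1 - 4 * (1 + PowerSeries.C Polynomial.X) * PowerSeries.map Polynomial.C T ^ 2 := by
    rw [hV]
    linear_combination -4 * (1 + PowerSeries.C Polynomial.X) * hW.2
  refine ⟨T, S, R, W, ⟨hT, hS, hR, hW⟩, embT D, embX R₁, embY V, ?_, ?_, ?_, ?_, ?_, ?_, ?_, ?_,
    hF, hG, hQ₀, ?_, ?_, ?_, ?_, ?_, ?_, ?_, ?_⟩
  · have := congrArg embT hT.2
    simp only [map_mul, map_sub, map_one, map_pow, map_ofNat, embT_X] at this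
    linear_combination this
  · simpa only [map_mul, map_sub, map_one, map_pow, map_ofNat] using congrArg embT hD
  · simpa only [map_mul, map_sub, map_pow, map_ofNat, embX_C_X, embX_map_C] using
      congrArg embX hR₁
  · simpa only [map_mul, map_sub, map_add, map_one, map_pow, map_ofNat, embY_C_X, embY_map_C] using
      congrArg embY hV2
  · simpa only [map_mul, map_add, map_one, map_pow] using congrArg embT hS.2
  · simpa only [map_mul, map_add, map_sub, map_one, map_pow] using congrArg embT hSD
  · simpa only [map_mul, map_pow, embT_X] using congrArg embT hTD
  · simpa only [map_mul, map_add, map_one, map_pow, embX_map_C] using congrArg embX hSR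
  · have h : emb (PowerSeries.C (MvPolynomial.X 0) - 2 * seriesT T) ≠ 0 :=
      emb_ne_zero_of_eval 1 (by simp [constantCoeff_seriesT, hT.1])
    simp only [map_sub, map_mul, map_ofNat] at h
    intro h0
    apply h
    have := x_ne_zero
    field_simp at h0
    rw [mul_zero] at h0
    exact h0
  · exact embT_ne_zero (by simp [hD0])
  · have h : emb ((1 - 4 * seriesT T ^ 2) * (1 + PowerSeries.C (MvPolynomial.X 1)) - 2) ≠ 0 :=
      emb_ne_zero_of_eval 0 (by
        simp only [map_sub, map_mul, map_add, map_one, map_pow, map_ofNat, constantCoeff_seriesT,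
          hT.1, PowerSeries.constantCoeff_C]
        norm_num)
    simp only [map_sub, map_mul, map_add, map_one, map_pow, map_ofNat] at h
    intro h0
    apply h
    have := one_add_y_ne_zero
    field_simp at h0
    rw [mul_zero] at h0
    exact h0
  · rw [embY_apply]
    exact emb_ne_zero_of_eval 0 (by rw [constantCoeff_seriesVar, hV]; simp [hW.1])
  · have : embT (12 * T ^ 2 - 1) ≠ 0 := embT_ne_zero (by simp [hT.1])
    simpa only [map_sub, map_mul, map_one, map_pow, map_ofNat] using this
  · have : embT (2 - D ^ 2) ≠ 0 := embT_ne_zero (by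
      simp only [map_sub, map_pow, map_ofNat, hD0]
      norm_num)
    simpa only [map_sub, map_pow, map_ofNat] using this
  · have : embT (1 + S ^ 2) ≠ 0 := embT_ne_zero (by simp [hS.1])
    simpa only [map_add, map_one, map_pow] using this
  · have : embT (1 - S ^ 2) ≠ 0 := embT_ne_zero (by simp [hS.1])
    simpa only [map_sub, map_one, map_pow] using this

theorem Q0y_mem_adjoin {T : PowerSeries ℚ} {W : PowerSeries (Polynomial ℚ)} (hT : IsT T)
    (hW : IsW T W) : emb Q0y ∈ IntermediateField.adjoin ℚ {embT T, embY W} := by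
  have hTk : embT T ∈ IntermediateField.adjoin ℚ {embT T, embY W} :=
    IntermediateField.subset_adjoin _ _ (by simp)
  have hWk : embY W ∈ IntermediateField.adjoin ℚ {embT T, embY W} :=
    IntermediateField.subset_adjoin _ _ (by simp)
  have htk : t ∈ IntermediateField.adjoin ℚ {embT T, embY W} := by
    rw [← embT_X, ← hT.2]
    simp only [map_mul, map_sub, map_one, map_pow, map_ofNat]
    exact mul_mem hTk (sub_mem (one_mem _) (mul_mem (ofNat_mem _ 4) (pow_mem hTk 2)))
  have h : emb Q0y = embY W * (1 - 4 * embT T ^ 2 - 2 * embY W) / t ^ 2 := by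
    rw [eq_div_iff (pow_ne_zero 2 t_ne_zero), mul_comm, sq_t_mul_Q0y hT hW]
  rw [h]
  exact div_mem (mul_mem hWk (sub_mem (sub_mem (one_mem _) (mul_mem (ofNat_mem _ 4)
    (pow_mem hTk 2))) (mul_mem (ofNat_mem _ 2) hWk))) (pow_mem htk 2)

end QuadrantWalk

end

/-! ### The main theorem -/

theorem mainTheorem4 :
    -- `Q(x,y;t)` is algebraic of degree 12 over `ℚ(x,y,t)`
    QuadrantWalk.AlgebraicOfDegree
      (IntermediateField.adjoin ℚ {QuadrantWalk.x, QuadrantWalk.y, QuadrantWalk.t})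
      (QuadrantWalk.emb QuadrantWalk.Q) 12 ∧
    -- the expression of `Q(x,y;t)`, whose denominator is not zero
    (QuadrantWalk.x * QuadrantWalk.y *
        (1 - QuadrantWalk.t * (1 + QuadrantWalk.y⁻¹) *
          (QuadrantWalk.x⁻¹ + QuadrantWalk.x * (1 + QuadrantWalk.y))) ≠ 0 ∧
      QuadrantWalk.emb QuadrantWalk.Q =
        (QuadrantWalk.x * QuadrantWalk.y
          - QuadrantWalk.t * (1 + QuadrantWalk.x ^ 2) * QuadrantWalk.emb QuadrantWalk.Qx0
          - QuadrantWalk.t * (1 + QuadrantWalk.y) * QuadrantWalk.emb QuadrantWalk.Q0y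
          + QuadrantWalk.t * QuadrantWalk.emb QuadrantWalk.Q00) /
        (QuadrantWalk.x * QuadrantWalk.y *
          (1 - QuadrantWalk.t * (1 + QuadrantWalk.y⁻¹) *
            (QuadrantWalk.x⁻¹ + QuadrantWalk.x * (1 + QuadrantWalk.y))))) ∧
    -- the series `T`, `S`, the square root `R`, and `W`
    (∃ (T S : PowerSeries ℚ) (R W : PowerSeries (Polynomial ℚ)),
      (QuadrantWalk.IsT T ∧ ∀ T', QuadrantWalk.IsT T' → T' = T) ∧
      (QuadrantWalk.IsS T S ∧ ∀ S', QuadrantWalk.IsS T S' → S' = S) ∧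
      (∀ S' : PowerSeries ℚ, PowerSeries.constantCoeff S' = 0 →
        (S' = T * (1 + S' ^ 2) ↔
          S' * (1 - S' ^ 2) ^ 2 = PowerSeries.X * (1 + S' ^ 2) ^ 3)) ∧
      (QuadrantWalk.IsR S R ∧ ∀ R', QuadrantWalk.IsR S R' → R' = R) ∧
      (QuadrantWalk.IsW T W ∧ ∀ W', QuadrantWalk.IsW T W' → W' = W) ∧
      -- `Q(x,0;t)`
      QuadrantWalk.AlgebraicOfDegree
        (IntermediateField.adjoin ℚ {QuadrantWalk.x, QuadrantWalk.t})
        (QuadrantWalk.emb QuadrantWalk.Qx0) 12 ∧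
      QuadrantWalk.AlgebraicOfDegree
        (IntermediateField.adjoin ℚ {QuadrantWalk.x, QuadrantWalk.embT S})
        (QuadrantWalk.emb QuadrantWalk.Qx0) 2 ∧
      (1 - QuadrantWalk.embT S ^ 2 ≠ 0 ∧
        2 * QuadrantWalk.x * (1 + QuadrantWalk.x ^ 2) * QuadrantWalk.embT S ^ 2 ≠ 0 ∧
        QuadrantWalk.emb QuadrantWalk.Qx0 =
          ((1 + QuadrantWalk.embT S ^ 2) / (1 - QuadrantWalk.embT S ^ 2)) ^ 3 *
            ((QuadrantWalk.x * (1 + 6 * QuadrantWalk.embT S ^ 2 + QuadrantWalk.embT S ^ 4)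
                - 2 * QuadrantWalk.embT S * (1 - QuadrantWalk.embT S ^ 2) * (1 + QuadrantWalk.x ^ 2)
                - (QuadrantWalk.x - 2 * QuadrantWalk.embT S + QuadrantWalk.x * QuadrantWalk.embT S ^ 2) *
                    QuadrantWalk.embX R) /
              (2 * QuadrantWalk.x * (1 + QuadrantWalk.x ^ 2) * QuadrantWalk.embT S ^ 2))) ∧
      -- `Q(0,y;t)`
      QuadrantWalk.AlgebraicOfDegree
        (IntermediateField.adjoin ℚ {QuadrantWalk.y, QuadrantWalk.t})
        (QuadrantWalk.emb QuadrantWalk.Q0y) 6 ∧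
      QuadrantWalk.emb QuadrantWalk.Q0y ∈
        IntermediateField.adjoin ℚ {QuadrantWalk.embT T, QuadrantWalk.embY W} ∧
      QuadrantWalk.emb QuadrantWalk.Q0y =
        QuadrantWalk.t ^ (-2 : ℤ) * QuadrantWalk.embY W *
          (1 - 4 * QuadrantWalk.embT T ^ 2 - 2 * QuadrantWalk.embY W)) ∧
    -- the coefficients of `Q(0,y;t)`
    QuadrantWalk.DoublyHypergeometric (fun n j => (QuadrantWalk.q 0 j (2 * n) : ℚ)) ∧
    (∀ n j : ℕ, j ≤ n → (QuadrantWalk.q 0 j (2 * n) : ℚ) = QuadrantWalk.coeffFormula n j) ∧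
    QuadrantWalk.Q0y = PowerSeries.mk (fun m =>
      if Even m then
        ∑ j ∈ Finset.range (m / 2 + 1),
          MvPolynomial.C (QuadrantWalk.coeffFormula (m / 2) j) * MvPolynomial.X 1 ^ j
      else 0) := by
  open QuadrantWalk in
  obtain ⟨T, S, R, W, ⟨hT, hS, hR, hW⟩, D, R₁, V, eT, eD, eR, eV, eS, eSD, eTD, eSR, hF, hG, hQ₀,
    hC, hD0, hA, hV0, h12, hD2, hS1, hS1'⟩ := exists_series
  have hx0 := x_ne_zero
  have hy0 := y_ne_zero
  have ht0 := t_ne_zero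
  have hx1 := one_add_sq_x_ne_zero
  have hw0 := one_add_y_ne_zero
  have hK := emb_kernel_ne_zero
  have hT0 : embT T ≠ 0 := by
    intro h
    apply ht0
    rw [← eT, h]
    ring
  have hS0 : embT S ≠ 0 := by
    rw [eS]
    exact mul_ne_zero hT0 hS1
  have h2 := two_ne_zero_seriesField
  have hx := @degree_x_zero SeriesField _ charZero_seriesField _ _ _ _ _ _ _ transcendental_x_t
    transcendental_t_x eT eD eR hT0 hC hD0 hx0 hD2 ht0 hx1 _ eS eSD hS1 hF
  refine ⟨?_, ⟨?_, ?_⟩, ⟨T, S, R, W, ⟨hT, fun _ => hT.unique⟩, ⟨hS, fun _ => hS.unique hT⟩,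
    fun _ => isS_iff hT, ⟨hR, fun _ => hR.unique⟩, ⟨hW, fun _ => hW.unique⟩, hx.1, hx.2,
    ⟨hS1', ?_, ?_⟩, ?_, Q0y_mem_adjoin hT hW, ?_⟩, doublyHypergeometric_q,
    fun _ _ => q_even_of_le, Q0y_eq⟩
  · exact @degree_x_y SeriesField _ charZero_seriesField _ _ _ _ _ _ _ _ _ _ _ _
      transcendental_x_y_t transcendental_y_x_t transcendental_t_x_y eT eD eR eV hT0 hC hD0 hx0 hw0
      hA hV0 h12 ht0 hK hF hG hQ₀ emb_functionalEquation
  · rw [kernel_eq hx0 hy0]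
    exact hK
  · rw [kernel_eq hx0 hy0, eq_div_iff hK, mul_comm]
    exact emb_functionalEquation
  · exact mul_ne_zero (mul_ne_zero (mul_ne_zero h2 hx0) hx1) (pow_ne_zero 2 hS0)
  · exact formula_of_sqrt hx0 hx1 hS0 hS1' h2 eS eSD eTD eSR hF
  · exact @degree_zero_y SeriesField _ charZero_seriesField _ _ _ _ _ _ _ transcendental_y_t
      transcendental_t_y eT eD eV hT0 hw0 hA h12 hD0 ht0 hG
  · rw [zpow_neg, mul_assoc, eq_inv_mul_iff_mul_eq₀ (zpow_ne_zero _ ht0)]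
    exact sq_t_mul_Q0y hT hW
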